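/- **Setting.** Let $n\ge 1$ and let $|\cdot|$ be the Euclidean norm on $\mathbb R^n$. Balls are Euclidean balls $B$, with radius $r(B)$; cubes $Q$ have sides parallel to the axes. A *weight* is a non-negative, locally integrable function $w$ on $\mathbb R^n$ that is not almost everywhere $0$, and $w(E)=\int_E w(x)\,dx$. For $1<t<\infty$ put $t'=t/(t-1)$. For $1<r<\infty$ let $$[w]_{A_r}=\sup_{B}\Big(\frac1{|B|}\int_B w\Big)\Big(\frac1{|B|}\int_B w^{1-r'}\Big)^{r-1},\qquad [w]_{A_1}=\Big\|\frac{Mw}{w}\Big\|_{L^\infty},$$ where the supremum is over all balls and $Mg(x)=\sup_{B\ni x}\frac1{|B|}\int_B|g|$; $w\in A_r$ means $[w]_{A_r}<\infty$. For a non-negative measurable function $v$ let $$[v]_{A_\infty}=\sup_Q\frac1{v(Q)}\int_Q M^{\mathcal Q}(v\chi_Q)(x)\,dx,\qquad M^{\mathcal Q}g(x)=\sup_{Q\ni x}\frac1{|Q|}\int_Q|g|,$$ with both suprema over cubes (the Fujii–Wilson constant). For $0<\alpha<n$ let $I_\alpha g(x)=\int_{\mathbb R^n}\frac{g(y)}{|x-y|^{n-\alpha}}\,dy$.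 Let $L^p(B,w)$ be the space of measurable $f$ on $B$ with $\int_B|f|^pw<\infty$; such $f$ is extended by $0$ outside $B$ when $I_\alpha f$ is formed. **Theorem.** For every $n\ge1$ there is a constant $c_n>0$, depending only on $n$, such that the following holds for all $\alpha\in(0,n)$, all $1<p<\frac n\alpha$, all $1\le r\le p$ and all $w\in A_r$. Put $p^*_\alpha=\frac{np}{n-\alpha p}$ and $\tau_n=2^{n+1}$. (i) If $r>1$ and $\sigma=w^{1-r'}$, then $[\sigma]_{A_\infty}<\infty$ and, with $q_r$ defined by $$\frac1p-\frac1{q_r}=\frac\alpha n\,\frac{\tau_n[\sigma]_{A_\infty}}{1+r(\tau_n[\sigma]_{A_\infty}-1)},$$ for every ball $B$ and every $f\in L^p(B,w)$ the integral defining $I_\alpha f(x)$ converges absolutely for almost every $x\in B$, and $$\Big(\frac1{w(B)}\int_B|I_\alpha f|^{q_r}w\Big)^{\frac1{q_r}}\le\frac{c_n}{\alpha}\,p^*_\alpha\,(p')^{\frac1{q_r}}\,[w]_{A_r}^{\frac1p}\,[\sigma]_{A_\infty}^{\frac1{q_r}}\,r(B)^\alpha\Big(\frac1{w(B)}\int_B|f|^pw\Big)^{\frac1p}.$$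 (ii) If $r=1$ and $q_1=p^*_\alpha$, then for every ball $B$ and every $f\in L^p(B,w)$ the integral defining $I_\alpha f(x)$ converges absolutely for almost every $x\in B$, and $$\Big(\frac1{w(B)}\int_B|I_\alpha f|^{q_1}w\Big)^{\frac1{q_1}}\le\frac{c_n}{\alpha}\,p^*_\alpha\,(p')^{\frac1{q_1}}\,[w]_{A_1}^{\frac1p}\,r(B)^\alpha\Big(\frac1{w(B)}\int_B|f|^pw\Big)^{\frac1p}.$$ -/

import Mathlib

open MeasureTheory Set
open scoped ENNReal

noncomputable section

namespace LocalRiesz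

/-- `ℝⁿ` with the Euclidean norm. -/
abbrev Rn (n : ℕ) : Type := EuclideanSpace ℝ (Fin n)

/-- The open axis-parallel cube with centre `c` and side length `2 * l`. -/
def cube {n : ℕ} (c : Rn n) (l : ℝ) : Set (Rn n) := {y | ∀ i, |y i - c i| < l}

/-- The conjugate exponent `t' = t / (t - 1)`, used for `1 < t`. -/
def conjExp (t : ℝ) : ℝ := t / (t - 1)

/-- The (uncentred) Hardy--Littlewood maximal function over balls, of a non-negative function. -/
def ballMaximal {n : ℕ} (g : Rn n → ℝ≥0∞) (x : Rn n) : ℝ≥0∞ :=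
  ⨆ (c : Rn n) (R : ℝ) (_ : 0 < R) (_ : x ∈ Metric.ball c R), ⨍⁻ y in Metric.ball c R, g y ∂volume

/-- The (uncentred) Hardy--Littlewood maximal function over cubes, of a non-negative function. -/
def cubeMaximal {n : ℕ} (g : Rn n → ℝ≥0∞) (x : Rn n) : ℝ≥0∞ :=
  ⨆ (c : Rn n) (l : ℝ) (_ : 0 < l) (_ : x ∈ cube c l), ⨍⁻ y in cube c l, g y ∂volume

/-- A weight: a non-negative locally integrable function that is not almost everywhere zero. -/
structure IsWeight {n : ℕ} (w : Rn n → ℝ) : Prop where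
  nonneg : ∀ x, 0 ≤ w x
  locallyIntegrable : LocallyIntegrable w volume
  not_ae_zero : ¬ (w =ᵐ[volume] 0)

/-- The Muckenhoupt constant `[w]_{A_r}`, `1 ≤ r < ∞`, with values in `[0, ∞]`. For `r > 1` it is
the supremum over all balls of `(⨍ w) (⨍ w^{1-r'})^{r-1}`; for `r = 1` it is the `L^∞` norm of
`M w / w`. Negative powers and quotients are taken in `[0, ∞]`, so they are `∞` where `w = 0`. -/
def muckenhouptConst {n : ℕ} (r : ℝ) (w : Rn n → ℝ) : ℝ≥0∞ :=
  if r = 1 then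
    essSup (fun x => ballMaximal (fun y => ENNReal.ofReal (w y)) x / ENNReal.ofReal (w x)) volume
  else
    ⨆ (c : Rn n) (R : ℝ) (_ : 0 < R),
      (⨍⁻ x in Metric.ball c R, ENNReal.ofReal (w x) ∂volume) *
        (⨍⁻ x in Metric.ball c R, ENNReal.ofReal (w x) ^ (1 - conjExp r) ∂volume) ^ (r - 1)

/-- The Muckenhoupt class `A_r`. -/
def MemMuckenhoupt {n : ℕ} (r : ℝ) (w : Rn n → ℝ) : Prop :=
  IsWeight w ∧ muckenhouptConst r w < ∞

/-- The dual weight `σ = w^{1-r'}`, used for `1 < r`. -/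
def dualWeight {n : ℕ} (r : ℝ) (w : Rn n → ℝ) (x : Rn n) : ℝ≥0∞ :=
  ENNReal.ofReal (w x) ^ (1 - conjExp r)

/-- The Fujii--Wilson constant `[v]_{A_∞} = sup_Q v(Q)⁻¹ ∫_Q M (v χ_Q)`, where `Q` runs over the
cubes and `M` is the maximal function over cubes. -/
def fujiiWilsonConst {n : ℕ} (v : Rn n → ℝ≥0∞) : ℝ≥0∞ :=
  ⨆ (c : Rn n) (l : ℝ) (_ : 0 < l),
    (∫⁻ x in cube c l, v x)⁻¹ * ∫⁻ x in cube c l, cubeMaximal ((cube c l).indicator v) x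

/-- The kernel integrand `y ↦ f y / |x - y|^{n-α}` of the fractional integral at `x`. -/
def rieszIntegrand {n : ℕ} (α : ℝ) (f : Rn n → ℝ) (x y : Rn n) : ℝ :=
  f y / ‖x - y‖ ^ ((n : ℝ) - α)

/-- The fractional integral (Riesz potential) `I_α f (x) = ∫ f y / |x - y|^{n-α} dy`. -/
def rieszPotential {n : ℕ} (α : ℝ) (f : Rn n → ℝ) (x : Rn n) : ℝ :=
  ∫ y, rieszIntegrand α f x y

/-- The weighted average `(w(B)⁻¹ ∫_B |g|^q w)^{1/q}`. -/
def weightedAverage {n : ℕ} (w : Rn n → ℝ) (B : Set (Rn n)) (q : ℝ) (g : Rn n → ℝ) : ℝ≥0∞ :=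
  ((∫⁻ x in B, ENNReal.ofReal (w x))⁻¹ *
    ∫⁻ x in B, ‖g x‖ₑ ^ q * ENNReal.ofReal (w x)) ^ (1 / q)

/-- Membership in the weighted Lebesgue space `L^p(B, w)`. -/
def MemWeightedLp {n : ℕ} (w : Rn n → ℝ) (B : Set (Rn n)) (p : ℝ) (f : Rn n → ℝ) : Prop :=
  AEStronglyMeasurable f (volume.restrict B) ∧
    ∫⁻ x in B, ‖f x‖ₑ ^ p * ENNReal.ofReal (w x) < ∞

/-- The exponent `p^*_α = n p / (n - α p)`. -/
def sobolevExponent (n : ℕ) (α p : ℝ) : ℝ := n * p / (n - α * p)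

/-- The dimensional constant `τ_n = 2^{n+1}`. -/
def tau (n : ℕ) : ℝ := 2 ^ (n + 1)

end LocalRiesz

end

open LocalRiesz

/-! The argument is Hedberg's, run with a Muckenhoupt exponent `s` below `p`. Let `f ≥ 0` be
supported in a cube `Q` of half-side `R`, and let `ν = w dx` satisfy the A_s condition in the form
`TestCondition ν s N`. Cutting the kernel into dyadic shells bounds `I_α f(x)` by a multiple of `R^α
∑ 2^(-kα) a_k`, where `a_k` is the mean of `f` over the cube of half-side `4R/2^k` about `x`. Each
`a_k` is at most the maximal function `Mf(x)`; by Jensen and the A_s condition on `Q` it is also at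
most `2^(kns/p) E`, where `E^p = N ν(Q)⁻¹ ∫ f^p dν`. Balancing the two bounds gives `(Mf)^(1-θ) E^θ`
with `θ = αp/(ns)` (`tsum_min_le`, `cubeRiesz_hedberg`). If `1/q = 1/p - α/(ns)`, then `q(1-θ) = p`,
so the `L^q(ν)` mean reduces to the `L^p(ν)` bound for `M`. That bound comes from Vitali covering
and Marcinkiewicz interpolation, with the factor `p/(p-s)` (`strong_type`).

For `r = 1` one takes `s = 1`. For `r > 1` the exponent `s < r` comes from a sharp reverse Hölder
inequality for `σ` (`reverse_holder`): with `K = 2^(n+1) [σ]_{A_∞}` and `ε = 1/(K-1)`, the mean of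
`σ^(1+ε)` over a cube is at most twice the `(1+ε)`-th power of the mean of `σ`. Hence `w ∈ A_s` as
soon as `(1+ε)(s-1) = r-1`, that is `s = (1 + r(K-1))/K`, and then `α/(ns)` is the gap `1/p -
1/q_r`. Since `p/(p-s) ≤ p' K`, this step also yields the factors `p'` and `[σ]_{A_∞}` to the power
`1/q_r`.

Finiteness of `[σ]_{A_∞}` is proved separately. The A_r condition makes `σ` give a fixed fraction of
`σ(Q)` to every half-size subset of `Q`. This bounds the integrals of truncated dyadic maximal
functions uniformly in the generation (`runMax_bound_of_large_subsets`), hence gives some reverse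
Hölder inequality, hence an `L^(1+ε)` bound for the full maximal function.

The analysis takes place in `Fin n → ℝ` with the sup norm, where balls are cubes; passing between
Euclidean balls and cubes costs only dimensional factors. -/

namespace LocalRiesz

variable {n : ℕ}

/-! ### Maximal function bounds for measures satisfying the A_s test condition. -/

/-- The average of `g` over the cube (sup-norm ball) with centre `c` and half-side `l`. -/
noncomputable def avg (g : (Fin n → ℝ) → ℝ≥0∞) (c : Fin n → ℝ) (l : ℝ) : ℝ≥0∞ :=
  (∫⁻ y in Metric.ball c l, g y) / volume (Metric.ball c l)

/-- The centred maximal function over the cubes of half-side `D / 2 ^ k`. -/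
noncomputable def dyadicMax (D : ℝ) (f : (Fin n → ℝ) → ℝ≥0∞) (x : Fin n → ℝ) : ℝ≥0∞ :=
  ⨆ k : ℕ, avg f x (D / 2 ^ k)

/-- The `A_s` condition for a measure `ν`, in terms of test functions. -/
def TestCondition (ν : Measure (Fin n → ℝ)) (s : ℝ) (N : ℝ≥0∞) : Prop :=
  ∀ (c : Fin n → ℝ) (l : ℝ), 0 < l → ∀ g : (Fin n → ℝ) → ℝ≥0∞, Measurable g →
    avg g c l ^ s * ν (Metric.ball c l) ≤ N * ∫⁻ y in Metric.ball c l, g y ^ s ∂ν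

theorem volume_cube (c : Fin n → ℝ) {l : ℝ} (hl : 0 < l) :
    volume (Metric.ball c l) = ENNReal.ofReal (2 * l) ^ n := by
  rw [Real.volume_pi_ball c hl, Fintype.card_fin, ENNReal.ofReal_pow (by positivity)]

theorem volume_cube_ne_zero (c : Fin n → ℝ) {l : ℝ} (hl : 0 < l) :
    volume (Metric.ball c l) ≠ 0 := (Metric.measure_ball_pos _ _ hl).ne'

theorem volume_cube_ne_top (c : Fin n → ℝ) (l : ℝ) :
    volume (Metric.ball c l) ≠ ∞ := measure_ball_lt_top.ne

theorem volume_cube_mul (c c' : Fin n → ℝ) {a l : ℝ} (ha : 0 < a) (hl : 0 < l) :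
    volume (Metric.ball c (a * l)) = ENNReal.ofReal a ^ n * volume (Metric.ball c' l) := by
  rw [volume_cube _ (by positivity), volume_cube _ hl, ← mul_pow, ← ENNReal.ofReal_mul ha.le]
  congr 2; ring

theorem avg_mul_volume (g : (Fin n → ℝ) → ℝ≥0∞) (c : Fin n → ℝ) {l : ℝ} (hl : 0 < l) :
    avg g c l * volume (Metric.ball c l) = ∫⁻ y in Metric.ball c l, g y :=
  ENNReal.div_mul_cancel (volume_cube_ne_zero c hl) (volume_cube_ne_top c l)

theorem measurable_avg {f : (Fin n → ℝ) → ℝ≥0∞} (hf : Measurable f) {l : ℝ} (hl : 0 < l) :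
    Measurable (fun x => avg f x l) := by
  have h : (fun x => avg f x l) = fun x =>
      (∫⁻ y, ({z : (Fin n → ℝ) × (Fin n → ℝ) | dist z.2 z.1 < l}.indicator (fun z => f z.2)) (x, y)) /
        ENNReal.ofReal (2 * l) ^ n := by
    funext x
    rw [avg, volume_cube x hl, ← lintegral_indicator Metric.isOpen_ball.measurableSet]
    rfl
  rw [h]
  refine Measurable.div_const (Measurable.lintegral_prod_right' (Measurable.indicator
    (hf.comp measurable_snd) ?_)) _
  exact measurableSet_lt (by fun_prop) measurable_const

theorem measurable_dyadicMax {f : (Fin n → ℝ) → ℝ≥0∞} (hf : Measurable f) {D : ℝ} (hD : 0 < D) :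
    Measurable (dyadicMax D f) :=
  Measurable.iSup fun _ => measurable_avg hf (by positivity)

/-- The dilation 6 absorbs the factor 5 of the Vitali lemma and the passage from closed to open
balls. -/
theorem avg_indicator_six (f : (Fin n → ℝ) → ℝ≥0∞) (c : Fin n → ℝ) {l : ℝ} (hl : 0 < l) :
    avg f c l = 6 ^ n * avg ((Metric.ball c l).indicator f) c (6 * l) := by
  rw [avg, avg, lintegral_indicator Metric.isOpen_ball.measurableSet,
    Measure.restrict_restrict Metric.isOpen_ball.measurableSet,
    inter_eq_left.2 (Metric.ball_subset_ball (by linarith)),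
    volume_cube_mul c c (by norm_num) hl, ENNReal.ofReal_ofNat, ← mul_div_assoc,
    ENNReal.mul_div_mul_left _ _ (by positivity) (by finiteness)]

/-- Vitali selection, possible since all half-sides are at most `D`. The test condition is applied
on the enlarged cube to `f` cut off to the selected cube, so doubling of `ν` is not needed as a
separate hypothesis. -/
theorem weak_type {ν : Measure (Fin n → ℝ)} {s : ℝ} {N : ℝ≥0∞} (hs : 1 ≤ s)
    (hν : TestCondition ν s N) {D : ℝ} (hD : 0 < D) {f : (Fin n → ℝ) → ℝ≥0∞}
    (hf : Measurable f) (t : ℝ≥0∞) :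
    t ^ s * ν {x | t < dyadicMax D f x} ≤ (6 ^ n) ^ s * N * ∫⁻ y, f y ^ s ∂ν := by
  have h1 : ∀ x, ∃ k : ℕ, x ∈ {x | t < dyadicMax D f x} → t < avg f x (D / 2 ^ k) := by
    intro x
    by_cases hx : t < dyadicMax D f x
    · obtain ⟨k, hk⟩ := lt_iSup_iff.1 hx
      exact ⟨k, fun _ => hk⟩
    · exact ⟨0, fun h => absurd h hx⟩
  choose k hk using h1
  set r : (Fin n → ℝ) → ℝ := fun x => D / 2 ^ k x with hr
  have hr0 : ∀ x, 0 < r x := fun x => by positivity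
  obtain ⟨u, hut, hdisj, hcov⟩ := Vitali.exists_disjoint_subfamily_covering_enlargement_closedBall
    {x | t < dyadicMax D f x} id r D
    (fun a _ => div_le_self hD.le (one_le_pow₀ (by norm_num))) 5 (by norm_num)
  have hcount : u.Countable := hdisj.countable_of_nonempty_interior fun a _ =>
    ⟨a, mem_interior.2 ⟨_, Metric.ball_subset_closedBall, Metric.isOpen_ball,
      Metric.mem_ball_self (hr0 a)⟩⟩
  have hdisj' : u.PairwiseDisjoint fun a => Metric.ball a (r a) :=
    hdisj.mono_on fun a _ => Metric.ball_subset_closedBall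
  have hsub : {x | t < dyadicMax D f x} ⊆ ⋃ b ∈ u, Metric.ball b (6 * r b) := by
    intro x hx
    obtain ⟨b, hb, hxb⟩ := hcov x hx
    refine mem_biUnion hb ?_
    have := hxb (Metric.mem_closedBall_self (hr0 x).le)
    exact Metric.closedBall_subset_ball (by nlinarith [hr0 b]) this
  have hone : ∀ b ∈ u, t ^ s * ν (Metric.ball b (6 * r b)) ≤
      (6 ^ n) ^ s * N * ∫⁻ y in Metric.ball b (r b), f y ^ s ∂ν := by
    intro b hb
    have h2 := hν b (6 * r b) (by have := hr0 b; positivity) ((Metric.ball b (r b)).indicator f)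
      (hf.indicator Metric.isOpen_ball.measurableSet)
    have h3 : t ^ s ≤ (6 ^ n) ^ s *
        avg ((Metric.ball b (r b)).indicator f) b (6 * r b) ^ s := by
      rw [← ENNReal.mul_rpow_of_nonneg _ _ (by linarith), ← avg_indicator_six f b (hr0 b)]
      exact ENNReal.rpow_le_rpow (hk b (hut hb)).le (by linarith)
    have h4 : ∫⁻ y in Metric.ball b (6 * r b), (Metric.ball b (r b)).indicator f y ^ s ∂ν =
        ∫⁻ y in Metric.ball b (r b), f y ^ s ∂ν := by
      have : (fun y => (Metric.ball b (r b)).indicator f y ^ s) =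
          (Metric.ball b (r b)).indicator fun y => f y ^ s := by
        funext y
        by_cases hy : y ∈ Metric.ball b (r b)
        · simp [hy]
        · simp [hy, ENNReal.zero_rpow_of_pos (by linarith : 0 < s)]
      rw [this, lintegral_indicator Metric.isOpen_ball.measurableSet,
        Measure.restrict_restrict Metric.isOpen_ball.measurableSet,
        inter_eq_left.2 (Metric.ball_subset_ball (by linarith [hr0 b]))]
    rw [h4] at h2
    calc t ^ s * ν (Metric.ball b (6 * r b)) ≤ (6 ^ n) ^ s *
        avg ((Metric.ball b (r b)).indicator f) b (6 * r b) ^ s * ν (Metric.ball b (6 * r b)) := by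
          gcongr
      _ ≤ (6 ^ n) ^ s * (N * ∫⁻ y in Metric.ball b (r b), f y ^ s ∂ν) := by
          rw [mul_assoc]; gcongr
      _ = _ := by rw [mul_assoc]
  have := hcount.to_subtype
  calc t ^ s * ν {x | t < dyadicMax D f x}
      ≤ t ^ s * ∑' b : u, ν (Metric.ball (b : Fin n → ℝ) (6 * r b)) := by
        gcongr
        exact (measure_mono hsub).trans (measure_biUnion_le ν hcount _)
    _ = ∑' b : u, t ^ s * ν (Metric.ball (b : Fin n → ℝ) (6 * r b)) := ENNReal.tsum_mul_left.symm
    _ ≤ ∑' b : u, (6 ^ n) ^ s * N * ∫⁻ y in Metric.ball (b : Fin n → ℝ) (r b), f y ^ s ∂ν :=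
        ENNReal.tsum_le_tsum fun b => hone b b.2
    _ = (6 ^ n) ^ s * N * ∫⁻ y in ⋃ b : u, Metric.ball (b : Fin n → ℝ) (r b), f y ^ s ∂ν := by
        rw [ENNReal.tsum_mul_left, lintegral_iUnion (fun b => Metric.isOpen_ball.measurableSet)]
        intro a b hab
        exact hdisj' a.2 b.2 fun h => hab (Subtype.ext h)
    _ ≤ _ := by gcongr; exact Measure.restrict_le_self

theorem rpow_eq_lintegral_of_ne_top {a : ℝ≥0∞} (ha : a ≠ ∞) {p : ℝ} (hp : 0 < p) :
    a ^ p = ∫⁻ t in Ioi (0 : ℝ),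
      if ENNReal.ofReal t < a then ENNReal.ofReal (p * t ^ (p - 1)) else 0 := by
  -- The layer-cake formula for a constant function on a one-point space.
  have h := lintegral_rpow_eq_lintegral_meas_lt_mul (Measure.dirac ()) (f := fun _ => a.toReal)
    (Filter.Eventually.of_forall fun _ => ENNReal.toReal_nonneg) aemeasurable_const hp
  rw [lintegral_dirac, ← ENNReal.ofReal_rpow_of_nonneg ENNReal.toReal_nonneg hp.le,
    ENNReal.ofReal_toReal ha] at h
  rw [h, ← lintegral_const_mul' _ _ (by finiteness)]
  refine setLIntegral_congr_fun measurableSet_Ioi fun t ht => ?_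
  have ht' : (0 : ℝ) ≤ t := le_of_lt ht
  have hiff : t < a.toReal ↔ ENNReal.ofReal t < a := by
    rw [ENNReal.ofReal_lt_iff_lt_toReal ht' ha]
  by_cases hta : t < a.toReal
  · simp [hta, hiff.1 hta, ENNReal.ofReal_mul hp.le]
  · simp [hta, hiff.not.1 hta]

/-- At `a = ∞` the integral dominates the one for `r^(1/p)` with any finite `r`, so it is infinite
too. -/
theorem rpow_eq_lintegral (a : ℝ≥0∞) {p : ℝ} (hp : 0 < p) :
    a ^ p = ∫⁻ t in Ioi (0 : ℝ),
      if ENNReal.ofReal t < a then ENNReal.ofReal (p * t ^ (p - 1)) else 0 := by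
  rcases eq_or_ne a ∞ with rfl | ha
  · rw [ENNReal.top_rpow_of_pos hp]
    symm
    refine ENNReal.eq_top_of_forall_nnreal_le fun r => ?_
    have h : ((r : ℝ≥0∞) ^ p⁻¹) ^ p = r := by
      rw [← ENNReal.rpow_mul, inv_mul_cancel₀ hp.ne', ENNReal.rpow_one]
    rw [← h, rpow_eq_lintegral_of_ne_top (by finiteness) hp]
    refine lintegral_mono fun t => ?_
    dsimp only
    split_ifs <;> simp_all
  · exact rpow_eq_lintegral_of_ne_top ha hp

theorem avg_le_avg_add {f g : (Fin n → ℝ) → ℝ≥0∞} {τ : ℝ≥0∞} (hfg : ∀ y, f y ≤ g y + τ)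
    (c : Fin n → ℝ) {l : ℝ} (hl : 0 < l) : avg f c l ≤ avg g c l + τ := by
  have h : ∫⁻ y in Metric.ball c l, f y ≤
      (∫⁻ y in Metric.ball c l, g y) + τ * volume (Metric.ball c l) := by
    rw [← setLIntegral_const, ← lintegral_add_right _ measurable_const]
    exact lintegral_mono hfg
  unfold avg
  refine ENNReal.div_le_of_le_mul ?_
  rwa [add_mul, ENNReal.div_mul_cancel (volume_cube_ne_zero c hl) (volume_cube_ne_top c l)]

theorem dyadicMax_le_add {f g : (Fin n → ℝ) → ℝ≥0∞} {τ : ℝ≥0∞} (hfg : ∀ y, f y ≤ g y + τ)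
    {D : ℝ} (hD : 0 < D) (x : Fin n → ℝ) : dyadicMax D f x ≤ dyadicMax D g x + τ :=
  iSup_le fun k => (avg_le_avg_add hfg x (by positivity)).trans
    (add_le_add_left (le_iSup (fun k : ℕ => avg g x (D / 2 ^ k)) k) _)

/-- The truncation step of Marcinkiewicz interpolation: the part of `f` that is at most `t/2`
contributes at most `t/2` to the maximal function, so the weak type bound is needed only for `f`
restricted to `{2f > t}`. -/
theorem distribution_bound {ν : Measure (Fin n → ℝ)} {s p : ℝ} {N : ℝ≥0∞} (hs : 1 ≤ s)
    (hsp : s < p) (hν : TestCondition ν s N) {D : ℝ} (hD : 0 < D) {f : (Fin n → ℝ) → ℝ≥0∞}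
    (hf : Measurable f) {t : ℝ} (ht : 0 < t) :
    ENNReal.ofReal (p * t ^ (p - 1)) * ν {x | ENNReal.ofReal t < dyadicMax D f x} ≤
      (6 ^ n) ^ s * N * ∫⁻ x, f x ^ s * (if ENNReal.ofReal t < 2 * f x then
        ENNReal.ofReal (2 ^ s * p * t ^ (p - s - 1)) else 0) ∂ν := by
  set S := {y | ENNReal.ofReal t < 2 * f y} with hS
  have hSm : MeasurableSet S := measurableSet_lt measurable_const (hf.const_mul 2)
  have hsub : {x | ENNReal.ofReal t < dyadicMax D f x} ⊆
      {x | ENNReal.ofReal (t / 2) < dyadicMax D (S.indicator f) x} := by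
    intro x hx
    rw [mem_ofPred_eq] at hx ⊢
    by_contra! hcon
    have h1 : dyadicMax D f x ≤ dyadicMax D (S.indicator f) x + ENNReal.ofReal (t / 2) := by
      refine dyadicMax_le_add (fun y => ?_) hD x
      by_cases hy : y ∈ S
      · simp [hy]
      · rw [indicator_of_notMem hy, zero_add, ENNReal.ofReal_div_of_pos (by norm_num),
          ENNReal.le_div_iff_mul_le (by simp) (by simp)]
        simpa [hS, mul_comm] using hy
    have h2 : dyadicMax D f x ≤ ENNReal.ofReal t := by
      refine h1.trans ((add_le_add_left hcon _).trans ?_)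
      rw [← ENNReal.ofReal_add (by positivity) (by positivity), add_halves]
    exact absurd hx (not_lt.2 h2)
  have hw := weak_type hs hν hD (hf.indicator hSm) (ENNReal.ofReal (t / 2))
  have hc : ENNReal.ofReal (p * t ^ (p - 1)) =
      ENNReal.ofReal (2 ^ s * p * t ^ (p - s - 1)) * ENNReal.ofReal (t / 2) ^ s := by
    rw [ENNReal.ofReal_rpow_of_pos (by positivity), ← ENNReal.ofReal_mul (by
      have : 0 < p := by linarith
      positivity)]
    congr 1
    rw [Real.div_rpow ht.le (by norm_num), show p - 1 = (p - s - 1) + s by ring, Real.rpow_add ht]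
    field_simp
  have hI : ∫⁻ x, f x ^ s * (if ENNReal.ofReal t < 2 * f x then
        ENNReal.ofReal (2 ^ s * p * t ^ (p - s - 1)) else 0) ∂ν =
      ENNReal.ofReal (2 ^ s * p * t ^ (p - s - 1)) * ∫⁻ y, S.indicator f y ^ s ∂ν := by
    rw [← lintegral_const_mul' _ _ (by finiteness)]
    refine lintegral_congr fun x => ?_
    by_cases hx : x ∈ S
    · rw [indicator_of_mem hx, if_pos (by exact hx), mul_comm]
    · rw [indicator_of_notMem hx, if_neg (by exact hx), ENNReal.zero_rpow_of_pos (by linarith)]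
      simp
  rw [hI, hc, mul_assoc]
  calc _ ≤ ENNReal.ofReal (2 ^ s * p * t ^ (p - s - 1)) *
        (ENNReal.ofReal (t / 2) ^ s *
          ν {x | ENNReal.ofReal (t / 2) < dyadicMax D (S.indicator f) x}) := by gcongr
    _ ≤ ENNReal.ofReal (2 ^ s * p * t ^ (p - s - 1)) *
        ((6 ^ n) ^ s * N * ∫⁻ y, S.indicator f y ^ s ∂ν) := by gcongr
    _ = _ := by ring

/-- Integrate the distributional bound in `t` and exchange integrals; the factor `1/(p-s)` is the
integral of `t^(p-s-1)` up to `2f(x)`. It is kept explicit because the dependence on `p'` and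
`[σ]_{A_∞}` comes from it. -/
theorem strong_type {ν : Measure (Fin n → ℝ)} [SFinite ν] {s p : ℝ} {N : ℝ≥0∞} (hs : 1 ≤ s)
    (hsp : s < p) (hν : TestCondition ν s N) {D : ℝ} (hD : 0 < D) {f : (Fin n → ℝ) → ℝ≥0∞}
    (hf : Measurable f) :
    ∫⁻ x, dyadicMax D f x ^ p ∂ν ≤
      2 ^ p * (6 ^ n) ^ s * N * ENNReal.ofReal (p / (p - s)) * ∫⁻ x, f x ^ p ∂ν := by
  have hp : 0 < p := by linarith
  have hps : 0 < p - s := by linarith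
  have hM := measurable_dyadicMax hf hD
  calc ∫⁻ x, dyadicMax D f x ^ p ∂ν
      = ∫⁻ x, (∫⁻ t in Ioi (0 : ℝ), (if ENNReal.ofReal t < dyadicMax D f x then
          ENNReal.ofReal (p * t ^ (p - 1)) else 0)) ∂ν := by
        refine lintegral_congr fun x => rpow_eq_lintegral _ hp
    _ = ∫⁻ t in Ioi (0 : ℝ), ∫⁻ x, (if ENNReal.ofReal t < dyadicMax D f x then
          ENNReal.ofReal (p * t ^ (p - 1)) else 0) ∂ν := by
        refine lintegral_lintegral_swap (Measurable.aemeasurable ?_)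
        refine Measurable.ite (measurableSet_lt ?_ ?_) ?_ measurable_const
        · fun_prop
        · exact hM.comp measurable_fst
        · fun_prop
    _ ≤ ∫⁻ t in Ioi (0 : ℝ), (6 ^ n) ^ s * N * ∫⁻ x, f x ^ s * (if ENNReal.ofReal t < 2 * f x then
        ENNReal.ofReal (2 ^ s * p * t ^ (p - s - 1)) else 0) ∂ν := by
        refine setLIntegral_mono' measurableSet_Ioi fun t ht => ?_
        refine le_trans (le_of_eq ?_) (distribution_bound hs hsp hν hD hf ht)
        rw [← lintegral_indicator_const (measurableSet_lt measurable_const hM)]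
        refine lintegral_congr fun x => ?_
        simp only [indicator_apply, mem_ofPred_eq]
    _ = (6 ^ n) ^ s * N * ∫⁻ t in Ioi (0 : ℝ), ∫⁻ x, f x ^ s * (if ENNReal.ofReal t < 2 * f x then
        ENNReal.ofReal (2 ^ s * p * t ^ (p - s - 1)) else 0) ∂ν := by
        refine lintegral_const_mul _ (Measurable.lintegral_prod_right' (f := fun z : ℝ × _ =>
          f z.2 ^ s * (if ENNReal.ofReal z.1 < 2 * f z.2 then
            ENNReal.ofReal (2 ^ s * p * z.1 ^ (p - s - 1)) else 0)) ?_)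
        refine Measurable.mul (by fun_prop) (Measurable.ite (measurableSet_lt ?_ ?_) ?_
          measurable_const) <;> fun_prop
    _ = (6 ^ n) ^ s * N * ∫⁻ x, (∫⁻ t in Ioi (0 : ℝ), f x ^ s *
        (if ENNReal.ofReal t < 2 * f x then
          ENNReal.ofReal (2 ^ s * p * t ^ (p - s - 1)) else 0)) ∂ν := by
        congr 1
        refine lintegral_lintegral_swap (Measurable.aemeasurable ?_)
        refine Measurable.mul (by fun_prop) (Measurable.ite (measurableSet_lt ?_ ?_) ?_
          measurable_const) <;> fun_prop
    _ = (6 ^ n) ^ s * N * ∫⁻ x, 2 ^ p * ENNReal.ofReal (p / (p - s)) * f x ^ p ∂ν := by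
        congr 1
        refine lintegral_congr fun x => ?_
        rw [lintegral_const_mul _ (Measurable.ite (measurableSet_lt (by fun_prop)
          measurable_const) (by fun_prop) measurable_const)]
        have h1 : ∀ t : ℝ, (if ENNReal.ofReal t < 2 * f x then
            ENNReal.ofReal (2 ^ s * p * t ^ (p - s - 1)) else 0) =
            ENNReal.ofReal (2 ^ s * (p / (p - s))) * (if ENNReal.ofReal t < 2 * f x then
            ENNReal.ofReal ((p - s) * t ^ (p - s - 1)) else 0) := by
          intro t
          split_ifs
          · rw [← ENNReal.ofReal_mul (by positivity)]
            congr 1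
            field_simp
          · simp
        simp_rw [h1]
        rw [lintegral_const_mul' _ _ (by finiteness), ← rpow_eq_lintegral _ hps,
          ENNReal.mul_rpow_of_nonneg _ _ hps.le, ENNReal.ofReal_mul (by positivity),
          ← ENNReal.ofReal_rpow_of_pos (by norm_num), ENNReal.ofReal_ofNat]
        have h2 : f x ^ p = f x ^ s * f x ^ (p - s) := by
          rw [← ENNReal.rpow_add_of_nonneg _ _ (by linarith) hps.le]; congr 1; ring
        have h3 : (2 : ℝ≥0∞) ^ p = 2 ^ s * 2 ^ (p - s) := by
          rw [← ENNReal.rpow_add_of_nonneg _ _ (by linarith) hps.le]; congr 1; ring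
        rw [h2, h3]; ring
    _ = _ := by
        rw [lintegral_const_mul' _ _ (by finiteness)]; ring

theorem testCondition_volume : TestCondition (volume : Measure (Fin n → ℝ)) 1 1 := by
  intro c l hl g _
  simp [avg_mul_volume g c hl]

/-! ### Summing a decaying against a growing geometric bound. -/

theorem inv_one_sub_two_rpow_le {β : ℝ} (hβ : 0 < β) : (1 - (2 : ℝ) ^ (-β))⁻¹ ≤ 1 + 2 / β := by
  have h1 : 1 + β / 2 ≤ (2 : ℝ) ^ β := by
    rw [Real.rpow_def_of_pos (by norm_num)]
    have := Real.add_one_le_exp (Real.log 2 * β)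
    nlinarith [Real.log_two_gt_d9]
  have h2 : (2 : ℝ) ^ (-β) ≤ (1 + β / 2)⁻¹ := by
    rw [Real.rpow_neg (by norm_num)]
    exact inv_anti₀ (by positivity) h1
  have h3 : 1 - (1 + β / 2)⁻¹ = (1 + 2 / β)⁻¹ := by field_simp; ring
  rw [← inv_inv (1 + 2 / β)]
  refine inv_anti₀ (by positivity) ?_
  linarith

theorem two_rpow_mul (a b : ℝ) : (2 : ℝ≥0∞) ^ a * 2 ^ b = 2 ^ (a + b) :=
  (ENNReal.rpow_add _ _ (by norm_num) (by norm_num)).symm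

theorem tsum_two_rpow_le {β : ℝ} (hβ : 0 < β) :
    ∑' j : ℕ, (2 : ℝ≥0∞) ^ (-(j * β)) ≤ ENNReal.ofReal (1 + 2 / β) := by
  have h : ∀ j : ℕ, (2 : ℝ≥0∞) ^ (-(j * β)) = ((2 : ℝ≥0∞) ^ (-β)) ^ j := by
    intro j
    rw [← ENNReal.rpow_natCast, ← ENNReal.rpow_mul]
    congr 1; ring
  have h1 : (2 : ℝ) ^ (-β) < 1 := Real.rpow_lt_one_of_one_lt_of_neg (by norm_num) (by linarith)
  simp_rw [h]
  rw [ENNReal.tsum_geometric]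
  have h2 : (2 : ℝ≥0∞) ^ (-β) = ENNReal.ofReal (2 ^ (-β)) := by
    rw [← ENNReal.ofReal_rpow_of_pos (by norm_num), ENNReal.ofReal_ofNat]
  rw [h2, ← ENNReal.ofReal_one, ← ENNReal.ofReal_sub _ (by positivity),
    ← ENNReal.ofReal_inv_of_pos (by linarith)]
  exact ENNReal.ofReal_le_ofReal (inv_one_sub_two_rpow_le hβ)

/-- Split the series at `⌈θ⌉₊`: each side is dominated by a geometric series in the distance to the
splitting index. If `θ ≤ 0` the lower part is empty. -/
theorem tsum_min_le_aux {α β θ : ℝ} (hα : 0 < α) (hβ : 0 < β) (g : ℕ → ℝ≥0∞)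
    (h1 : ∀ k : ℕ, g k ≤ 2 ^ (-((k - θ) * α))) (h2 : ∀ k : ℕ, g k ≤ 2 ^ (-((θ - k) * β))) :
    ∑' k, g k ≤ ENNReal.ofReal (1 + 2 / α + (1 + 2 / β)) := by
  set m := ⌈θ⌉₊ with hm
  have hsplit : ∑ i ∈ Finset.range m, g i + ∑' i, g (i + m) = ∑' i, g i :=
    Summable.sum_add_tsum_nat_add' ENNReal.summable
  rw [← hsplit, ENNReal.ofReal_add (by positivity) (by positivity),
    add_comm]
  refine add_le_add (le_trans (ENNReal.tsum_le_tsum fun j => (h1 (j + m)).trans ?_)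
    (tsum_two_rpow_le hα)) ?_
  · refine ENNReal.rpow_le_rpow_of_exponent_le (by norm_num) ?_
    have := Nat.le_ceil θ
    push_cast
    nlinarith
  · rw [← Finset.sum_range_reflect]
    refine le_trans (Finset.sum_le_sum (g := fun j : ℕ => (2 : ℝ≥0∞) ^ (-(j * β)))
      fun j hj => (h2 _).trans ?_) ((ENNReal.sum_le_tsum _).trans (tsum_two_rpow_le hβ))
    refine ENNReal.rpow_le_rpow_of_exponent_le (by norm_num) ?_
    have hj' : j < m := Finset.mem_range.1 hj
    have hpos : 0 < m := by omega
    have hθ : (m : ℝ) < θ + 1 := Nat.ceil_lt_add_one (Nat.ceil_pos.1 hpos).le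
    rw [Nat.sub_sub, Nat.cast_sub (by omega)]
    push_cast
    nlinarith

/-- Hedberg's optimisation. The bounds `M` and `2^(kγ) E` cross at a real index `θ`, the terms decay
geometrically on both sides of it, and the value at the crossing is `M^(1-α/γ) E^(α/γ)`. -/
theorem tsum_min_le {α γ : ℝ} (hα : 0 < α) (hγ : α < γ) (M E : ℝ≥0∞) :
    ∑' k : ℕ, (2 : ℝ≥0∞) ^ (-(k * α)) * min M (2 ^ (k * γ) * E) ≤
      ENNReal.ofReal (1 + 2 / α + (1 + 2 / (γ - α))) * (M ^ (1 - α / γ) * E ^ (α / γ)) := by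
  have hγ0 : 0 < γ := hα.trans hγ
  have hr : 0 < α / γ := by positivity
  have hr1 : 0 < 1 - α / γ := by rw [sub_pos, div_lt_one hγ0]; exact hγ
  have hC : ENNReal.ofReal (1 + 2 / α + (1 + 2 / (γ - α))) ≠ 0 := by
    have : 0 < γ - α := by linarith
    exact (ENNReal.ofReal_pos.2 (by positivity)).ne'
  rcases eq_or_ne M 0 with rfl | hM0
  · simp
  rcases eq_or_ne E 0 with rfl | hE0
  · simp
  rcases eq_or_ne M ∞ with rfl | hM
  · rw [ENNReal.top_rpow_of_pos hr1, ENNReal.top_mul (by simp [ENNReal.rpow_eq_zero_iff, hE0,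
      hr.not_gt]), ENNReal.mul_top hC]
    exact le_top
  rcases eq_or_ne E ∞ with rfl | hE
  · rw [ENNReal.top_rpow_of_pos hr, ENNReal.mul_top (by simp [ENNReal.rpow_eq_zero_iff, hM0,
      hr1.not_gt]), ENNReal.mul_top hC]
    exact le_top
  -- The crossing index; it may be negative or fractional.
  obtain ⟨θ, hθ⟩ : ∃ θ : ℝ, M = E * 2 ^ (θ * γ) := by
    have hpos : 0 < (M / E).toReal :=
      ENNReal.toReal_pos (ENNReal.div_pos hM0 hE).ne' (ENNReal.div_ne_top hM hE0)
    refine ⟨Real.logb 2 (M / E).toReal / γ, ?_⟩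
    rw [div_mul_cancel₀ _ hγ0.ne']
    have : (2 : ℝ≥0∞) ^ (Real.logb 2 (M / E).toReal) = M / E := by
      rw [← ENNReal.ofReal_ofNat, ENNReal.ofReal_rpow_of_pos (by norm_num),
        Real.rpow_logb (by norm_num) (by norm_num) hpos,
        ENNReal.ofReal_toReal (ENNReal.div_ne_top hM hE0)]
    rw [this, ENNReal.mul_div_cancel hE0 hE]
  have hT : M ^ (1 - α / γ) * E ^ (α / γ) = E * 2 ^ (θ * (γ - α)) := by
    rw [hθ, ENNReal.mul_rpow_of_nonneg _ _ hr1.le, ← ENNReal.rpow_mul, mul_right_comm,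
      ← ENNReal.rpow_add _ _ hE0 hE]
    congr 2
    · rw [sub_add_cancel, ENNReal.rpow_one]
    · field_simp
  rw [hT]
  have hmain := tsum_min_le_aux (θ := θ) hα (sub_pos.2 hγ)
    (fun k : ℕ => min ((2 : ℝ≥0∞) ^ (-((k - θ) * α))) (2 ^ (-((θ - k) * (γ - α)))))
    (fun k => min_le_left _ _) (fun k => min_le_right _ _)
  have hterm : ∀ k : ℕ, (2 : ℝ≥0∞) ^ (-(k * α)) * min M (2 ^ (k * γ) * E) =
      min ((2 : ℝ≥0∞) ^ (-((k - θ) * α))) (2 ^ (-((θ - k) * (γ - α)))) *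
        (E * 2 ^ (θ * (γ - α))) := by
    intro k
    rw [mul_min, min_mul, hθ]
    congr 1
    · rw [mul_left_comm, mul_left_comm _ E, two_rpow_mul, two_rpow_mul]
      congr 2; ring
    · rw [mul_comm _ E, mul_left_comm, mul_left_comm _ E, two_rpow_mul, two_rpow_mul]
      congr 2; ring
  simp_rw [hterm]
  rw [ENNReal.tsum_mul_right]
  gcongr

/-! ### Hedberg's inequality and the averaged bound for the fractional integral. -/

/-- The fractional integral of a non-negative function, with the sup norm in the kernel. -/
noncomputable def cubeRiesz (α : ℝ) (f : (Fin n → ℝ) → ℝ≥0∞) (x : Fin n → ℝ) : ℝ≥0∞ :=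
  ∫⁻ y, f y * ENNReal.ofReal ((‖x - y‖ ^ ((n : ℝ) - α))⁻¹)

/-- One term already suffices: choose `k` with `R/2^k < ‖x - y‖ ≤ 2R/2^k`. On the diagonal the
kernel is `0`, as `0⁻¹ = 0`. -/
theorem riesz_kernel_le {α : ℝ} (hαn : α < n) {R : ℝ} (hR : 0 < R) {x y : Fin n → ℝ}
    (hxy : ‖x - y‖ ≤ 2 * R) :
    ENNReal.ofReal ((‖x - y‖ ^ ((n : ℝ) - α))⁻¹) ≤
      ∑' k : ℕ, (Metric.ball x (4 * R / 2 ^ k)).indicator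
        (fun _ => ENNReal.ofReal (((R / 2 ^ k) ^ ((n : ℝ) - α))⁻¹)) y := by
  have hα' : 0 < (n : ℝ) - α := by linarith
  rcases (norm_nonneg (x - y)).eq_or_lt with h0 | h0
  · rw [← h0, Real.zero_rpow hα'.ne', inv_zero, ENNReal.ofReal_zero]
    exact zero_le
  obtain ⟨k, hk1, hk2⟩ := exists_nat_pow_near_of_lt_one (x := ‖x - y‖ / (2 * R)) (y := (1 / 2 : ℝ))
    (by positivity) (by rw [div_le_one (by positivity)]; exact hxy) (by norm_num) (by norm_num)
  rw [div_le_iff₀ (by positivity), one_div, inv_pow] at hk2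
  rw [lt_div_iff₀ (by positivity), one_div, inv_pow, pow_succ] at hk1
  have hmem : y ∈ Metric.ball x (4 * R / 2 ^ k) := by
    rw [Metric.mem_ball', dist_eq_norm, div_eq_inv_mul]
    refine hk2.trans_lt ?_
    gcongr
    norm_num
  refine le_trans ?_ (ENNReal.le_tsum k)
  rw [indicator_of_mem hmem]
  refine ENNReal.ofReal_le_ofReal (inv_anti₀ (by positivity) ?_)
  refine Real.rpow_le_rpow (by positivity) ?_ hα'.le
  rw [div_eq_inv_mul]
  rw [mul_inv] at hk1
  linarith

/-- The cube of half-side `4R/2^k` has volume `(8R/2^k)^n`; against the kernel size `(R/2^k)^(α-n)`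
this leaves `8^n R^α 2^(-kα)`. -/
theorem cubeRiesz_le_tsum {α : ℝ} (hαn : α < n) {R : ℝ} (hR : 0 < R)
    {x₀ x : Fin n → ℝ} (hx : x ∈ Metric.ball x₀ R) {f : (Fin n → ℝ) → ℝ≥0∞}
    (hf : Measurable f) (hsupp : ∀ y ∉ Metric.ball x₀ R, f y = 0) :
    cubeRiesz α f x ≤ ENNReal.ofReal (8 ^ n * R ^ α) *
      ∑' k : ℕ, (2 : ℝ≥0∞) ^ (-(k * α)) * avg f x (4 * R / 2 ^ k) := by
  have hpt : ∀ y, f y * ENNReal.ofReal ((‖x - y‖ ^ ((n : ℝ) - α))⁻¹) ≤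
      ∑' k : ℕ, ENNReal.ofReal (((R / 2 ^ k) ^ ((n : ℝ) - α))⁻¹) *
        (Metric.ball x (4 * R / 2 ^ k)).indicator f y := by
    intro y
    by_cases hy : y ∈ Metric.ball x₀ R
    · have hxy : ‖x - y‖ ≤ 2 * R := by
        rw [← dist_eq_norm]
        have := dist_triangle_right x y x₀
        rw [Metric.mem_ball] at hx hy
        linarith
      refine (mul_le_mul_right (riesz_kernel_le hαn hR hxy) (f y)).trans_eq ?_
      rw [← ENNReal.tsum_mul_left]
      refine tsum_congr fun k => ?_
      by_cases hk : y ∈ Metric.ball x (4 * R / 2 ^ k)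
      · rw [indicator_of_mem hk, indicator_of_mem hk, mul_comm]
      · simp [indicator_of_notMem hk]
    · rw [hsupp y hy, zero_mul]
      exact zero_le
  refine (lintegral_mono hpt).trans ?_
  rw [lintegral_tsum (fun k => ((hf.indicator Metric.isOpen_ball.measurableSet).const_mul
    _).aemeasurable), ← ENNReal.tsum_mul_left]
  refine ENNReal.tsum_le_tsum fun k => ?_
  rw [lintegral_const_mul' _ _ (by finiteness), lintegral_indicator Metric.isOpen_ball.measurableSet,
    ← avg_mul_volume f x (by positivity), volume_cube x (by positivity), mul_comm (avg _ _ _),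
    ← mul_assoc, ← mul_assoc]
  refine mul_le_mul_left (le_of_eq ?_) _
  have h2 : (2 : ℝ≥0∞) ^ (-(k * α)) = ENNReal.ofReal (2 ^ (-(k * α))) := by
    rw [← ENNReal.ofReal_rpow_of_pos (by norm_num), ENNReal.ofReal_ofNat]
  rw [h2, ← ENNReal.ofReal_pow (by positivity), ← ENNReal.ofReal_mul (by positivity),
    ← ENNReal.ofReal_mul (by positivity)]
  congr 1
  have h3 : (2 * (4 * R / 2 ^ k)) = 8 * (R / 2 ^ k) := by ring
  have h4 : (0 : ℝ) < R / 2 ^ k := by positivity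
  rw [h3, ← Real.rpow_neg h4.le, mul_pow, ← Real.rpow_natCast (R / 2 ^ k), mul_left_comm,
    ← Real.rpow_add h4]
  rw [show -((n : ℝ) - α) + n = α by ring, Real.div_rpow hR.le (by positivity),
    Real.rpow_neg (by norm_num), Real.rpow_mul (by norm_num), Real.rpow_natCast]
  field_simp

theorem lintegral_rpow_le_mul_measure {X : Type*} [MeasurableSpace X] (μ : Measure X)
    {f : X → ℝ≥0∞} (hf : AEMeasurable f μ) {t : ℝ} (ht : 1 ≤ t) :
    (∫⁻ x, f x ∂μ) ^ t ≤ (∫⁻ x, f x ^ t ∂μ) * μ univ ^ (t - 1) := by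
  rcases ht.eq_or_lt with rfl | ht1
  · simp
  have hc := Real.HolderConjugate.conjExponent ht1
  have h := ENNReal.lintegral_mul_le_Lp_mul_Lq μ hc hf (g := fun _ => 1) aemeasurable_const
  simp only [Pi.mul_apply, mul_one, ENNReal.one_rpow, lintegral_const, one_mul] at h
  refine (ENNReal.rpow_le_rpow h (by linarith)).trans_eq ?_
  rw [ENNReal.mul_rpow_of_nonneg _ _ (by linarith), ← ENNReal.rpow_mul, ← ENNReal.rpow_mul,
    one_div_mul_cancel (by linarith), ENNReal.rpow_one]
  congr 2
  rw [Real.conjExponent]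
  field_simp

theorem avg_rpow_le {f : (Fin n → ℝ) → ℝ≥0∞} (hf : AEMeasurable f) (c : Fin n → ℝ) {l t : ℝ}
    (hl : 0 < l) (ht : 1 ≤ t) : avg f c l ^ t ≤ avg (fun y => f y ^ t) c l := by
  have h := lintegral_rpow_le_mul_measure (volume.restrict (Metric.ball c l)) hf.restrict ht
  rw [Measure.restrict_apply_univ] at h
  have h0 := volume_cube_ne_zero c hl
  have h1 := volume_cube_ne_top c l
  unfold avg
  rw [ENNReal.div_rpow_of_nonneg _ _ (by linarith)]
  refine ENNReal.div_le_of_le_mul (h.trans_eq ?_)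
  rw [ENNReal.rpow_sub _ _ h0 h1, ENNReal.rpow_one, div_eq_mul_inv, div_eq_mul_inv]
  ring

theorem avg_le_of_support {g : (Fin n → ℝ) → ℝ≥0∞} {x₀ : Fin n → ℝ} {R : ℝ} (hR : 0 < R)
    (hsupp : ∀ y ∉ Metric.ball x₀ R, g y = 0) (x : Fin n → ℝ) (k : ℕ) :
    avg g x (4 * R / 2 ^ k) ≤ (2 ^ k) ^ n * avg g x₀ R := by
  have h1 : ∫⁻ y in Metric.ball x (4 * R / 2 ^ k), g y ≤ ∫⁻ y in Metric.ball x₀ R, g y := by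
    rw [← lintegral_indicator Metric.isOpen_ball.measurableSet,
      ← lintegral_indicator Metric.isOpen_ball.measurableSet]
    refine lintegral_mono fun y => ?_
    by_cases hy : y ∈ Metric.ball x₀ R
    · rw [indicator_of_mem hy]; exact indicator_le_self _ _ y
    · by_cases hy' : y ∈ Metric.ball x (4 * R / 2 ^ k) <;> simp [hy, hsupp y hy]
  have h2 : volume (Metric.ball x₀ R) ≤ (2 ^ k) ^ n * volume (Metric.ball x (4 * R / 2 ^ k)) := by
    rw [volume_cube _ hR, volume_cube _ (by positivity), ← mul_pow]
    gcongr
    rw [show (2 : ℝ≥0∞) ^ k = ENNReal.ofReal (2 ^ k) by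
      rw [ENNReal.ofReal_pow (by norm_num), ENNReal.ofReal_ofNat],
      ← ENNReal.ofReal_mul (by positivity)]
    refine ENNReal.ofReal_le_ofReal ?_
    field_simp
    norm_num
  unfold avg
  refine ENNReal.div_le_of_le_mul (h1.trans ?_)
  rw [mul_right_comm]
  calc ∫⁻ y in Metric.ball x₀ R, g y
      = volume (Metric.ball x₀ R) * ((∫⁻ y in Metric.ball x₀ R, g y) /
          volume (Metric.ball x₀ R)) :=
        (ENNReal.mul_div_cancel (volume_cube_ne_zero _ hR) (volume_cube_ne_top _ _)).symm
    _ ≤ _ := by gcongr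

/-- Jensen with exponent `p/s`, enlargement of the small cube to the support cube at the cost of
`2^(kn)`, then the test condition for `f^(p/s)`. The cost is raised to the power `s/p`, and this
rate `ns/p` determines `q`. -/
theorem avg_le_of_testCondition {ν : Measure (Fin n → ℝ)} {s p : ℝ} {N : ℝ≥0∞} (hs : 1 ≤ s)
    (hsp : s < p) (hν : TestCondition ν s N) {x₀ : Fin n → ℝ} {R : ℝ} (hR : 0 < R)
    (hν0 : ν (Metric.ball x₀ R) ≠ 0) (hν1 : ν (Metric.ball x₀ R) ≠ ∞)
    {f : (Fin n → ℝ) → ℝ≥0∞} (hf : Measurable f) (hsupp : ∀ y ∉ Metric.ball x₀ R, f y = 0)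
    (x : Fin n → ℝ) (k : ℕ) :
    avg f x (4 * R / 2 ^ k) ≤ 2 ^ (k * (n * s / p)) *
      (N * ((ν (Metric.ball x₀ R))⁻¹ * ∫⁻ y, f y ^ p ∂ν)) ^ (1 / p) := by
  have hs0 : 0 < s := by linarith
  have hp0 : 0 < p := by linarith
  have h1 := avg_rpow_le hf.aemeasurable x (l := 4 * R / 2 ^ k) (by positivity)
    (t := p / s) (by rw [le_div_iff₀ hs0]; linarith)
  have h2 := avg_le_of_support hR (x₀ := x₀) (g := fun y => f y ^ (p / s))
    (fun y hy => by simp only [hsupp y hy]; exact ENNReal.zero_rpow_of_pos (by positivity)) x k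
  have h3 := hν x₀ R hR (fun y => f y ^ (p / s)) (by fun_prop)
  simp_rw [← ENNReal.rpow_mul, div_mul_cancel₀ _ hs0.ne'] at h3
  have h4 : avg (fun y => f y ^ (p / s)) x₀ R ^ s ≤
      N * ((ν (Metric.ball x₀ R))⁻¹ * ∫⁻ y, f y ^ p ∂ν) := by
    rw [mul_left_comm, mul_comm _ (N * _), ← div_eq_mul_inv,
      ENNReal.le_div_iff_mul_le (Or.inl hν0) (Or.inl hν1)]
    refine h3.trans ?_
    gcongr
    exact Measure.restrict_le_self
  have h5 : avg f x (4 * R / 2 ^ k) ^ p ≤ ((2 ^ k) ^ n) ^ s *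
      (N * ((ν (Metric.ball x₀ R))⁻¹ * ∫⁻ y, f y ^ p ∂ν)) := by
    calc avg f x (4 * R / 2 ^ k) ^ p = (avg f x (4 * R / 2 ^ k) ^ (p / s)) ^ s := by
          rw [← ENNReal.rpow_mul, div_mul_cancel₀ _ hs0.ne']
      _ ≤ ((2 ^ k) ^ n * avg (fun y => f y ^ (p / s)) x₀ R) ^ s :=
          ENNReal.rpow_le_rpow (h1.trans h2) hs0.le
      _ ≤ _ := by
          rw [ENNReal.mul_rpow_of_nonneg _ _ hs0.le]
          gcongr
  have h6 : ((2 : ℝ≥0∞) ^ (k * (n * s / p))) = (((2 ^ k) ^ n) ^ s) ^ (1 / p) := by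
    rw [← ENNReal.rpow_natCast, ← ENNReal.rpow_natCast, ← ENNReal.rpow_mul, ← ENNReal.rpow_mul,
      ← ENNReal.rpow_mul]
    congr 1; ring
  rw [h6, ← ENNReal.mul_rpow_of_nonneg _ _ (by positivity)]
  calc avg f x (4 * R / 2 ^ k) = (avg f x (4 * R / 2 ^ k) ^ p) ^ (1 / p) := by
        rw [← ENNReal.rpow_mul, mul_one_div_cancel hp0.ne', ENNReal.rpow_one]
    _ ≤ _ := ENNReal.rpow_le_rpow h5 (by positivity)

/-- Since `s ≥ 1`, the gap `ns/p - α` is at least `n/p - α`, whose inverse is `p^*_α / n`. This is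
where `p^*_α` enters the final constant. -/
theorem hedberg_const_le {α p s : ℝ} (hα : 0 < α) (hp : 1 < p) (hpn : α * p < n)
    (hs : 1 ≤ s) :
    1 + 2 / α + (1 + 2 / (n * s / p - α)) ≤ (2 * n + 4) / α * sobolevExponent n α p := by
  have hn : (0 : ℝ) < n := by nlinarith
  have hd : 0 < n - α * p := by linarith
  have hαn : α ≤ n := by nlinarith
  have h1 : (n - α * p) / p ≤ n * s / p - α := by
    rw [le_sub_iff_add_le, div_add' _ _ _ (by linarith)]
    gcongr
    nlinarith
  have h2 : 1 / (n * s / p - α) ≤ sobolevExponent n α p / n := by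
    have : sobolevExponent n α p / n = 1 / ((n - α * p) / p) := by
      unfold sobolevExponent; field_simp
    rw [this]
    exact one_div_le_one_div_of_le (by positivity) h1
  have h3 : 1 ≤ sobolevExponent n α p := by
    unfold sobolevExponent
    rw [le_div_iff₀ hd]
    nlinarith [mul_pos hα (by linarith : 0 < p)]
  have h4 : 1 ≤ n / α := by rwa [le_div_iff₀ hα, one_mul]
  have h5 : sobolevExponent n α p / n ≤ sobolevExponent n α p / α := by gcongr
  set P := sobolevExponent n α p
  have h6 : 2 / (n * s / p - α) ≤ 2 * (P / α) := by
    rw [show 2 / (n * s / p - α) = 2 * (1 / (n * s / p - α)) by ring]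
    linarith
  have h7 : (2 * n + 4) / α * P = 2 * ((n / α) * P) + 2 * (P / α) + 2 * (P / α) := by ring
  have h8 : 2 / α ≤ 2 * (P / α) := by
    rw [show 2 / α = 2 * (1 / α) by ring]
    gcongr
  have h9 : 1 * 1 ≤ n / α * P := mul_le_mul h4 h3 (by norm_num) (by positivity)
  linarith

theorem cubeRiesz_hedberg {ν : Measure (Fin n → ℝ)} {s p α : ℝ} {N : ℝ≥0∞} (hα : 0 < α)
    (hp : 1 < p) (hpn : α * p < n) (hs : 1 ≤ s)
    (hsp : s < p) (hν : TestCondition ν s N) {x₀ : Fin n → ℝ} {R : ℝ} (hR : 0 < R)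
    (hν0 : ν (Metric.ball x₀ R) ≠ 0) (hν1 : ν (Metric.ball x₀ R) ≠ ∞)
    {f : (Fin n → ℝ) → ℝ≥0∞} (hf : Measurable f) (hsupp : ∀ y ∉ Metric.ball x₀ R, f y = 0)
    {x : Fin n → ℝ} (hx : x ∈ Metric.ball x₀ R) :
    cubeRiesz α f x ≤ ENNReal.ofReal (8 ^ n * R ^ α) *
      (ENNReal.ofReal ((2 * n + 4) / α * sobolevExponent n α p) *
      (dyadicMax (4 * R) f x ^ (1 - α * p / (n * s)) *
        ((N * ((ν (Metric.ball x₀ R))⁻¹ * ∫⁻ y, f y ^ p ∂ν)) ^ (1 / p)) ^ (α * p / (n * s)))) := by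
  have hαn : α < n := by nlinarith
  have hγ : α < n * s / p := by
    rw [lt_div_iff₀ (by linarith)]
    nlinarith
  refine (cubeRiesz_le_tsum hαn hR hx hf hsupp).trans ?_
  gcongr
  have h := tsum_min_le hα hγ (dyadicMax (4 * R) f x)
    ((N * ((ν (Metric.ball x₀ R))⁻¹ * ∫⁻ y, f y ^ p ∂ν)) ^ (1 / p))
  rw [show α / (n * s / p) = α * p / (n * s) by field_simp] at h
  refine (ENNReal.tsum_le_tsum fun k => ?_).trans (h.trans ?_)
  · gcongr
    exact le_min (le_iSup (fun k : ℕ => avg f x (4 * R / 2 ^ k)) k)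
      (avg_le_of_testCondition hs hsp hν hR hν0 hν1 hf hsupp x k)
  · gcongr
    exact hedberg_const_le hα hp hpn hs

/-- The relation for `q` says `q(1-θ) = p`, so the `q`-th power of Hedberg's bound contains the
`p`-th power of the maximal function. The powers `θ` and `p/q` of `Y` then add up to one. The
smaller set `B` is allowed so that Euclidean balls can be inserted later. -/
theorem cubeRiesz_average_le {ν : Measure (Fin n → ℝ)} [SFinite ν] {s p q α : ℝ} {N : ℝ≥0∞}
    (hα : 0 < α) (hp : 1 < p) (hpn : α * p < n) (hs : 1 ≤ s) (hsp : s < p)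
    (hq : 1 / q = 1 / p - α / (n * s)) (hν : TestCondition ν s N) {x₀ : Fin n → ℝ} {R : ℝ}
    (hR : 0 < R) (hν1 : ν (Metric.ball x₀ R) ≠ ∞)
    {B : Set (Fin n → ℝ)} (hB : B ⊆ Metric.ball x₀ R) (hBm : MeasurableSet B) (hB0 : ν B ≠ 0)
    {f : (Fin n → ℝ) → ℝ≥0∞} (hf : Measurable f) (hsupp : ∀ y ∉ Metric.ball x₀ R, f y = 0) :
    ((ν B)⁻¹ * ∫⁻ x in B, cubeRiesz α f x ^ q ∂ν) ^ (1 / q) ≤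
      ENNReal.ofReal (8 ^ n * R ^ α) *
      (ENNReal.ofReal ((2 * n + 4) / α * sobolevExponent n α p) *
        ((2 * 6 ^ n) * (ENNReal.ofReal (p / (p - s)) ^ (1 / q) *
          (N * ((ν B)⁻¹ * ∫⁻ y, f y ^ p ∂ν)) ^ (1 / p)))) := by
  have hn : (0 : ℝ) < n := by nlinarith
  have hs0 : 0 < s := by linarith
  have hp0 : 0 < p := by linarith
  have hpq : p / q = 1 - α * p / (n * s) := by
    rw [div_eq_mul_one_div, hq]; field_simp
  have hlt : α * p / (n * s) < 1 := by
    rw [div_lt_one (by positivity)]; nlinarith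
  have hpos : 0 < α * p / (n * s) := by positivity
  have hq0 : 0 < q := by
    have : 0 < p / q := by rw [hpq]; linarith
    exact (div_pos_iff_of_pos_left hp0).1 this
  have hpq1 : p ≤ q := by
    have : p / q ≤ 1 := by rw [hpq]; linarith
    rwa [div_le_one hq0] at this
  have hν0 : ν (Metric.ball x₀ R) ≠ 0 := fun h => hB0 (measure_mono_null hB h)
  set X := ∫⁻ y, f y ^ p ∂ν with hX
  set Y := (N * ((ν B)⁻¹ * X)) ^ (1 / p) with hY
  set C₁ := ENNReal.ofReal (8 ^ n * R ^ α)
  set C₂ := ENNReal.ofReal ((2 * n + 4) / α * sobolevExponent n α p)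
  set θ := α * p / (n * s) with hθ
  have hpt : ∀ x ∈ B, cubeRiesz α f x ^ q ≤
      (C₁ * (C₂ * Y ^ θ)) ^ q * dyadicMax (4 * R) f x ^ p := by
    intro x hx
    have h := cubeRiesz_hedberg hα hp hpn hs hsp hν hR hν0 hν1 hf hsupp (hB hx)
    have h' : cubeRiesz α f x ≤ (C₁ * (C₂ * Y ^ θ)) * dyadicMax (4 * R) f x ^ (p / q) := by
      refine h.trans ?_
      rw [hpq, mul_assoc, mul_assoc, mul_comm (Y ^ θ)]
      gcongr
      -- Only `ν B ≤ ν Q` is used to change the normalisation.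
      rw [hY]
      gcongr
    refine (ENNReal.rpow_le_rpow h' hq0.le).trans_eq ?_
    rw [ENNReal.mul_rpow_of_nonneg _ _ hq0.le, ← ENNReal.rpow_mul (dyadicMax _ _ _),
      div_mul_cancel₀ _ hq0.ne']
  have hint : ∫⁻ x in B, cubeRiesz α f x ^ q ∂ν ≤ (C₁ * (C₂ * Y ^ θ)) ^ q *
      (2 ^ p * (6 ^ n) ^ s * N * ENNReal.ofReal (p / (p - s)) * X) := by
    calc ∫⁻ x in B, cubeRiesz α f x ^ q ∂ν
        ≤ ∫⁻ x in B, (C₁ * (C₂ * Y ^ θ)) ^ q * dyadicMax (4 * R) f x ^ p ∂ν :=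
          setLIntegral_mono' hBm hpt
      _ ≤ ∫⁻ x, (C₁ * (C₂ * Y ^ θ)) ^ q * dyadicMax (4 * R) f x ^ p ∂ν :=
          setLIntegral_le_lintegral _ _
      _ ≤ _ := by
          rw [lintegral_const_mul _ ((measurable_dyadicMax hf (by positivity)).pow_const p)]
          gcongr
          exact strong_type hs hsp hν (by positivity) hf
  calc ((ν B)⁻¹ * ∫⁻ x in B, cubeRiesz α f x ^ q ∂ν) ^ (1 / q)
      ≤ ((C₁ * (C₂ * Y ^ θ)) ^ q * ((2 ^ p * (6 ^ n) ^ s) * (ENNReal.ofReal (p / (p - s)) *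
          (N * ((ν B)⁻¹ * X))))) ^ (1 / q) := by
        refine ENNReal.rpow_le_rpow ?_ (by positivity)
        refine (mul_le_mul_right hint _).trans_eq ?_
        ring
    _ = (C₁ * (C₂ * Y ^ θ)) * ((2 ^ p * (6 ^ n) ^ s) ^ (1 / q) *
          (ENNReal.ofReal (p / (p - s)) ^ (1 / q) * Y ^ (p / q))) := by
        rw [ENNReal.mul_rpow_of_nonneg _ _ (by positivity), ← ENNReal.rpow_mul,
          mul_one_div_cancel hq0.ne', ENNReal.rpow_one,
          ENNReal.mul_rpow_of_nonneg (2 ^ p * _) _ (by positivity),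
          ENNReal.mul_rpow_of_nonneg (ENNReal.ofReal _) _ (by positivity)]
        congr 3
        rw [hY, ← ENNReal.rpow_mul]
        congr 1
        field_simp
    _ = C₁ * (C₂ * ((2 ^ p * (6 ^ n) ^ s) ^ (1 / q) *
          (ENNReal.ofReal (p / (p - s)) ^ (1 / q) * Y))) := by
        have : Y = Y ^ θ * Y ^ (p / q) := by
          rw [← ENNReal.rpow_add_of_nonneg _ _ hpos.le (by positivity), hpq, add_sub_cancel,
            ENNReal.rpow_one]
        conv_rhs => rw [this]
        ring
    _ ≤ _ := by
        gcongr
        rw [ENNReal.mul_rpow_of_nonneg _ _ (by positivity), ← ENNReal.rpow_mul,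
          ← ENNReal.rpow_mul]
        have e1 : p * (1 / q) ≤ 1 := by rw [mul_one_div, div_le_one hq0]; exact hpq1
        have e2 : s * (1 / q) ≤ 1 := by rw [mul_one_div, div_le_one hq0]; linarith
        gcongr
        · exact (ENNReal.rpow_le_rpow_of_exponent_le (by norm_num) e1).trans_eq
            (ENNReal.rpow_one _)
        · exact (ENNReal.rpow_le_rpow_of_exponent_le (one_le_pow₀ (by norm_num)) e2).trans_eq
            (ENNReal.rpow_one _)

/-! ### Dyadic subdivision and the running maximum. -/

/-- The centre of the dyadic child with index `s` of the cube with centre `c` and half-side `l`. -/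
noncomputable def child (c : Fin n → ℝ) (l : ℝ) (s : Fin n → Bool) : Fin n → ℝ :=
  fun i => c i + if s i then l / 2 else -(l / 2)

theorem child_ball_subset (c : Fin n → ℝ) {l : ℝ} (hl : 0 < l) (s : Fin n → Bool) :
    Metric.ball (child c l s) (l / 2) ⊆ Metric.ball c l := by
  intro y hy
  rw [Metric.mem_ball, dist_pi_lt_iff (by positivity)] at hy ⊢
  intro i
  have := hy i
  rw [Real.dist_eq, abs_lt] at this ⊢
  unfold child at this
  split_ifs at this <;> constructor <;> linarith

theorem child_ball_disjoint (c : Fin n → ℝ) {l : ℝ} (hl : 0 < l) :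
    Pairwise (Function.onFun Disjoint fun s => Metric.ball (child c l s) (l / 2)) := by
  intro s s' hss
  obtain ⟨i, hi⟩ := Function.ne_iff.1 hss
  refine disjoint_left.2 fun y hy hy' => ?_
  rw [Metric.mem_ball, dist_pi_lt_iff (by positivity)] at hy hy'
  have h1 := hy i
  have h2 := hy' i
  rw [Real.dist_eq, abs_lt] at h1 h2
  unfold child at h1 h2
  cases h : s i <;> cases h' : s' i <;> simp_all <;> linarith

theorem volume_child (c : Fin n → ℝ) {l : ℝ} (hl : 0 < l) (s : Fin n → Bool) :
    volume (Metric.ball c l) = 2 ^ n * volume (Metric.ball (child c l s) (l / 2)) := by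
  have := volume_cube_mul c (child c l s) (a := 2) (l := l / 2) (by norm_num) (by positivity)
  rwa [mul_div_cancel₀ _ (by norm_num : (2 : ℝ) ≠ 0), ENNReal.ofReal_ofNat] at this

/-- The open children miss the inner faces; these are null because the volumes of the `2^n` disjoint
children add up to that of the parent. -/
theorem iUnion_child_ae_eq (c : Fin n → ℝ) {l : ℝ} (hl : 0 < l) :
    (⋃ s, Metric.ball (child c l s) (l / 2) : Set (Fin n → ℝ)) =ᵐ[volume] Metric.ball c l := by
  refine ae_eq_of_subset_of_measure_ge (iUnion_subset (child_ball_subset c hl)) ?_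
    (MeasurableSet.iUnion fun s => Metric.isOpen_ball.measurableSet).nullMeasurableSet
    (volume_cube_ne_top c l)
  rw [measure_iUnion (child_ball_disjoint c hl) (fun s => Metric.isOpen_ball.measurableSet),
    tsum_fintype]
  have h : ∀ s : Fin n → Bool, volume (Metric.ball (child c l s) (l / 2)) =
      ENNReal.ofReal (2 * (l / 2)) ^ n := fun s => volume_cube _ (by positivity)
  simp_rw [h]
  rw [Finset.sum_const, Finset.card_univ, Fintype.card_fun, Fintype.card_bool, Fintype.card_fin,
    volume_cube _ hl, nsmul_eq_mul, Nat.cast_pow, ← mul_pow, ← ENNReal.ofReal_natCast,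
    ← ENNReal.ofReal_mul (by positivity)]
  refine le_of_eq ?_
  congr 2
  push_cast; ring

theorem setLIntegral_child (c : Fin n → ℝ) {l : ℝ} (hl : 0 < l) (g : (Fin n → ℝ) → ℝ≥0∞) :
    ∫⁻ x in Metric.ball c l, g x = ∑ s, ∫⁻ x in Metric.ball (child c l s) (l / 2), g x := by
  rw [← setLIntegral_congr (iUnion_child_ae_eq c hl),
    lintegral_iUnion (fun s => Metric.isOpen_ball.measurableSet) (child_ball_disjoint c hl),
    tsum_fintype]

theorem volume_eq_sum_child (c : Fin n → ℝ) {l : ℝ} (hl : 0 < l) :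
    volume (Metric.ball c l) = ∑ s, volume (Metric.ball (child c l s) (l / 2)) := by
  simpa using setLIntegral_child c hl 1

theorem avg_child_le (v : (Fin n → ℝ) → ℝ≥0∞) (c : Fin n → ℝ) {l : ℝ} (hl : 0 < l)
    (s : Fin n → Bool) : avg v (child c l s) (l / 2) ≤ 2 ^ n * avg v c l := by
  have h0 := volume_cube_ne_zero (child c l s) (half_pos hl)
  have h1 := volume_cube_ne_top (child c l s) (l / 2)
  unfold avg
  rw [volume_child c hl s, ← mul_div_assoc, ENNReal.mul_div_mul_left _ _ (by positivity)
    (by finiteness)]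
  gcongr
  exact child_ball_subset c hl s

/-- The running maximum of `m` and the averages of `v` over the dyadic cubes of the first `k`
generations that contain `x`. -/
noncomputable def runMax (v : (Fin n → ℝ) → ℝ≥0∞) :
    ℕ → (Fin n → ℝ) → ℝ → ℝ≥0∞ → (Fin n → ℝ) → ℝ≥0∞
  | 0, c, l, m, _ => max m (avg v c l)
  | k + 1, c, l, m, x => ∑ s, (Metric.ball (child c l s) (l / 2)).indicator
      (runMax v k (child c l s) (l / 2) (max m (avg v c l))) x

theorem measurable_runMax (v : (Fin n → ℝ) → ℝ≥0∞) (k : ℕ) (c : Fin n → ℝ) (l : ℝ) (m : ℝ≥0∞) :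
    Measurable (runMax v k c l m) := by
  induction k generalizing c l m with
  | zero => exact measurable_const
  | succ k ih =>
    have h : runMax v (k + 1) c l m = fun x => ∑ s, (Metric.ball (child c l s) (l / 2)).indicator
        (runMax v k (child c l s) (l / 2) (max m (avg v c l))) x := by
      funext x; rw [runMax]
    rw [h]
    exact Finset.measurable_fun_sum _ fun s _ =>
      (ih _ _ _).indicator Metric.isOpen_ball.measurableSet

theorem runMax_succ_of_mem (v : (Fin n → ℝ) → ℝ≥0∞) (k : ℕ) (c : Fin n → ℝ) {l : ℝ} (hl : 0 < l)
    (m : ℝ≥0∞) {s : Fin n → Bool} {x : Fin n → ℝ} (hx : x ∈ Metric.ball (child c l s) (l / 2)) :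
    runMax v (k + 1) c l m x = runMax v k (child c l s) (l / 2) (max m (avg v c l)) x := by
  rw [runMax, Finset.sum_eq_single s, indicator_of_mem hx]
  · intro s' _ hs
    exact indicator_of_notMem (fun h => disjoint_left.1 (child_ball_disjoint c hl hs) h hx) _
  · simp

/-- Once the average over the top cube exceeds the starting level, that level is forgotten and may
be replaced by `0`. -/
theorem runMax_congr_left (v : (Fin n → ℝ) → ℝ≥0∞) (k : ℕ) (c : Fin n → ℝ) (l : ℝ) {m m' : ℝ≥0∞}
    (h : max m (avg v c l) = max m' (avg v c l)) : runMax v k c l m = runMax v k c l m' := by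
  cases k <;> funext x <;> simp only [runMax, h]

theorem setLIntegral_runMax_succ (v : (Fin n → ℝ) → ℝ≥0∞) (k : ℕ) (c : Fin n → ℝ) {l : ℝ}
    (hl : 0 < l) (m : ℝ≥0∞) (F : (Fin n → ℝ) → ℝ≥0∞ → ℝ≥0∞) :
    ∫⁻ x in Metric.ball c l, F x (runMax v (k + 1) c l m x) =
      ∑ s, ∫⁻ x in Metric.ball (child c l s) (l / 2),
        F x (runMax v k (child c l s) (l / 2) (max m (avg v c l)) x) := by
  rw [setLIntegral_child c hl]
  refine Finset.sum_congr rfl fun s _ => ?_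
  refine setLIntegral_congr_fun Metric.isOpen_ball.measurableSet fun x hx => ?_
  simp only [runMax_succ_of_mem v k c hl m hx]

theorem ae_ball_of_forall_child (c : Fin n → ℝ) {l : ℝ} (hl : 0 < l) {P : (Fin n → ℝ) → Prop}
    (h : ∀ s, ∀ᵐ x ∂(volume.restrict (Metric.ball (child c l s) (l / 2))), P x) :
    ∀ᵐ x ∂(volume.restrict (Metric.ball c l)), P x := by
  rw [← Measure.restrict_congr_set (iUnion_child_ae_eq c hl), ae_restrict_iUnion_iff]
  exact h

theorem avg_ne_top {v : (Fin n → ℝ) → ℝ≥0∞} {c : Fin n → ℝ} {l : ℝ} (hl : 0 < l)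
    (hv : ∫⁻ x in Metric.ball c l, v x ≠ ∞) : avg v c l ≠ ∞ :=
  ENNReal.div_ne_top hv (volume_cube_ne_zero c hl)

theorem lintegral_runMax_rpow_ne_top {v : (Fin n → ℝ) → ℝ≥0∞}
    (hv : ∀ c l, ∫⁻ x in Metric.ball c l, v x ≠ ∞) {t : ℝ} (ht : 0 ≤ t) (k : ℕ) (c : Fin n → ℝ)
    {l : ℝ} (hl : 0 < l) {m : ℝ≥0∞} (hm : m ≠ ∞) :
    ∫⁻ x in Metric.ball c l, runMax v k c l m x ^ t ≠ ∞ := by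
  have hmax : ∀ c l, 0 < l → ∀ m, m ≠ ∞ → max m (avg v c l) ≠ ∞ := fun c l hl m hm =>
    max_ne_top hm (avg_ne_top hl (hv c l))
  induction k generalizing c l m with
  | zero =>
    simp only [runMax, setLIntegral_const]
    exact ENNReal.mul_ne_top (ENNReal.rpow_ne_top_of_nonneg ht (hmax c l hl m hm))
      (volume_cube_ne_top c l)
  | succ k ih =>
    rw [setLIntegral_runMax_succ v k c hl m fun _ r => r ^ t]
    exact ENNReal.sum_ne_top.2 fun s _ => ih _ (half_pos hl) (hmax c l hl m hm)

/-! ### The sharp reverse Hölder inequality. -/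

/-- Compare derivatives in `t ∈ [m, b]`: `b ε t^(ε-1) ≤ C t ε t^(ε-1)`, because `b ≤ C m ≤ C t`. -/
theorem rpow_increment_le {ε C m b : ℝ} (hε : 0 < ε) (hm : 0 < m) (hmb : m ≤ b)
    (hC : b ≤ C * m) :
    (b ^ ε - m ^ ε) * b ≤ C * (ε / (1 + ε)) * (b ^ (1 + ε) - m ^ (1 + ε)) := by
  have hC0 : 0 ≤ C := by
    by_contra! h
    nlinarith
  have hmono : MonotoneOn (fun t : ℝ => C * (ε / (1 + ε)) * t ^ (1 + ε) - b * t ^ ε) (Icc m b) := by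
    refine monotoneOn_of_deriv_nonneg (convex_Icc m b) ?_ ?_ ?_
    · refine ContinuousOn.sub (continuousOn_const.mul ?_) (continuousOn_const.mul ?_) <;>
        exact continuousOn_id.rpow_const fun x hx => Or.inl (by simp at hx ⊢; linarith)
    · intro x hx
      rw [interior_Icc] at hx
      have hx0 : x ≠ 0 := by linarith [hx.1]
      exact (((Real.hasDerivAt_rpow_const (Or.inl hx0)).const_mul _).sub
        ((Real.hasDerivAt_rpow_const (Or.inl hx0)).const_mul _)).differentiableAt
          |>.differentiableWithinAt
    · intro x hx
      rw [interior_Icc] at hx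
      have hx0 : 0 < x := by linarith [hx.1]
      have hd : HasDerivAt (fun t : ℝ => C * (ε / (1 + ε)) * t ^ (1 + ε) - b * t ^ ε)
          (C * (ε / (1 + ε)) * ((1 + ε) * x ^ (1 + ε - 1)) - b * (ε * x ^ (ε - 1))) x :=
        ((Real.hasDerivAt_rpow_const (Or.inl hx0.ne')).const_mul _).sub
          ((Real.hasDerivAt_rpow_const (Or.inl hx0.ne')).const_mul _)
      rw [hd.deriv]
      have h1 : x ^ (1 + ε - 1) = x ^ (ε - 1) * x := by
        rw [← Real.rpow_add_one hx0.ne']; congr 1; ring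
      rw [h1]
      have h2 : C * (ε / (1 + ε)) * ((1 + ε) * (x ^ (ε - 1) * x)) - b * (ε * x ^ (ε - 1)) =
          ε * x ^ (ε - 1) * (C * x - b) := by field_simp
      rw [h2]
      have : 0 ≤ C * x - b := by nlinarith [hx.1]
      positivity
  have h := hmono (left_mem_Icc.2 hmb) (right_mem_Icc.2 hmb) hmb
  have hb : b ^ (1 + ε) = b ^ ε * b := by
    rw [add_comm, Real.rpow_add_one (by linarith)]
  simp only at h
  nlinarith

/-- Lowering the level from `b` to `m` removes `(b^ε - m^ε) H ≤ A (b^ε - m^ε) b V` on the right and,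
by `rpow_increment_le`, at least as much on the left. The form without subtraction suits `ℝ≥0∞`. -/
theorem descend_level_nnreal {ε : ℝ} (hε : 0 < ε) {A C m b X H V G : NNReal} (hmb : m ≤ b)
    (hC : b ≤ C * m) (hH : H ≤ A * (b * V))
    (h : X + A * C * (ε / (1 + ε)).toNNReal * (b ^ (1 + ε) * V) ≤
      b ^ ε * H + A * C * (ε / (1 + ε)).toNNReal * G) :
    X + A * C * (ε / (1 + ε)).toNNReal * (m ^ (1 + ε) * V) ≤
      m ^ ε * H + A * C * (ε / (1 + ε)).toNNReal * G := by
  rcases eq_or_ne m 0 with rfl | hm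
  · have hb : b = 0 := by simpa using hC
    rwa [hb] at h
  have hm0 : (0 : ℝ) < m := by positivity
  rw [← NNReal.coe_le_coe] at h hH hmb hC ⊢
  push_cast at h hH hmb hC ⊢
  rw [Real.coe_toNNReal _ (by positivity)] at h ⊢
  have h1 := rpow_increment_le hε hm0 hmb hC
  have h2 : (m : ℝ) ^ ε ≤ (b : ℝ) ^ ε := Real.rpow_le_rpow hm0.le hmb hε.le
  have h3 := mul_le_mul_of_nonneg_left hH (sub_nonneg.2 h2)
  have h4 := mul_le_mul_of_nonneg_left h1 (mul_nonneg A.2 V.2)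
  simp only [NNReal.val_eq_coe] at h4
  nlinarith

theorem descend_level {ε : ℝ} (hε : 0 < ε) {A C : NNReal} {m b X H V G : ℝ≥0∞} (hb : b ≠ ∞)
    (hV : V ≠ ∞) (hG : G ≠ ∞) (hmb : m ≤ b) (hC : b ≤ C * m) (hH : H ≤ A * (b * V))
    (h : X + A * C * (ε / (1 + ε)).toNNReal * (b ^ (1 + ε) * V) ≤
      b ^ ε * H + A * C * (ε / (1 + ε)).toNNReal * G) :
    X + A * C * (ε / (1 + ε)).toNNReal * (m ^ (1 + ε) * V) ≤
      m ^ ε * H + A * C * (ε / (1 + ε)).toNNReal * G := by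
  have hm : m ≠ ∞ := ne_top_of_le_ne_top hb hmb
  have hH' : H ≠ ∞ := ne_top_of_le_ne_top (by finiteness) hH
  have hX : X ≠ ∞ := by
    refine ne_top_of_le_ne_top ?_ (le_self_add.trans h)
    have : b ^ ε ≠ ∞ := ENNReal.rpow_ne_top_of_nonneg hε.le hb
    finiteness
  lift m to NNReal using hm
  lift b to NNReal using hb
  lift X to NNReal using hX
  lift H to NNReal using hH'
  lift V to NNReal using hV
  lift G to NNReal using hG
  have hε1 : 0 ≤ 1 + ε := by linarith
  rw [← ENNReal.coe_rpow_of_nonneg _ hε.le, ← ENNReal.coe_rpow_of_nonneg _ hε1] at h ⊢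
  norm_cast at h hmb hC hH ⊢
  exact descend_level_nnreal hε hmb hC hH h

/-- Abel summation over generations. The power `ε` of the running maximum is `m^ε` plus jumps. A
jump from `m` to `b` on a cube `Q` has `b` equal to the mean of `v` over `Q` and `b ≤ 2^n m`, and
there `∫_Q U ≤ A b |Q|`. So it costs at most a multiple of the jump of the power `1+ε`, integrated
over `Q`, and those jumps telescope. The family `U` is left general because both `runMax v` and `v`
itself are needed. -/
theorem runMax_summation_by_parts {v : (Fin n → ℝ) → ℝ≥0∞}
    (hv : ∀ c l, ∫⁻ x in Metric.ball c l, v x ≠ ∞) {ε : ℝ} (hε : 0 < ε) {A : NNReal}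
    (U : ℕ → (Fin n → ℝ) → ℝ → ℝ≥0∞ → (Fin n → ℝ) → ℝ≥0∞)
    (hU : ∀ k c l m s, 0 < l → ∀ x ∈ Metric.ball (child c l s) (l / 2),
      U (k + 1) c l m x = U k (child c l s) (l / 2) (max m (avg v c l)) x)
    (hUA : ∀ k c l m, 0 < l → m ≤ avg v c l →
      ∫⁻ x in Metric.ball c l, U k c l m x ≤ A * ∫⁻ x in Metric.ball c l, v x)
    (k : ℕ) (c : Fin n → ℝ) {l : ℝ} (hl : 0 < l) {m : ℝ≥0∞} (hm : m ≠ ∞)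
    (hcm : avg v c l ≤ 2 ^ n * m) :
    (∫⁻ x in Metric.ball c l, runMax v k c l m x ^ ε * U k c l m x) +
        A * (2 ^ n : NNReal) * (ε / (1 + ε)).toNNReal *
          (m ^ (1 + ε) * volume (Metric.ball c l)) ≤
      m ^ ε * (∫⁻ x in Metric.ball c l, U k c l m x) +
        A * (2 ^ n : NNReal) * (ε / (1 + ε)).toNNReal *
          ∫⁻ x in Metric.ball c l, runMax v k c l m x ^ (1 + ε) := by
  have hε1 : 0 ≤ 1 + ε := by linarith
  induction k generalizing c l m with
  | zero =>
    have key : (∫⁻ x in Metric.ball c l, runMax v 0 c l m x ^ ε * U 0 c l m x) +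
        A * (2 ^ n : NNReal) * (ε / (1 + ε)).toNNReal *
          (max m (avg v c l) ^ (1 + ε) * volume (Metric.ball c l)) ≤
      max m (avg v c l) ^ ε * (∫⁻ x in Metric.ball c l, U 0 c l m x) +
        A * (2 ^ n : NNReal) * (ε / (1 + ε)).toNNReal *
          ∫⁻ x in Metric.ball c l, runMax v 0 c l m x ^ (1 + ε) := by
      simp only [runMax, setLIntegral_const]
      rw [lintegral_const_mul' _ _ (ENNReal.rpow_ne_top_of_nonneg hε.le
        (max_ne_top hm (avg_ne_top hl (hv c l))))]
    -- Only a cube whose average sets a new maximum requires the level to be lowered.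
    rcases le_total (avg v c l) m with h | h
    · rwa [max_eq_left h] at key
    · rw [max_eq_right h] at key
      refine descend_level hε (avg_ne_top hl (hv c l)) (volume_cube_ne_top c l)
        (lintegral_runMax_rpow_ne_top hv hε1 0 c hl hm) h (by exact_mod_cast hcm) ?_ key
      rw [avg_mul_volume v c hl]
      exact hUA 0 c l m hl h
  | succ k ih =>
    have key : (∫⁻ x in Metric.ball c l, runMax v (k + 1) c l m x ^ ε * U (k + 1) c l m x) +
        A * (2 ^ n : NNReal) * (ε / (1 + ε)).toNNReal *
          (max m (avg v c l) ^ (1 + ε) * volume (Metric.ball c l)) ≤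
      max m (avg v c l) ^ ε * (∫⁻ x in Metric.ball c l, U (k + 1) c l m x) +
        A * (2 ^ n : NNReal) * (ε / (1 + ε)).toNNReal *
          ∫⁻ x in Metric.ball c l, runMax v (k + 1) c l m x ^ (1 + ε) := by
      have e1 : ∫⁻ x in Metric.ball c l, U (k + 1) c l m x =
          ∑ s, ∫⁻ x in Metric.ball (child c l s) (l / 2),
            U k (child c l s) (l / 2) (max m (avg v c l)) x := by
        rw [setLIntegral_child c hl]
        exact Finset.sum_congr rfl fun s _ => setLIntegral_congr_fun
          Metric.isOpen_ball.measurableSet (hU k c l m s hl)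
      have e2 : ∫⁻ x in Metric.ball c l, runMax v (k + 1) c l m x ^ ε * U (k + 1) c l m x =
          ∑ s, ∫⁻ x in Metric.ball (child c l s) (l / 2),
            runMax v k (child c l s) (l / 2) (max m (avg v c l)) x ^ ε *
            U k (child c l s) (l / 2) (max m (avg v c l)) x := by
        rw [setLIntegral_child c hl]
        refine Finset.sum_congr rfl fun s _ => setLIntegral_congr_fun
          Metric.isOpen_ball.measurableSet fun x hx => ?_
        simp only [hU k c l m s hl x hx, runMax_succ_of_mem v k c hl m hx]
      rw [e1, e2, setLIntegral_runMax_succ v k c hl m fun _ r => r ^ (1 + ε),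
        volume_eq_sum_child c hl, Finset.mul_sum, Finset.mul_sum, Finset.mul_sum, Finset.mul_sum,
        ← Finset.sum_add_distrib, ← Finset.sum_add_distrib]
      refine Finset.sum_le_sum fun s _ => ih _ (half_pos hl)
        (max_ne_top hm (avg_ne_top hl (hv c l))) ((avg_child_le v c hl s).trans ?_)
      gcongr
      exact le_max_right _ _
    rcases le_total (avg v c l) m with h | h
    · rwa [max_eq_left h] at key
    · rw [max_eq_right h] at key
      refine descend_level hε (avg_ne_top hl (hv c l)) (volume_cube_ne_top c l)
        (lintegral_runMax_rpow_ne_top hv hε1 (k + 1) c hl hm) h (by exact_mod_cast hcm) ?_ key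
      rw [avg_mul_volume v c hl]
      exact hUA (k + 1) c l m hl h

theorem ae_exists_avg_le_runMax (v : (Fin n → ℝ) → ℝ≥0∞) (k : ℕ) (c : Fin n → ℝ) {l : ℝ}
    (hl : 0 < l) (m : ℝ≥0∞) : ∀ᵐ x ∂(volume.restrict (Metric.ball c l)),
      ∃ c', x ∈ Metric.ball c' (l / 2 ^ k) ∧ Metric.ball c' (l / 2 ^ k) ⊆ Metric.ball c l ∧
        avg v c' (l / 2 ^ k) ≤ runMax v k c l m x := by
  induction k generalizing c l m with
  | zero =>
    filter_upwards [ae_restrict_mem Metric.isOpen_ball.measurableSet] with x hx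
    refine ⟨c, ?_⟩
    simp only [pow_zero, div_one]
    exact ⟨hx, Subset.rfl, le_max_right _ _⟩
  | succ k ih =>
    refine ae_ball_of_forall_child c hl fun s => ?_
    filter_upwards [ae_restrict_mem Metric.isOpen_ball.measurableSet,
      ih (child c l s) (half_pos hl) (max m (avg v c l))] with x hx h
    obtain ⟨c', h1, h2, h3⟩ := h
    have e : l / 2 / 2 ^ k = l / 2 ^ (k + 1) := by rw [pow_succ, div_div, mul_comm 2]
    rw [e] at h1 h2 h3
    refine ⟨c', h1, h2.trans (child_ball_subset c hl s), ?_⟩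
    rwa [runMax_succ_of_mem v k c hl m hx]

theorem ae_le_runMax (v : (Fin n → ℝ) → ℝ≥0∞) (k : ℕ) (c : Fin n → ℝ) {l : ℝ}
    (hl : 0 < l) (m : ℝ≥0∞) : ∀ᵐ x ∂(volume.restrict (Metric.ball c l)),
      max m (avg v c l) ≤ runMax v k c l m x := by
  induction k generalizing c l m with
  | zero => exact Filter.Eventually.of_forall fun x => le_rfl
  | succ k ih =>
    refine ae_ball_of_forall_child c hl fun s => ?_
    filter_upwards [ae_restrict_mem Metric.isOpen_ball.measurableSet,
      ih (child c l s) (half_pos hl) (max m (avg v c l))] with x hx h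
    rw [runMax_succ_of_mem v k c hl m hx]
    exact (le_max_left _ _).trans h

theorem closedBall_ae_eq_ball' (c : Fin n → ℝ) {l : ℝ} (hl : 0 < l) :
    (Metric.ball c l : Set (Fin n → ℝ)) =ᵐ[volume] Metric.closedBall c l := by
  refine ae_eq_of_subset_of_measure_ge Metric.ball_subset_closedBall ?_
    Metric.isOpen_ball.measurableSet.nullMeasurableSet measure_closedBall_lt_top.ne
  rw [Real.volume_pi_closedBall c hl.le, Real.volume_pi_ball c hl]

/-- Lebesgue differentiation along the dyadic cubes containing `x`. They are not centred at `x`,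
hence the Vitali family that admits such cubes. -/
theorem ae_exists_tendsto_le_runMax {v : (Fin n → ℝ) → ℝ≥0∞} (hvm : AEMeasurable v)
    (hv : ∀ c l, ∫⁻ x in Metric.ball c l, v x ≠ ∞) (c : Fin n → ℝ) {l : ℝ}
    (hl : 0 < l) (m : ℝ≥0∞) : ∀ᵐ x ∂(volume.restrict (Metric.ball c l)),
      ∃ a : ℕ → ℝ≥0∞, Filter.Tendsto a Filter.atTop (nhds (v x)) ∧
        ∀ k, a k ≤ runMax v k c l m x := by
  have hb : MeasurableSet (Metric.ball c l) := Metric.isOpen_ball.measurableSet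
  have hL := VitaliFamily.ae_tendsto_lintegral_div
    (IsUnifLocDoublingMeasure.vitaliFamily (volume : Measure (Fin n → ℝ)) 1)
    (hvm.indicator hb) (by rw [lintegral_indicator hb]; exact hv c l)
  filter_upwards [ae_restrict_of_ae hL, ae_restrict_mem hb,
    ae_all_iff.2 fun k => ae_exists_avg_le_runMax v k c hl m] with x hx hxb hk
  choose c' h1 h2 h3 using hk
  refine ⟨fun k => avg v (c' k) (l / 2 ^ k), ?_, h3⟩
  rw [indicator_of_mem hxb] at hx
  have hδ : Filter.Tendsto (fun k : ℕ => l / 2 ^ k) Filter.atTop (nhdsWithin 0 (Ioi 0)) := by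
    refine tendsto_nhdsWithin_iff.2 ⟨?_, Filter.Eventually.of_forall fun k => ?_⟩
    · have := (tendsto_pow_atTop_nhds_zero_of_lt_one (r := (1 / 2 : ℝ)) (by norm_num)
        (by norm_num)).const_mul l
      simpa [div_eq_mul_inv] using this
    · exact mem_Ioi.2 (by positivity)
  have hT := IsUnifLocDoublingMeasure.tendsto_closedBall_filterAt
    (volume : Measure (Fin n → ℝ)) (K := 1) (x := x) c' (fun k : ℕ => l / 2 ^ k) hδ
    (Filter.Eventually.of_forall fun k => by
      rw [one_mul]; exact Metric.ball_subset_closedBall (h1 k))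
  refine (hx.comp hT).congr fun k => ?_
  have hlk : 0 < l / 2 ^ k := by positivity
  simp only [Function.comp]
  rw [← setLIntegral_congr (closedBall_ae_eq_ball' (c' k) hlk),
    ← measure_congr (closedBall_ae_eq_ball' (c' k) hlk), avg]
  congr 1
  refine setLIntegral_congr_fun Metric.isOpen_ball.measurableSet fun y hy => ?_
  exact indicator_of_mem (h2 k hy) _

/-- Fatou's lemma: the running maxima eventually dominate averages that tend to `v`. -/
theorem lintegral_rpow_le_of_runMax {v : (Fin n → ℝ) → ℝ≥0∞} (hvm : AEMeasurable v)
    (hv : ∀ c l, ∫⁻ x in Metric.ball c l, v x ≠ ∞) (c : Fin n → ℝ) {l : ℝ}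
    (hl : 0 < l) (m : ℝ≥0∞) {ε : ℝ} (hε : 0 < ε) {K : ℝ≥0∞}
    (hK : ∀ k, ∫⁻ x in Metric.ball c l, runMax v k c l m x ^ ε * v x ≤ K) :
    ∫⁻ x in Metric.ball c l, v x ^ (1 + ε) ≤ K := by
  calc ∫⁻ x in Metric.ball c l, v x ^ (1 + ε)
      ≤ ∫⁻ x in Metric.ball c l,
          Filter.liminf (fun k => runMax v k c l m x ^ ε * v x) Filter.atTop := by
        refine lintegral_mono_ae ?_
        filter_upwards [ae_exists_tendsto_le_runMax hvm hv c hl m,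
          ae_lt_top' hvm.restrict (hv c l)] with x hx hxt
        obtain ⟨a, ha, hak⟩ := hx
        -- Finiteness of `v x` makes multiplication by it continuous.
        have h1 : Filter.Tendsto (fun k => a k ^ ε * v x) Filter.atTop
            (nhds (v x ^ ε * v x)) :=
          ENNReal.Tendsto.mul_const (ha.ennrpow_const ε) (Or.inr hxt.ne)
        have h2 : v x ^ (1 + ε) = v x ^ ε * v x := by
          rw [add_comm, ENNReal.rpow_add_of_nonneg _ _ hε.le zero_le_one, ENNReal.rpow_one]
        rw [h2, ← h1.liminf_eq]
        refine Filter.liminf_le_liminf (Filter.Eventually.of_forall fun k => ?_)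
        gcongr
        exact hak k
    _ ≤ Filter.liminf (fun k => ∫⁻ x in Metric.ball c l, runMax v k c l m x ^ ε * v x)
          Filter.atTop :=
        lintegral_liminf_le' fun k =>
          ((measurable_runMax v k c l m).pow_const ε).aemeasurable.mul hvm.restrict
    _ ≤ K := by
        refine (Filter.liminf_le_liminf (Filter.Eventually.of_forall hK)).trans ?_
        simp

/-- Let `a` be the mean and `G` the integral of the `(1+ε)`-th power of the running maximum.
Summation by parts with `U = runMax v` gives `G ≤ a^ε A I + G/2`; as `G` is finite at each
generation, `G/2 ≤ A a^ε I`. With `U = v` the error is `2^n ε/(1+ε) G = G/(2A) ≤ a^ε I`, which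
accounts for the factor 2. The choice of `ε` makes the absorbed coefficient exactly one half. -/
theorem reverse_holder {v : (Fin n → ℝ) → ℝ≥0∞} (hvm : AEMeasurable v)
    (hv : ∀ c l, ∫⁻ x in Metric.ball c l, v x ≠ ∞) {A : NNReal} {ε : ℝ} (hε : 0 < ε)
    (hεA : (A : ℝ) * 2 ^ n * (ε / (1 + ε)) = 1 / 2)
    (hA : ∀ k c l, 0 < l →
      ∫⁻ x in Metric.ball c l, runMax v k c l 0 x ≤ A * ∫⁻ x in Metric.ball c l, v x)
    (c : Fin n → ℝ) {l : ℝ} (hl : 0 < l) :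
    ∫⁻ x in Metric.ball c l, v x ^ (1 + ε) ≤
      2 * (avg v c l ^ ε * ∫⁻ x in Metric.ball c l, v x) := by
  set a := avg v c l with ha
  have ha1 : a ≠ ∞ := avg_ne_top hl (hv c l)
  have ha2 : a ≤ 2 ^ n * a := le_mul_of_one_le_left zero_le (one_le_pow₀ (by norm_num))
  refine lintegral_rpow_le_of_runMax hvm hv c hl a hε fun k => ?_
  have hδ : 0 ≤ ε / (1 + ε) := by positivity
  have hκ : (A : ℝ≥0∞) * (2 ^ n : NNReal) * (ε / (1 + ε)).toNNReal = 2⁻¹ := by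
    have h : A * (2 ^ n : NNReal) * (ε / (1 + ε)).toNNReal = 2⁻¹ := by
      rw [← NNReal.coe_inj]
      push_cast
      rw [Real.coe_toNNReal _ hδ, hεA, one_div]
    rw [← ENNReal.coe_mul, ← ENNReal.coe_mul, h]
    simp
  set δ := (ε / (1 + ε)).toNNReal
  set I := ∫⁻ x in Metric.ball c l, v x with hI
  have hUA : ∀ k c l m, 0 < l → m ≤ avg v c l →
      ∫⁻ x in Metric.ball c l, runMax v k c l m x ≤ A * ∫⁻ x in Metric.ball c l, v x := by
    intro k c l m hl hm
    rw [runMax_congr_left v k c l (m := m) (m' := 0) (by rw [max_eq_right hm,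
      max_eq_right zero_le])]
    exact hA k c l hl
  have h1 := runMax_summation_by_parts hv hε (runMax v)
    (fun k c l m s hl x hx => runMax_succ_of_mem v k c hl m hx) hUA k c hl ha1 ha2
  have h2 := runMax_summation_by_parts hv hε (A := 1) (fun _ _ _ _ => v)
    (fun k c l m s hl x hx => rfl) (fun k c l m hl hm => by simp) k c hl ha1 ha2
  have hGtop := lintegral_runMax_rpow_ne_top hv (t := 1 + ε) (by linarith) k c hl ha1
  have hX : ∫⁻ x in Metric.ball c l, runMax v k c l a x ^ ε * runMax v k c l a x =
      ∫⁻ x in Metric.ball c l, runMax v k c l a x ^ (1 + ε) := by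
    refine lintegral_congr fun x => ?_
    rw [add_comm 1 ε, ENNReal.rpow_add_of_nonneg _ _ hε.le zero_le_one, ENNReal.rpow_one]
  rw [hX, hκ] at h1
  set G := ∫⁻ x in Metric.ball c l, runMax v k c l a x ^ (1 + ε) with hG
  have h3 : 2⁻¹ * G ≤ a ^ ε * (A * I) := by
    have h4 : G ≤ a ^ ε * (A * I) + 2⁻¹ * G := by
      refine (le_self_add.trans h1).trans ?_
      gcongr
      exact hUA k c l a hl le_rfl
    have h5 : G = 2⁻¹ * G + 2⁻¹ * G := by
      rw [← add_mul, ENNReal.inv_two_add_inv_two, one_mul]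
    have h6 : 2⁻¹ * G ≠ ∞ := ENNReal.mul_ne_top (by simp) hGtop
    exact (ENNReal.add_le_add_iff_right h6).1 (h5.symm.le.trans h4)
  have h7 : (A : ℝ≥0∞) * ((2 ^ n : NNReal) * δ * G) ≤ A * (a ^ ε * I) := by
    calc (A : ℝ≥0∞) * ((2 ^ n : NNReal) * δ * G) = (A * (2 ^ n : NNReal) * δ) * G := by ring
      _ = 2⁻¹ * G := by rw [hκ]
      _ ≤ a ^ ε * (A * I) := h3
      _ = _ := by ring
  have hA0 : (A : ℝ≥0∞) ≠ 0 := by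
    intro h
    rw [h, zero_mul, zero_mul] at hκ
    exact ENNReal.inv_ne_zero.2 ENNReal.ofNat_ne_top hκ.symm
  have h8 := (ENNReal.mul_le_mul_iff_right hA0 ENNReal.coe_ne_top).1 h7
  refine (le_self_add.trans h2).trans ?_
  rw [ENNReal.coe_one, one_mul, two_mul]
  gcongr

/-! ### A bound for running maxima, uniform in the generation. -/

theorem runMax_mono (v : (Fin n → ℝ) → ℝ≥0∞) (k : ℕ) (c : Fin n → ℝ) (l : ℝ) {m m' : ℝ≥0∞}
    (h : m ≤ m') (x : Fin n → ℝ) : runMax v k c l m x ≤ runMax v k c l m' x := by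
  induction k generalizing c l m m' with
  | zero => exact max_le_max_right _ h
  | succ k ih =>
    simp only [runMax]
    refine Finset.sum_le_sum fun s _ => ?_
    exact indicator_le_indicator (ih _ _ (max_le_max_right _ h))

/-- A crude bound, growing with `k`, that starts the iteration in `runMax_bound_of_large_subsets`.
-/
theorem lintegral_runMax_le_succ (v : (Fin n → ℝ) → ℝ≥0∞) (k : ℕ) (c : Fin n → ℝ) {l : ℝ}
    (hl : 0 < l) (m : ℝ≥0∞) :
    ∫⁻ x in Metric.ball c l, runMax v k c l m x ≤
      m * volume (Metric.ball c l) + (k + 1) * ∫⁻ x in Metric.ball c l, v x := by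
  have hmax : ∀ c l, 0 < l → max m (avg v c l) * volume (Metric.ball c l) ≤
      m * volume (Metric.ball c l) + ∫⁻ x in Metric.ball c l, v x := by
    intro c l hl
    rw [← avg_mul_volume v c hl, ← add_mul]
    gcongr
    exact max_le le_self_add le_add_self
  induction k generalizing c l m with
  | zero =>
    simp only [runMax, setLIntegral_const]
    simpa using hmax c l hl
  | succ k ih =>
    rw [setLIntegral_runMax_succ v k c hl m fun _ r => r]
    calc _ ≤ ∑ s, (max m (avg v c l) * volume (Metric.ball (child c l s) (l / 2)) +
          (k + 1) * ∫⁻ x in Metric.ball (child c l s) (l / 2), v x) := by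
          refine Finset.sum_le_sum fun s _ => ih _ (half_pos hl) _ fun c' l' hl' => ?_
          rw [← avg_mul_volume v c' hl', ← add_mul]
          gcongr
          exact max_le le_self_add le_add_self
      _ = max m (avg v c l) * volume (Metric.ball c l) +
          (k + 1) * ∫⁻ x in Metric.ball c l, v x := by
          rw [Finset.sum_add_distrib, ← Finset.mul_sum, ← Finset.mul_sum,
            ← volume_eq_sum_child c hl, ← setLIntegral_child c hl]
      _ ≤ _ := by
          refine (add_le_add_left (hmax c l hl) _).trans_eq ?_
          push_cast; ring

/-- A stopping argument: descend until the average exceeds `t`. On a stopping cube the level `t` is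
forgotten and `hC` applies with fewer generations left; elsewhere the running maximum is still `t`.
-/
theorem lintegral_runMax_le_level {v : (Fin n → ℝ) → ℝ≥0∞} {K : ℕ} {C : ℝ≥0∞}
    (hC : ∀ j ≤ K, ∀ c l, 0 < l →
      ∫⁻ x in Metric.ball c l, runMax v j c l 0 x ≤ C * ∫⁻ x in Metric.ball c l, v x)
    {j : ℕ} (hj : j ≤ K) (c : Fin n → ℝ) {l : ℝ} (hl : 0 < l) (t : ℝ≥0∞) :
    ∫⁻ x in Metric.ball c l, runMax v j c l t x ≤ t * volume (Metric.ball c l) +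
      C * ∫⁻ x in Metric.ball c l, (if t < runMax v j c l t x then v x else 0) := by
  have hlt : ∀ j ≤ K, ∀ c l, 0 < l → t < avg v c l →
      ∫⁻ x in Metric.ball c l, runMax v j c l t x ≤ t * volume (Metric.ball c l) +
      C * ∫⁻ x in Metric.ball c l, (if t < runMax v j c l t x then v x else 0) := by
    intro j hj c l hl hta
    have e1 : ∫⁻ x in Metric.ball c l, (if t < runMax v j c l t x then v x else 0) =
        ∫⁻ x in Metric.ball c l, v x := by
      refine lintegral_congr_ae ?_
      filter_upwards [ae_le_runMax v j c hl t] with x hx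
      rw [if_pos (hta.trans_le ((le_max_right _ _).trans hx))]
    rw [e1, runMax_congr_left v j c l (m := t) (m' := 0) (by rw [max_eq_right hta.le,
      max_eq_right zero_le])]
    exact (hC j hj c l hl).trans le_add_self
  induction j generalizing c l with
  | zero =>
    rcases lt_or_ge t (avg v c l) with h | h
    · exact hlt 0 hj c l hl h
    · simp [runMax, max_eq_left h]
  | succ j ih =>
    rcases lt_or_ge t (avg v c l) with h | h
    · exact hlt _ hj c l hl h
    · rw [setLIntegral_runMax_succ v j c hl t fun _ r => r,
        setLIntegral_runMax_succ v j c hl t fun x r => if t < r then v x else 0, max_eq_left h,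
        volume_eq_sum_child c hl, Finset.mul_sum, Finset.mul_sum, ← Finset.sum_add_distrib]
      exact Finset.sum_le_sum fun s _ => ih (by omega) _ (half_pos hl)

/-- The weak type bound for the dyadic maximal function, by the same stopping cubes: each has
average greater than `t`. -/
theorem measure_level_le (v : (Fin n → ℝ) → ℝ≥0∞) (j : ℕ) (c : Fin n → ℝ) {l : ℝ} (hl : 0 < l)
    (t : ℝ≥0∞) :
    t * ∫⁻ x in Metric.ball c l, (if t < runMax v j c l t x then 1 else 0) ≤
      ∫⁻ x in Metric.ball c l, (if t < runMax v j c l t x then v x else 0) := by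
  have hlt : ∀ j c l, 0 < l → t < avg v c l →
      t * ∫⁻ x in Metric.ball c l, (if t < runMax v j c l t x then 1 else 0) ≤
      ∫⁻ x in Metric.ball c l, (if t < runMax v j c l t x then v x else 0) := by
    intro j c l hl hta
    have hae : ∀ᵐ x ∂(volume.restrict (Metric.ball c l)), t < runMax v j c l t x := by
      filter_upwards [ae_le_runMax v j c hl t] with x hx
      exact hta.trans_le ((le_max_right _ _).trans hx)
    have e1 : ∫⁻ x in Metric.ball c l, (if t < runMax v j c l t x then v x else 0) =
        ∫⁻ x in Metric.ball c l, v x := by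
      refine lintegral_congr_ae ?_
      filter_upwards [hae] with x hx
      rw [if_pos hx]
    have e2 : ∫⁻ x in Metric.ball c l, (if t < runMax v j c l t x then 1 else 0) ≤
        volume (Metric.ball c l) := by
      rw [← setLIntegral_one]
      refine lintegral_mono fun x => ?_
      split_ifs <;> simp
    rw [e1, ← avg_mul_volume v c hl]
    gcongr
  induction j generalizing c l with
  | zero =>
    rcases lt_or_ge t (avg v c l) with h | h
    · exact hlt 0 c l hl h
    · simp [runMax, max_eq_left h]
  | succ j ih =>
    rcases lt_or_ge t (avg v c l) with h | h
    · exact hlt _ c l hl h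
    · rw [setLIntegral_runMax_succ v j c hl t fun _ r => if t < r then 1 else 0,
        setLIntegral_runMax_succ v j c hl t fun x r => if t < r then v x else 0, max_eq_left h,
        Finset.mul_sum]
      exact Finset.sum_le_sum fun s _ => ih _ (half_pos hl)

/-- In effect `C` improves to `2 + (1 - η) C`. The set where the running maximum exceeds twice the
mean occupies at most half the cube, so its complement carries a fraction `η` of the mass, and `C`
is paid only on the rest. -/
theorem runMax_bound_improve {v : (Fin n → ℝ) → ℝ≥0∞}
    (hv : ∀ c l, ∫⁻ x in Metric.ball c l, v x ≠ ∞) {η : ℝ≥0∞}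
    (hη : ∀ c l, 0 < l → ∀ S, MeasurableSet S → S ⊆ Metric.ball c l →
      volume (Metric.ball c l) ≤ 2 * volume S →
      η * ∫⁻ x in Metric.ball c l, v x ≤ ∫⁻ x in S, v x) {K : ℕ} {C : ℝ≥0∞}
    (hC : ∀ j ≤ K, ∀ c l, 0 < l →
      ∫⁻ x in Metric.ball c l, runMax v j c l 0 x ≤ C * ∫⁻ x in Metric.ball c l, v x)
    {j : ℕ} (hj : j ≤ K) (c : Fin n → ℝ) {l : ℝ} (hl : 0 < l) :
    (∫⁻ x in Metric.ball c l, runMax v j c l 0 x) + C * η * ∫⁻ x in Metric.ball c l, v x ≤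
      (2 + C) * ∫⁻ x in Metric.ball c l, v x := by
  set a := avg v c l with ha
  set I := ∫⁻ x in Metric.ball c l, v x with hI
  set V := volume (Metric.ball c l) with hV
  have haV : a * V = I := avg_mul_volume v c hl
  have hb : MeasurableSet (Metric.ball c l) := Metric.isOpen_ball.measurableSet
  rcases eq_or_ne a 0 with h0 | h0
  · have hI0 : I = 0 := by rw [← haV, h0, zero_mul]
    have := hC j hj c l hl
    rw [← hI, hI0, mul_zero] at this
    rw [hI0, mul_zero, mul_zero, add_zero]
    exact this
  have hVtop : V ≠ ∞ := volume_cube_ne_top c l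
  have hatop : a ≠ ∞ := avg_ne_top hl (hv c l)
  -- The threshold is twice the mean so that the weak type bound gives measure at most one half.
  set T : Set (Fin n → ℝ) := {x | 2 * a < runMax v j c l (2 * a) x} with hT
  have hTm : MeasurableSet T := measurableSet_lt measurable_const (measurable_runMax v j c l _)
  set S := Metric.ball c l ∩ T with hS
  have hite : ∀ g : (Fin n → ℝ) → ℝ≥0∞, ∫⁻ x in Metric.ball c l,
      (if 2 * a < runMax v j c l (2 * a) x then g x else 0) = ∫⁻ x in S, g x := by
    intro g
    rw [hS, inter_comm, ← Measure.restrict_restrict hTm, ← lintegral_indicator hTm]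
    refine lintegral_congr fun x => ?_
    simp only [indicator_apply, hT, mem_ofPred_eq]
  have h1 := lintegral_runMax_le_level hC hj c hl (2 * a)
  have h2 := measure_level_le v j c hl (2 * a)
  rw [hite] at h1
  rw [hite fun _ => 1, setLIntegral_one, hite v] at h2
  have hsplit : (∫⁻ x in S, v x) + ∫⁻ x in Metric.ball c l \ S, v x = I := by
    rw [hS, sdiff_self_inter]
    exact lintegral_inter_add_sdiff v _ hTm
  have hVsplit : volume S + volume (Metric.ball c l \ S) = V := by
    rw [hS, sdiff_self_inter]
    exact measure_inter_add_sdiff _ hTm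
  have h3 : 2 * volume S ≤ V := by
    have : a * (2 * volume S) ≤ a * V := by
      rw [haV, ← mul_assoc, mul_comm a 2]
      exact h2.trans (le_self_add.trans hsplit.le)
    exact (ENNReal.mul_le_mul_iff_right h0 hatop).1 this
  have h4 : V ≤ 2 * volume (Metric.ball c l \ S) := by
    have : V + V ≤ V + 2 * volume (Metric.ball c l \ S) := by
      calc V + V = 2 * volume S + 2 * volume (Metric.ball c l \ S) := by
            rw [← mul_add, hVsplit, two_mul]
        _ ≤ _ := by gcongr
    exact (ENNReal.add_le_add_iff_left hVtop).1 this
  have h5 := hη c l hl _ (hb.diff (hb.inter hTm)) sdiff_subset h4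
  calc (∫⁻ x in Metric.ball c l, runMax v j c l 0 x) + C * η * I
      ≤ (2 * a * V + C * ∫⁻ x in S, v x) + C * ∫⁻ x in Metric.ball c l \ S, v x := by
        rw [mul_assoc C η I]
        gcongr
        exact (lintegral_mono fun x => runMax_mono v j c l zero_le x).trans h1
    _ = (2 + C) * I := by
        rw [add_assoc, ← mul_add, hsplit, mul_assoc, haV, add_mul]

/-- Iterating `C ↦ 2 + (1 - η) C` from `2/η + k + 1` converges to the fixed point `2/η`, which no
longer depends on `k`. -/
theorem runMax_bound_of_large_subsets {v : (Fin n → ℝ) → ℝ≥0∞}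
    (hv : ∀ c l, ∫⁻ x in Metric.ball c l, v x ≠ ∞) {η : ℝ} (hη0 : 0 < η) (hη1 : η ≤ 1)
    (hη : ∀ c l, 0 < l → ∀ S, MeasurableSet S → S ⊆ Metric.ball c l →
      volume (Metric.ball c l) ≤ 2 * volume S →
      ENNReal.ofReal η * ∫⁻ x in Metric.ball c l, v x ≤ ∫⁻ x in S, v x)
    (k : ℕ) (c : Fin n → ℝ) {l : ℝ} (hl : 0 < l) :
    ∫⁻ x in Metric.ball c l, runMax v k c l 0 x ≤
      ENNReal.ofReal (2 / η) * ∫⁻ x in Metric.ball c l, v x := by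
  have hη' : 0 ≤ 1 - η := by linarith
  have h : ∀ i : ℕ, ∀ j ≤ k, ∀ c l, 0 < l → ∫⁻ x in Metric.ball c l, runMax v j c l 0 x ≤
      ENNReal.ofReal (2 / η + (1 - η) ^ i * (k + 1)) * ∫⁻ x in Metric.ball c l, v x := by
    intro i
    induction i with
    | zero =>
      intro j hj c l hl
      refine (lintegral_runMax_le_succ v j c hl 0).trans ?_
      rw [zero_mul, zero_add]
      gcongr
      rw [← ENNReal.ofReal_natCast, ← ENNReal.ofReal_one,
        ← ENNReal.ofReal_add (by positivity) zero_le_one]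
      refine ENNReal.ofReal_le_ofReal ?_
      have : (j : ℝ) ≤ k := by exact_mod_cast hj
      have : 0 ≤ 2 / η := by positivity
      linarith
    | succ i ih =>
      intro j hj c l hl
      have h1 := runMax_bound_improve hv hη ih hj c hl
      have hC0 : 0 ≤ 2 / η + (1 - η) ^ i * (k + 1) := by positivity
      have e1 : 2 + ENNReal.ofReal (2 / η + (1 - η) ^ i * (k + 1)) =
          ENNReal.ofReal (2 / η + (1 - η) ^ (i + 1) * (k + 1)) +
          ENNReal.ofReal (2 / η + (1 - η) ^ i * (k + 1)) * ENNReal.ofReal η := by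
        rw [← ENNReal.ofReal_mul hC0, ← ENNReal.ofReal_add (by positivity) (by positivity),
          ← ENNReal.ofReal_ofNat, ← ENNReal.ofReal_add (by positivity) hC0]
        congr 1
        field_simp
        ring
      rw [e1, add_mul] at h1
      exact (ENNReal.add_le_add_iff_right (ENNReal.mul_ne_top (by finiteness) (hv c l))).1 h1
  have hlim : Filter.Tendsto (fun i : ℕ => ENNReal.ofReal (2 / η + (1 - η) ^ i * (k + 1)) *
      ∫⁻ x in Metric.ball c l, v x) Filter.atTop
      (nhds (ENNReal.ofReal (2 / η) * ∫⁻ x in Metric.ball c l, v x)) := by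
    refine ENNReal.Tendsto.mul_const (ENNReal.tendsto_ofReal ?_) (Or.inr (hv c l))
    have := ((tendsto_pow_atTop_nhds_zero_of_lt_one hη' (by linarith)).mul_const
      ((k : ℝ) + 1)).const_add (2 / η)
    simpa using this
  exact ge_of_tendsto' hlim fun i => h i k le_rfl c l hl

/-! ### Comparison of maximal functions and finiteness of the Fujii–Wilson supremum. -/

/-- The uncentred maximal function over cubes. -/
noncomputable def supMax (g : (Fin n → ℝ) → ℝ≥0∞) (x : Fin n → ℝ) : ℝ≥0∞ :=
  ⨆ (c : Fin n → ℝ) (l : ℝ) (_ : 0 < l) (_ : x ∈ Metric.ball c l), avg g c l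

theorem avg_le_supMax (g : (Fin n → ℝ) → ℝ≥0∞) {x c : Fin n → ℝ} {l : ℝ} (hl : 0 < l)
    (hx : x ∈ Metric.ball c l) : avg g c l ≤ supMax g x :=
  le_iSup_of_le c (le_iSup_of_le l (le_iSup_of_le hl (le_iSup_of_le hx le_rfl)))

theorem avg_congr_ae {f g : (Fin n → ℝ) → ℝ≥0∞} (h : f =ᵐ[volume] g) (c : Fin n → ℝ) (l : ℝ) :
    avg f c l = avg g c l := by
  unfold avg
  rw [lintegral_congr_ae (ae_restrict_of_ae h)]

theorem dyadicMax_congr_ae {f g : (Fin n → ℝ) → ℝ≥0∞} (h : f =ᵐ[volume] g) (D : ℝ) :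
    dyadicMax D f = dyadicMax D g := by
  funext x
  simp only [dyadicMax, avg_congr_ae h]

theorem runMax_le_supMax (v : (Fin n → ℝ) → ℝ≥0∞) {Q : Set (Fin n → ℝ)} (k : ℕ)
    {c : Fin n → ℝ} {l : ℝ} (hl : 0 < l) (m : ℝ≥0∞) (hQ : Metric.ball c l ⊆ Q)
    {x : Fin n → ℝ} (hx : x ∈ Metric.ball c l) :
    runMax v k c l m x ≤ max m (supMax (Q.indicator v) x) := by
  have hmax : ∀ c l, 0 < l → Metric.ball c l ⊆ Q → x ∈ Metric.ball c l →
      avg v c l ≤ supMax (Q.indicator v) x := by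
    intro c l hl hQ hx
    refine le_trans (le_of_eq ?_) (avg_le_supMax _ hl hx)
    unfold avg
    congr 1
    exact setLIntegral_congr_fun Metric.isOpen_ball.measurableSet fun y hy =>
      (indicator_of_mem (hQ hy) _).symm
  induction k generalizing c l m with
  | zero => exact max_le_max_left _ (hmax c l hl hQ hx)
  | succ k ih =>
    by_cases h : ∃ s, x ∈ Metric.ball (child c l s) (l / 2)
    · obtain ⟨s, hs⟩ := h
      rw [runMax_succ_of_mem v k c hl m hs]
      refine (ih (half_pos hl) _ ((child_ball_subset c hl s).trans hQ) hs).trans ?_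
      exact max_le (max_le_max_left _ (hmax c l hl hQ hx)) (le_max_right _ _)
    · push Not at h
      rw [runMax, Finset.sum_eq_zero fun s _ => indicator_of_notMem (h s) _]
      exact zero_le

theorem avg_le_four_mul {g : (Fin n → ℝ) → ℝ≥0∞} {c x : Fin n → ℝ} {l ρ : ℝ} (hl : 0 < l)
    (hρ : 0 < ρ) (hρl : ρ ≤ 4 * l)
    (h : ∫⁻ y in Metric.ball c l, g y ≤ ∫⁻ y in Metric.ball x ρ, g y) :
    avg g c l ≤ 4 ^ n * avg g x ρ := by
  have hv : volume (Metric.ball x ρ) ≤ 4 ^ n * volume (Metric.ball c l) := by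
    rw [volume_cube _ hρ, volume_cube _ hl, ← mul_pow, ← ENNReal.ofReal_ofNat,
      ← ENNReal.ofReal_mul (by norm_num)]
    exact pow_le_pow_left' (ENNReal.ofReal_le_ofReal (by linarith)) n
  rw [avg]
  refine ENNReal.div_le_of_le_mul (h.trans ?_)
  rw [← avg_mul_volume g x hρ, mul_right_comm, mul_comm]
  gcongr

/-- A cube containing `x` is replaced by a centred one of admissible size, at most four times as
large: half-side `2l` when the cube is at least as large as the support, otherwise `2l/2^k` with
`l/2^(k+1) < l' ≤ l/2^k`. -/
theorem supMax_le_dyadicMax (v : (Fin n → ℝ) → ℝ≥0∞) {c x : Fin n → ℝ} {l : ℝ} (hl : 0 < l)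
    (hx : x ∈ Metric.ball c l) :
    supMax ((Metric.ball c l).indicator v) x ≤
      4 ^ n * dyadicMax (4 * l) ((Metric.ball c l).indicator v) x := by
  refine iSup_le fun c' => iSup_le fun l' => iSup_le fun hl' => iSup_le fun hx' => ?_
  rcases le_or_gt l l' with h | h
  · refine (avg_le_four_mul (ρ := 4 * l / 2 ^ 1) (x := x) hl' (by positivity) (by linarith)
      ?_).trans ?_
    · refine (setLIntegral_le_lintegral _ _).trans (le_of_eq ?_)
      rw [lintegral_indicator Metric.isOpen_ball.measurableSet,
        lintegral_indicator Metric.isOpen_ball.measurableSet,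
        Measure.restrict_restrict Metric.isOpen_ball.measurableSet, inter_eq_left.2]
      intro y hy
      rw [Metric.mem_ball] at *
      have := dist_triangle_right y x c
      linarith
    · gcongr
      exact le_iSup (fun k : ℕ => avg _ x (4 * l / 2 ^ k)) 1
  · obtain ⟨k, hk1, hk2⟩ := exists_nat_pow_near_of_lt_one (x := l' / l) (y := (1 / 2 : ℝ))
      (by positivity) (by rw [div_le_one hl]; exact h.le) (by norm_num) (by norm_num)
    rw [div_le_iff₀ hl, one_div, inv_pow] at hk2
    rw [lt_div_iff₀ hl, one_div, inv_pow, pow_succ, mul_inv] at hk1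
    have e : 4 * l / 2 ^ (k + 1) = 2 * ((2 ^ k)⁻¹ * l) := by rw [pow_succ]; field_simp; norm_num
    refine (avg_le_four_mul (ρ := 4 * l / 2 ^ (k + 1)) (x := x) hl' (by positivity)
      (by rw [e]; linarith) ?_).trans ?_
    · refine lintegral_mono_set fun y hy => ?_
      rw [Metric.mem_ball] at *
      have := dist_triangle_right y x c'
      rw [e]
      linarith
    · gcongr
      exact le_iSup (fun k : ℕ => avg _ x (4 * l / 2 ^ k)) (k + 1)

/-- The unweighted maximal theorem in `L^(1+ε)`, followed by reverse Hölder, then Hölder back to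
`L^1`. Only finiteness of the constant matters. -/
theorem exists_supMax_bound {v : (Fin n → ℝ) → ℝ≥0∞} (hvm : AEMeasurable v) {ε : ℝ} (hε : 0 < ε)
    (hRH : ∀ c l, 0 < l → ∫⁻ x in Metric.ball c l, v x ^ (1 + ε) ≤
      2 * (avg v c l ^ ε * ∫⁻ x in Metric.ball c l, v x)) :
    ∃ C : ℝ≥0∞, C ≠ ∞ ∧ ∀ c l, 0 < l →
      ∫⁻ x in Metric.ball c l, supMax ((Metric.ball c l).indicator v) x ≤
        C * ∫⁻ x in Metric.ball c l, v x := by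
  set t := 1 + ε with ht
  have ht1 : 1 < t := by linarith
  have ht0 : 0 < t := by linarith
  set C₀ : ℝ≥0∞ := 2 ^ t * (6 ^ n) ^ (1 : ℝ) * 1 * ENNReal.ofReal (t / (t - 1)) * 2 with hC₀
  have hC₀' : C₀ ≠ ∞ := by
    have : (2 : ℝ≥0∞) ^ t ≠ ∞ := ENNReal.rpow_ne_top_of_nonneg ht0.le (by norm_num)
    rw [hC₀, ENNReal.rpow_one]
    finiteness
  refine ⟨4 ^ n * C₀ ^ (1 / t), ENNReal.mul_ne_top (by finiteness)
    (ENNReal.rpow_ne_top_of_nonneg (by positivity) hC₀'), fun c l hl => ?_⟩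
  have hb : MeasurableSet (Metric.ball c l) := Metric.isOpen_ball.measurableSet
  have hV0 := volume_cube_ne_zero c hl
  have hV1 := volume_cube_ne_top c l
  obtain ⟨f, hfm, hf⟩ := hvm.indicator hb
  have hM := measurable_dyadicMax hfm (D := 4 * l) (by positivity)
  set I := ∫⁻ x in Metric.ball c l, v x with hI
  have hft : ∫⁻ x, f x ^ t = ∫⁻ x in Metric.ball c l, v x ^ t := by
    rw [← lintegral_indicator hb]
    refine lintegral_congr_ae ?_
    filter_upwards [hf] with x hx
    rw [← hx]
    by_cases hxb : x ∈ Metric.ball c l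
    · simp [hxb]
    · simp [hxb, ENNReal.zero_rpow_of_pos ht0]
  have hstrong := strong_type (p := t) le_rfl ht1 testCondition_volume (D := 4 * l)
    (by positivity) hfm
  have hIV : avg v c l ^ ε * I * volume (Metric.ball c l) ^ ε = I ^ t := by
    rw [mul_right_comm, ← ENNReal.mul_rpow_of_nonneg _ _ hε.le, avg_mul_volume v c hl, ht,
      add_comm, ENNReal.rpow_add_of_nonneg _ _ hε.le zero_le_one, ENNReal.rpow_one]
  have hpow : (∫⁻ x in Metric.ball c l, dyadicMax (4 * l) f x) ^ t ≤ C₀ * I ^ t := by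
    have h1 := lintegral_rpow_le_mul_measure (volume.restrict (Metric.ball c l))
      hM.aemeasurable ht1.le
    rw [Measure.restrict_apply_univ] at h1
    refine h1.trans ?_
    have h2 : ∫⁻ x in Metric.ball c l, dyadicMax (4 * l) f x ^ t ≤
        2 ^ t * (6 ^ n) ^ (1 : ℝ) * 1 * ENNReal.ofReal (t / (t - 1)) *
          (2 * (avg v c l ^ ε * I)) := by
      refine (setLIntegral_le_lintegral _ _).trans (hstrong.trans ?_)
      rw [hft]
      gcongr
      exact hRH c l hl
    rw [show t - 1 = ε by rw [ht]; ring]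
    rw [show t - 1 = ε by rw [ht]; ring] at h2
    refine (mul_le_mul_left h2 _).trans_eq ?_
    rw [← hIV, hC₀, show t - 1 = ε by rw [ht]; ring]
    ring
  have hroot : ∫⁻ x in Metric.ball c l, dyadicMax (4 * l) f x ≤ C₀ ^ (1 / t) * I := by
    have h := ENNReal.rpow_le_rpow hpow (z := 1 / t) (by positivity)
    rwa [ENNReal.mul_rpow_of_nonneg _ _ (by positivity), ← ENNReal.rpow_mul, ← ENNReal.rpow_mul,
      mul_one_div_cancel ht0.ne', ENNReal.rpow_one, ENNReal.rpow_one] at h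
  calc ∫⁻ x in Metric.ball c l, supMax ((Metric.ball c l).indicator v) x
      ≤ ∫⁻ x in Metric.ball c l, 4 ^ n * dyadicMax (4 * l) f x := by
        refine setLIntegral_mono' hb fun x hx => ?_
        rw [← dyadicMax_congr_ae hf]
        exact supMax_le_dyadicMax v hl hx
    _ = 4 ^ n * ∫⁻ x in Metric.ball c l, dyadicMax (4 * l) f x := lintegral_const_mul _ hM
    _ ≤ 4 ^ n * (C₀ ^ (1 / t) * I) := by gcongr
    _ = _ := by ring

/-! ### Muckenhoupt weights over cubes: the A_∞ property and the self-improvement from A_r to A_s.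
-/

/-- Hölder for the factorisation `g = (g W^(1/s)) W^(-1/s)`. -/
theorem setLIntegral_rpow_holder {W g : (Fin n → ℝ) → ℝ≥0∞} (hW : AEMeasurable W)
    (hg : AEMeasurable g) (hW0 : ∀ᵐ x, W x ≠ 0) (hW1 : ∀ x, W x ≠ ∞) {s : ℝ} (hs : 1 < s)
    (S : Set (Fin n → ℝ)) :
    (∫⁻ x in S, g x) ^ s ≤
      (∫⁻ x in S, g x ^ s * W x) * (∫⁻ x in S, W x ^ (-(1 / (s - 1)))) ^ (s - 1) := by
  have hs0 : 0 < s := by linarith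
  have hs1 : 0 < s - 1 := by linarith
  have hc := Real.HolderConjugate.conjExponent hs
  have h := ENNReal.lintegral_mul_le_Lp_mul_Lq (volume.restrict S) hc
    (f := fun x => g x * W x ^ (1 / s)) (g := fun x => W x ^ (-(1 / s)))
    (by fun_prop) (by fun_prop)
  have e1 : ∫⁻ x in S, ((fun x => g x * W x ^ (1 / s)) * fun x => W x ^ (-(1 / s))) x =
      ∫⁻ x in S, g x := by
    refine lintegral_congr_ae ?_
    filter_upwards [ae_restrict_of_ae hW0] with x hx
    rw [Pi.mul_apply, mul_assoc, ← ENNReal.rpow_add _ _ hx (hW1 x), add_neg_cancel,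
      ENNReal.rpow_zero, mul_one]
  have e2 : ∀ x, (g x * W x ^ (1 / s)) ^ s = g x ^ s * W x := by
    intro x
    rw [ENNReal.mul_rpow_of_nonneg _ _ hs0.le, ← ENNReal.rpow_mul, one_div_mul_cancel hs0.ne',
      ENNReal.rpow_one]
  have e3 : ∀ x, (W x ^ (-(1 / s))) ^ s.conjExponent = W x ^ (-(1 / (s - 1))) := by
    intro x
    rw [← ENNReal.rpow_mul]
    congr 1
    rw [Real.conjExponent]
    field_simp
  rw [e1] at h
  simp_rw [e2, e3] at h
  refine (ENNReal.rpow_le_rpow h hs0.le).trans_eq ?_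
  rw [ENNReal.mul_rpow_of_nonneg _ _ hs0.le, ← ENNReal.rpow_mul, ← ENNReal.rpow_mul,
    one_div_mul_cancel hs0.ne', ENNReal.rpow_one]
  congr 2
  rw [Real.conjExponent]
  field_simp

theorem inv_sub_one_div_one_add {x : ℝ} (hx : 1 < x) :
    1 / (x - 1) / (1 + 1 / (x - 1)) = 1 / x := by
  have h : x - 1 ≠ 0 := by linarith
  have e : 1 + 1 / (x - 1) = x / (x - 1) := by field_simp; ring
  rw [e]
  field_simp

theorem one_sub_conjExp {r : ℝ} (hr : 1 < r) : 1 - conjExp r = -(1 / (r - 1)) := by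
  have : r - 1 ≠ 0 := by linarith
  unfold conjExp
  field_simp
  ring

theorem setLIntegral_ne_zero_of_ae {W : (Fin n → ℝ) → ℝ≥0∞} (hW : AEMeasurable W)
    (hW0 : ∀ᵐ x, W x ≠ 0) (c : Fin n → ℝ) {l : ℝ} (hl : 0 < l) :
    ∫⁻ x in Metric.ball c l, W x ≠ 0 := by
  intro h
  rw [lintegral_eq_zero_iff' hW.restrict] at h
  have hf : ∀ᵐ x ∂(volume.restrict (Metric.ball c l)), False := by
    filter_upwards [h, ae_restrict_of_ae hW0] with x h1 h2 using h2 h1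
  rw [Filter.eventually_false_iff_eq_bot, ae_eq_bot, Measure.restrict_eq_zero] at hf
  exact volume_cube_ne_zero c hl hf

/-- The data of an `A_r` weight over cubes, `r > 1`, with constant `N` and dual weight `v`. -/
structure CubeMuckenhoupt (r : ℝ) (N : ℝ≥0∞) (W v : (Fin n → ℝ) → ℝ≥0∞) : Prop where
  one_lt : 1 < r
  aemeasurable : AEMeasurable W
  ne_zero : ∀ᵐ x, W x ≠ 0
  ne_top : ∀ x, W x ≠ ∞
  const_ne_top : N ≠ ∞
  dual : ∀ x, v x = W x ^ (-(1 / (r - 1)))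
  lintegral_ne_top : ∀ c l, ∫⁻ x in Metric.ball c l, W x ≠ ∞
  bound : ∀ c l, 0 < l → avg W c l * avg v c l ^ (r - 1) ≤ N

namespace CubeMuckenhoupt

variable {r : ℝ} {N : ℝ≥0∞} {W v : (Fin n → ℝ) → ℝ≥0∞}

theorem aemeasurable_dual (h : CubeMuckenhoupt r N W v) : AEMeasurable v := by
  have : v = fun x => W x ^ (-(1 / (r - 1))) := funext h.dual
  rw [this]
  exact h.aemeasurable.pow_const _

theorem dual_ne_zero (h : CubeMuckenhoupt r N W v) (x : Fin n → ℝ) : v x ≠ 0 := by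
  have hr : 0 < r - 1 := by linarith [h.one_lt]
  rw [h.dual, ENNReal.rpow_neg]
  exact ENNReal.inv_ne_zero.2 (ENNReal.rpow_ne_top_of_nonneg (by positivity) (h.ne_top x))

theorem avg_ne_zero (h : CubeMuckenhoupt r N W v) (c : Fin n → ℝ) {l : ℝ} (hl : 0 < l) :
    avg W c l ≠ 0 :=
  (ENNReal.div_pos (setLIntegral_ne_zero_of_ae h.aemeasurable h.ne_zero c hl)
    (volume_cube_ne_top c l)).ne'

theorem lintegral_dual_ne_top (h : CubeMuckenhoupt r N W v) (c : Fin n → ℝ) (l : ℝ) :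
    ∫⁻ x in Metric.ball c l, v x ≠ ∞ := by
  have hr : 0 < r - 1 := by linarith [h.one_lt]
  rcases le_or_gt l 0 with hl | hl
  · simp [Metric.ball_eq_empty.2 hl]
  intro htop
  have h1 : avg v c l = ∞ := by
    rw [avg, htop, ENNReal.top_div_of_ne_top (volume_cube_ne_top c l)]
  have h2 := h.bound c l hl
  rw [h1, ENNReal.top_rpow_of_pos hr, ENNReal.mul_top (h.avg_ne_zero c hl)] at h2
  exact h.const_ne_top (top_le_iff.1 h2)

theorem bound_integral (h : CubeMuckenhoupt r N W v) (c : Fin n → ℝ) {l : ℝ} (hl : 0 < l) :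
    (∫⁻ x in Metric.ball c l, W x) * (∫⁻ x in Metric.ball c l, v x) ^ (r - 1) ≤
      N * volume (Metric.ball c l) ^ r := by
  have hr : 0 < r - 1 := by linarith [h.one_lt]
  rw [← avg_mul_volume W c hl, ← avg_mul_volume v c hl, ENNReal.mul_rpow_of_nonneg _ _ hr.le]
  calc _ = (avg W c l * avg v c l ^ (r - 1)) *
        (volume (Metric.ball c l) * volume (Metric.ball c l) ^ (r - 1)) := by ring
    _ = (avg W c l * avg v c l ^ (r - 1)) * volume (Metric.ball c l) ^ r := by
        congr 1
        nth_rewrite 1 [← ENNReal.rpow_one (volume (Metric.ball c l))]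
        rw [← ENNReal.rpow_add_of_nonneg _ _ zero_le_one hr.le, add_sub_cancel]
    _ ≤ _ := by gcongr; exact h.bound c l hl

theorem measure_rpow_le (h : CubeMuckenhoupt r N W v) (S : Set (Fin n → ℝ)) :
    volume S ^ r ≤ (∫⁻ x in S, W x) * (∫⁻ x in S, v x) ^ (r - 1) := by
  have := setLIntegral_rpow_holder h.aemeasurable (g := fun _ => 1) aemeasurable_const h.ne_zero
    h.ne_top h.one_lt S
  simp only [setLIntegral_one, ENNReal.one_rpow, one_mul] at this
  simpa only [h.dual] using this

/-- Compare the A_r bound on the cube with Hölder on `S`, use that the `W`-mass of `S` is at most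
that of the cube, and cancel it. The maximum with 1 in `M` ensures `η ≤ 1`. -/
theorem exists_large_subset_bound (h : CubeMuckenhoupt r N W v) :
    ∃ η : ℝ, 0 < η ∧ η ≤ 1 ∧ ∀ c l, 0 < l → ∀ S, MeasurableSet S → S ⊆ Metric.ball c l →
      volume (Metric.ball c l) ≤ 2 * volume S →
      ENNReal.ofReal η * ∫⁻ x in Metric.ball c l, v x ≤ ∫⁻ x in S, v x := by
  have hr : 0 < r - 1 := by linarith [h.one_lt]
  have hr0 : 0 < r := by linarith
  set M : ℝ := 2 ^ r * max 1 N.toReal with hM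
  have hM1 : 1 ≤ M := by
    have h1 : (1 : ℝ) ≤ 2 ^ r := Real.one_le_rpow (by norm_num) hr0.le
    have h2 : (1 : ℝ) ≤ max 1 N.toReal := le_max_left _ _
    nlinarith
  have hM0 : 0 < M := by linarith
  have hNM : 2 ^ r * N ≤ ENNReal.ofReal M := by
    rw [hM, ENNReal.ofReal_mul (by positivity), ← ENNReal.ofReal_rpow_of_pos (by norm_num),
      ENNReal.ofReal_ofNat]
    gcongr
    exact (ENNReal.ofReal_toReal h.const_ne_top).symm.le.trans
      (ENNReal.ofReal_le_ofReal (le_max_right _ _))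
  refine ⟨(M ^ (1 / (r - 1)))⁻¹, by positivity,
    inv_le_one_of_one_le₀ (Real.one_le_rpow hM1 (by positivity)), fun c l hl S hS hSQ hVS => ?_⟩
  set a := ∫⁻ x in Metric.ball c l, W x with ha
  have ha0 : a ≠ 0 := setLIntegral_ne_zero_of_ae h.aemeasurable h.ne_zero c hl
  have ha1 : a ≠ ∞ := h.lintegral_ne_top c l
  have h1 : a * (∫⁻ x in Metric.ball c l, v x) ^ (r - 1) ≤
      a * (ENNReal.ofReal M * (∫⁻ x in S, v x) ^ (r - 1)) := by
    calc a * (∫⁻ x in Metric.ball c l, v x) ^ (r - 1) ≤ N * volume (Metric.ball c l) ^ r :=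
          h.bound_integral c hl
      _ ≤ N * (2 * volume S) ^ r := by gcongr
      _ = 2 ^ r * N * volume S ^ r := by
          rw [ENNReal.mul_rpow_of_nonneg _ _ hr0.le]; ring
      _ ≤ ENNReal.ofReal M * (a * (∫⁻ x in S, v x) ^ (r - 1)) := by
          gcongr
          refine (h.measure_rpow_le S).trans ?_
          gcongr
          exact lintegral_mono_set hSQ
      _ = _ := by ring
  have h2 := (ENNReal.mul_le_mul_iff_right ha0 ha1).1 h1
  have h3 := ENNReal.rpow_le_rpow h2 (z := 1 / (r - 1)) (by positivity)
  rw [ENNReal.mul_rpow_of_nonneg _ _ (by positivity), ← ENNReal.rpow_mul, ← ENNReal.rpow_mul,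
    mul_one_div_cancel hr.ne', ENNReal.rpow_one, ENNReal.rpow_one,
    ENNReal.ofReal_rpow_of_pos hM0] at h3
  rw [ENNReal.ofReal_inv_of_pos (by positivity), mul_comm, ← div_eq_mul_inv]
  refine ENNReal.div_le_of_le_mul ?_
  rwa [mul_comm]

theorem exists_supMax_bound (h : CubeMuckenhoupt r N W v) :
    ∃ C : ℝ≥0∞, C ≠ ∞ ∧ ∀ c l, 0 < l →
      ∫⁻ x in Metric.ball c l, supMax ((Metric.ball c l).indicator v) x ≤
        C * ∫⁻ x in Metric.ball c l, v x := by
  obtain ⟨η, hη0, hη1, hη⟩ := h.exists_large_subset_bound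
  have hA := fun k c l (hl : 0 < l) =>
    runMax_bound_of_large_subsets h.lintegral_dual_ne_top hη0 hη1 hη k c hl
  set A : NNReal := (2 / η).toNNReal with hAdef
  have hA1 : (2 : ℝ) ≤ A := by
    rw [Real.coe_toNNReal _ (by positivity), le_div_iff₀ hη0]
    linarith
  have hpow : (1 : ℝ) ≤ 2 ^ n := one_le_pow₀ (by norm_num)
  have hK : 1 < 2 * (A * 2 ^ n : ℝ) := by nlinarith
  -- This `ε` solves `ε/(1+ε) = 1/(2 A 2^n)`, the requirement of `reverse_holder`.
  refine LocalRiesz.exists_supMax_bound h.aemeasurable_dual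
    (ε := 1 / (2 * (A * 2 ^ n : ℝ) - 1)) (by rw [one_div_pos]; linarith) fun c l hl =>
      reverse_holder h.aemeasurable_dual h.lintegral_dual_ne_top (A := A)
        (by rw [one_div_pos]; linarith) ?_ hA c hl
  rw [inv_sub_one_div_one_add hK]
  have : (A : ℝ) ≠ 0 := by linarith
  field_simp

/-- The relation between `s` and `ε` makes the A_s dual weight of `W` equal to `v^(1+ε)`; the
reverse Hölder inequality returns it to `v`, at the cost `2^(s-1)`. -/
theorem testCondition (h : CubeMuckenhoupt r N W v) {s ε : ℝ} (hs : 1 < s) (hε : 0 < ε)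
    (hsε : (1 + ε) * (s - 1) = r - 1)
    (hRH : ∀ c l, 0 < l → ∫⁻ x in Metric.ball c l, v x ^ (1 + ε) ≤
      2 * (avg v c l ^ ε * ∫⁻ x in Metric.ball c l, v x)) :
    TestCondition (volume.withDensity W) s (2 ^ (s - 1) * N) := by
  intro c l hl g hg
  have hs1 : 0 < s - 1 := by linarith
  have hs0 : 0 < s := by linarith
  have hr : 0 < r - 1 := by linarith [h.one_lt]
  have hb : MeasurableSet (Metric.ball c l) := Metric.isOpen_ball.measurableSet
  have hV0 := volume_cube_ne_zero c hl
  have hV1 := volume_cube_ne_top c l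
  set V := volume (Metric.ball c l) with hV
  have e1 : ∫⁻ x in Metric.ball c l, g x ^ s ∂(volume.withDensity W) =
      ∫⁻ x in Metric.ball c l, g x ^ s * W x := by
    rw [setLIntegral_withDensity_eq_setLIntegral_mul_non_measurable₀ _ h.aemeasurable.restrict _ hb
      (Filter.Eventually.of_forall fun x => (h.ne_top x).lt_top)]
    exact lintegral_congr fun x => mul_comm _ _
  rw [e1, withDensity_apply _ hb, ← avg_mul_volume W c hl]
  set J := ∫⁻ x in Metric.ball c l, g x ^ s * W x
  have h1 := setLIntegral_rpow_holder h.aemeasurable hg.aemeasurable h.ne_zero h.ne_top hs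
    (Metric.ball c l)
  have e2 : ∀ x, W x ^ (-(1 / (s - 1))) = v x ^ (1 + ε) := by
    intro x
    rw [h.dual, ← ENNReal.rpow_mul]
    congr 1
    have : 1 + ε = (r - 1) / (s - 1) := by rw [eq_div_iff hs1.ne', hsε]
    rw [this]
    field_simp
  simp_rw [e2] at h1
  have h2 : (∫⁻ x in Metric.ball c l, v x ^ (1 + ε)) ^ (s - 1) ≤
      2 ^ (s - 1) * (avg v c l ^ (r - 1) * V ^ (s - 1)) := by
    refine (ENNReal.rpow_le_rpow (hRH c l hl) hs1.le).trans_eq ?_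
    rw [← avg_mul_volume v c hl, ← mul_assoc (avg v c l ^ ε)]
    have : avg v c l ^ ε * avg v c l = avg v c l ^ (1 + ε) := by
      rw [add_comm, ENNReal.rpow_add_of_nonneg _ _ hε.le zero_le_one, ENNReal.rpow_one]
    rw [this, ENNReal.mul_rpow_of_nonneg _ _ hs1.le, ENNReal.mul_rpow_of_nonneg _ _ hs1.le,
      ← ENNReal.rpow_mul, hsε]
  have hVs : V ^ s = V ^ (s - 1) * V := by
    nth_rewrite 3 [← ENNReal.rpow_one V]
    rw [← ENNReal.rpow_add_of_nonneg _ _ hs1.le zero_le_one, sub_add_cancel]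
  have hVs0 : V ^ (s - 1) ≠ 0 := by simp [ENNReal.rpow_eq_zero_iff, hV0, hV1]
  have hVs1 : V ^ (s - 1) ≠ ∞ := ENNReal.rpow_ne_top_of_nonneg hs1.le hV1
  have h3 : V ^ (s - 1) * (avg g c l ^ s * (avg W c l * V)) ≤
      V ^ (s - 1) * (2 ^ (s - 1) * N * J) := by
    calc V ^ (s - 1) * (avg g c l ^ s * (avg W c l * V))
        = (avg g c l * V) ^ s * avg W c l := by
          rw [ENNReal.mul_rpow_of_nonneg _ _ hs0.le, hVs]; ring
      _ ≤ (J * (2 ^ (s - 1) * (avg v c l ^ (r - 1) * V ^ (s - 1)))) * avg W c l := by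
          rw [avg_mul_volume g c hl]
          gcongr
          exact h1.trans (by gcongr)
      _ = V ^ (s - 1) * (2 ^ (s - 1) * (avg W c l * avg v c l ^ (r - 1)) * J) := by ring
      _ ≤ _ := by gcongr; exact h.bound c l hl
  exact (ENNReal.mul_le_mul_iff_right hVs0 hVs1).1 h3

end CubeMuckenhoupt

theorem testCondition_of_avg_le {W : (Fin n → ℝ) → ℝ≥0∞} (hW : AEMeasurable W)
    (hW1 : ∀ x, W x ≠ ∞) {N : ℝ≥0∞}
    (hN : ∀ᵐ x, ∀ c l, 0 < l → x ∈ Metric.ball c l → avg W c l ≤ N * W x) (hN1 : N ≠ ∞) :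
    TestCondition (volume.withDensity W) 1 N := by
  intro c l hl g hg
  have hb : MeasurableSet (Metric.ball c l) := Metric.isOpen_ball.measurableSet
  simp only [ENNReal.rpow_one]
  rw [setLIntegral_withDensity_eq_setLIntegral_mul_non_measurable₀ _ hW.restrict _ hb
    (Filter.Eventually.of_forall fun x => (hW1 x).lt_top), withDensity_apply _ hb,
    ← avg_mul_volume W c hl, mul_left_comm, avg_mul_volume g c hl, ← lintegral_const_mul' _ _ hN1,
    mul_comm, ← lintegral_mul_const _ hg]
  refine lintegral_mono_ae ?_
  filter_upwards [ae_restrict_of_ae hN, ae_restrict_mem hb] with x hx hxb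
  rw [Pi.mul_apply, mul_comm (g x), ← mul_assoc]
  gcongr
  exact hx c l hl hxb

/-! ### Transfer between Euclidean space and coordinates with the sup norm. -/

theorem measurableEmbedding_toLp :
    MeasurableEmbedding (WithLp.toLp 2 : (Fin n → ℝ) → Rn n) :=
  (MeasurableEquiv.toLp 2 (Fin n → ℝ)).measurableEmbedding

theorem setLIntegral_toLp (s : Set (Rn n)) (f : Rn n → ℝ≥0∞) :
    ∫⁻ y in WithLp.toLp 2 ⁻¹' s, f (WithLp.toLp 2 y) = ∫⁻ x in s, f x :=
  (PiLp.volume_preserving_toLp (Fin n)).setLIntegral_comp_preimage_emb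
    measurableEmbedding_toLp f s

theorem lintegral_toLp (f : Rn n → ℝ≥0∞) :
    ∫⁻ y, f (WithLp.toLp 2 y) = ∫⁻ x, f x := by
  simpa using setLIntegral_toLp univ f

theorem volume_toLp (s : Set (Rn n)) : volume (WithLp.toLp 2 ⁻¹' s) = volume s :=
  (PiLp.volume_preserving_toLp (Fin n)).measure_preimage_emb measurableEmbedding_toLp s

theorem ae_toLp {P : Rn n → Prop} (h : ∀ᵐ x, P x) : ∀ᵐ y : Fin n → ℝ, P (WithLp.toLp 2 y) :=
  (PiLp.volume_preserving_toLp (Fin n)).quasiMeasurePreserving.ae h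

theorem toLp_preimage_cube (c : Rn n) {l : ℝ} (hl : 0 < l) :
    WithLp.toLp 2 ⁻¹' cube c l = Metric.ball (WithLp.ofLp c) l := by
  ext y
  rw [Metric.mem_ball, dist_pi_lt_iff hl]
  rfl

theorem setLIntegral_cube (g : Rn n → ℝ≥0∞) (c : Rn n) {l : ℝ} (hl : 0 < l) :
    ∫⁻ x in cube c l, g x = ∫⁻ y in Metric.ball (WithLp.ofLp c) l, g (WithLp.toLp 2 y) := by
  rw [← setLIntegral_toLp, toLp_preimage_cube c hl]

theorem setLAverage_cube (g : Rn n → ℝ≥0∞) (c : Rn n) {l : ℝ} (hl : 0 < l) :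
    ⨍⁻ x in cube c l, g x ∂volume = avg (fun y => g (WithLp.toLp 2 y)) (WithLp.ofLp c) l := by
  rw [setLAverage_eq, setLIntegral_cube g c hl, avg, ← volume_toLp, toLp_preimage_cube c hl]

theorem cubeMaximal_eq_supMax (g : Rn n → ℝ≥0∞) (x : Rn n) :
    cubeMaximal g x = supMax (fun y => g (WithLp.toLp 2 y)) (WithLp.ofLp x) := by
  have hmem : ∀ (c : Rn n) (l : ℝ), 0 < l →
      (x ∈ cube c l ↔ WithLp.ofLp x ∈ Metric.ball (WithLp.ofLp c) l) := by
    intro c l hl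
    rw [← toLp_preimage_cube c hl]
    rfl
  refine le_antisymm ?_ ?_
  · refine iSup_le fun c => iSup_le fun l => iSup_le fun hl => iSup_le fun hx => ?_
    rw [setLAverage_cube g c hl]
    exact avg_le_supMax _ hl ((hmem c l hl).1 hx)
  · refine iSup_le fun c => iSup_le fun l => iSup_le fun hl => iSup_le fun hx => ?_
    refine le_iSup_of_le (WithLp.toLp 2 c) (le_iSup_of_le l (le_iSup_of_le hl
      (le_iSup_of_le ((hmem _ l hl).2 hx) ?_)))
    rw [setLAverage_cube g _ hl]

theorem setLIntegral_cubeMaximal (v : Rn n → ℝ≥0∞) (c : Rn n) {l : ℝ} (hl : 0 < l) :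
    ∫⁻ x in cube c l, cubeMaximal ((cube c l).indicator v) x =
      ∫⁻ y in Metric.ball (WithLp.ofLp c) l, supMax ((Metric.ball (WithLp.ofLp c) l).indicator
        fun y => v (WithLp.toLp 2 y)) y := by
  rw [setLIntegral_cube _ c hl]
  refine lintegral_congr fun y => ?_
  rw [cubeMaximal_eq_supMax, ← toLp_preimage_cube c hl]
  rfl

theorem fujiiWilsonConst_le {v : Rn n → ℝ≥0∞} {C : ℝ≥0∞}
    (hC : ∀ (c : Fin n → ℝ) (l : ℝ), 0 < l → ∫⁻ y in Metric.ball c l, supMax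
      ((Metric.ball c l).indicator fun y => v (WithLp.toLp 2 y)) y ≤
        C * ∫⁻ y in Metric.ball c l, v (WithLp.toLp 2 y)) : fujiiWilsonConst v ≤ C := by
  refine iSup_le fun c => iSup_le fun l => iSup_le fun hl => ?_
  rw [setLIntegral_cubeMaximal v c hl, setLIntegral_cube v c hl, mul_comm, ← div_eq_mul_inv]
  exact ENNReal.div_le_of_le_mul (hC _ l hl)

theorem setLIntegral_supMax_le {v : Rn n → ℝ≥0∞} (c : Fin n → ℝ) {l : ℝ} (hl : 0 < l)
    (h0 : ∫⁻ y in Metric.ball c l, v (WithLp.toLp 2 y) ≠ 0)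
    (h1 : ∫⁻ y in Metric.ball c l, v (WithLp.toLp 2 y) ≠ ∞) :
    ∫⁻ y in Metric.ball c l, supMax
      ((Metric.ball c l).indicator fun y => v (WithLp.toLp 2 y)) y ≤
        fujiiWilsonConst v * ∫⁻ y in Metric.ball c l, v (WithLp.toLp 2 y) := by
  have h : (∫⁻ x in cube (WithLp.toLp 2 c) l, v x)⁻¹ *
      ∫⁻ x in cube (WithLp.toLp 2 c) l,
        cubeMaximal ((cube (WithLp.toLp 2 c) l).indicator v) x ≤ fujiiWilsonConst v :=
    le_iSup_of_le (WithLp.toLp 2 c) (le_iSup_of_le l (le_iSup_of_le hl le_rfl))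
  rw [setLIntegral_cubeMaximal v _ hl, setLIntegral_cube v _ hl, mul_comm,
    ← div_eq_mul_inv] at h
  exact (ENNReal.div_le_iff h0 h1).1 h

theorem ball_subset_toLp_ball (hn : 1 ≤ n) (c : Fin n → ℝ) {l : ℝ} (hl : 0 < l) :
    Metric.ball c l ⊆ WithLp.toLp 2 ⁻¹' Metric.ball (WithLp.toLp 2 c : Rn n) (n * l) := by
  intro y hy
  have hn' : (1 : ℝ) ≤ n := by exact_mod_cast hn
  rw [Metric.mem_ball, dist_pi_lt_iff hl] at hy
  rw [mem_preimage, Metric.mem_ball, EuclideanSpace.dist_eq,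
    Real.sqrt_lt' (by positivity)]
  calc ∑ i, dist (y i) (c i) ^ 2 < ∑ _i : Fin n, l ^ 2 := by
        refine Finset.sum_lt_sum_of_nonempty ⟨⟨0, hn⟩, Finset.mem_univ _⟩ fun i _ => ?_
        exact pow_lt_pow_left₀ (hy i) dist_nonneg (by norm_num)
    _ = n * l ^ 2 := by simp
    _ ≤ (n * l) ^ 2 := by
        rw [mul_pow]
        gcongr
        nlinarith

theorem norm_ofLp_sub_le (x : Rn n) (y : Fin n → ℝ) :
    ‖WithLp.ofLp x - y‖ ≤ ‖x - WithLp.toLp 2 y‖ := by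
  refine (pi_norm_le_iff_of_nonneg (norm_nonneg _)).2 fun i => ?_
  exact PiLp.norm_apply_le (x - WithLp.toLp 2 y) i

theorem toLp_ball_subset (c : Rn n) (R : ℝ) :
    WithLp.toLp 2 ⁻¹' Metric.ball c R ⊆ Metric.ball (WithLp.ofLp c) R := by
  intro y hy
  rw [mem_preimage, mem_ball_iff_norm'] at hy
  rw [mem_ball_iff_norm']
  exact (norm_ofLp_sub_le c y).trans_lt hy

/-- The cube lies in the Euclidean ball of radius `n l`, which lies in the cube of half-side `n l`;
this gives the volume ratio `n^n`. -/
theorem avg_le_setLAverage_ball (hn : 1 ≤ n) (g : Rn n → ℝ≥0∞) (c : Fin n → ℝ) {l : ℝ}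
    (hl : 0 < l) : avg (fun y => g (WithLp.toLp 2 y)) c l ≤
      n ^ n * ⨍⁻ x in Metric.ball (WithLp.toLp 2 c) (n * l), g x ∂volume := by
  have hn' : (0 : ℝ) < n := by exact_mod_cast hn
  have hnl : 0 < n * l := by positivity
  have hv0 : volume (Metric.ball (WithLp.toLp 2 c : Rn n) (n * l)) ≠ 0 :=
    (Metric.measure_ball_pos _ _ hnl).ne'
  have hv1 : volume (Metric.ball (WithLp.toLp 2 c : Rn n) (n * l)) ≠ ∞ := measure_ball_lt_top.ne
  have hv : volume (Metric.ball (WithLp.toLp 2 c : Rn n) (n * l)) ≤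
      n ^ n * volume (Metric.ball c l) := by
    rw [← volume_toLp]
    refine (measure_mono (toLp_ball_subset _ _)).trans_eq ?_
    rw [volume_cube_mul _ c hn' hl, ENNReal.ofReal_natCast]
  rw [setLAverage_eq, avg]
  refine ENNReal.div_le_of_le_mul ?_
  calc ∫⁻ y in Metric.ball c l, g (WithLp.toLp 2 y)
      ≤ ∫⁻ x in Metric.ball (WithLp.toLp 2 c) (n * l), g x := by
        rw [← setLIntegral_toLp]
        exact lintegral_mono_set (ball_subset_toLp_ball hn c hl)
    _ = volume (Metric.ball (WithLp.toLp 2 c : Rn n) (n * l)) *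
        ((∫⁻ x in Metric.ball (WithLp.toLp 2 c) (n * l), g x) /
          volume (Metric.ball (WithLp.toLp 2 c : Rn n) (n * l))) :=
        (ENNReal.mul_div_cancel hv0 hv1).symm
    _ ≤ n ^ n * volume (Metric.ball c l) *
        ((∫⁻ x in Metric.ball (WithLp.toLp 2 c) (n * l), g x) /
          volume (Metric.ball (WithLp.toLp 2 c : Rn n) (n * l))) := by gcongr
    _ = _ := by ring

theorem ae_of_forall_ball {P : Rn n → Prop}
    (h : ∀ k : ℕ, ∀ᵐ x ∂(volume.restrict (Metric.ball (0 : Rn n) k)), P x) : ∀ᵐ x, P x := by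
  have := (ae_restrict_iUnion_iff (μ := volume) (fun k : ℕ => Metric.ball (0 : Rn n) k) P).2 h
  rwa [Metric.iUnion_ball_nat, Measure.restrict_univ] at this

namespace IsWeight

variable {w : Rn n → ℝ}

theorem aemeasurable_ofReal (hw : IsWeight w) : AEMeasurable fun x => ENNReal.ofReal (w x) :=
  hw.locallyIntegrable.aestronglyMeasurable.aemeasurable.ennreal_ofReal

theorem aemeasurable_toLp (hw : IsWeight w) :
    AEMeasurable fun y : Fin n → ℝ => ENNReal.ofReal (w (WithLp.toLp 2 y)) :=
  hw.aemeasurable_ofReal.comp_quasiMeasurePreserving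
    (PiLp.volume_preserving_toLp (Fin n)).quasiMeasurePreserving

theorem lintegral_ball_ne_top (hw : IsWeight w) (c : Rn n) (R : ℝ) :
    ∫⁻ x in Metric.ball c R, ENNReal.ofReal (w x) ≠ ∞ := by
  have h : IntegrableOn w (Metric.ball c R) :=
    (hw.locallyIntegrable.integrableOn_isCompact (isCompact_closedBall c R)).mono_set
      Metric.ball_subset_closedBall
  exact h.lintegral_lt_top.ne

theorem lintegral_toLp_ne_top (hn : 1 ≤ n) (hw : IsWeight w) (c : Fin n → ℝ) (l : ℝ) :
    ∫⁻ y in Metric.ball c l, ENNReal.ofReal (w (WithLp.toLp 2 y)) ≠ ∞ := by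
  rcases le_or_gt l 0 with hl | hl
  · simp [Metric.ball_eq_empty.2 hl]
  refine ne_top_of_le_ne_top (hw.lintegral_ball_ne_top (WithLp.toLp 2 c) (n * l)) ?_
  rw [← setLIntegral_toLp]
  exact lintegral_mono_set (ball_subset_toLp_ball hn c hl)

theorem exists_lintegral_ball_ne_zero (hw : IsWeight w) (K : ℝ) :
    ∃ R : ℝ, K ≤ R ∧ 0 < R ∧ ∫⁻ x in Metric.ball 0 R, ENNReal.ofReal (w x) ≠ 0 := by
  by_contra! hcon
  refine hw.not_ae_zero (ae_of_forall_ball fun k => ?_)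
  have h := hcon (max K (k + 1)) (le_max_left _ _) (lt_max_of_lt_right (by positivity))
  rw [lintegral_eq_zero_iff' hw.aemeasurable_ofReal.restrict] at h
  have h' := ae_restrict_of_ae_restrict_of_subset (Metric.ball_subset_ball
    (show (k : ℝ) ≤ max K (k + 1) from le_max_of_le_right (by linarith))) h
  filter_upwards [h'] with x hx
  exact le_antisymm (ENNReal.ofReal_eq_zero.1 hx) (hw.nonneg x)

end IsWeight

/-- On a large ball `w` has positive mass, so the A_r bound forces the dual weight to be integrable
there, whereas it is `∞` where `w` vanishes. -/
theorem MemMuckenhoupt.ae_ne_zero {r : ℝ} (hr : 1 < r) {w : Rn n → ℝ} (hw : MemMuckenhoupt r w) :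
    ∀ᵐ x, ENNReal.ofReal (w x) ≠ 0 := by
  have hr1 : 0 < r - 1 := by linarith
  refine ae_of_forall_ball fun k => ?_
  obtain ⟨R, hkR, hR, hint⟩ := hw.1.exists_lintegral_ball_ne_zero k
  have hv1 : volume (Metric.ball (0 : Rn n) R) ≠ ∞ := measure_ball_lt_top.ne
  have hlt : (⨍⁻ x in Metric.ball 0 R, ENNReal.ofReal (w x) ∂volume) *
      (⨍⁻ x in Metric.ball 0 R, ENNReal.ofReal (w x) ^ (1 - conjExp r) ∂volume) ^ (r - 1) < ∞ := by
    refine lt_of_le_of_lt ?_ hw.2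
    rw [muckenhouptConst, if_neg hr.ne']
    exact le_iSup_of_le 0 (le_iSup_of_le R (le_iSup_of_le hR le_rfl))
  have hw0 : ⨍⁻ x in Metric.ball 0 R, ENNReal.ofReal (w x) ∂volume ≠ 0 := by
    rw [setLAverage_eq]
    exact (ENNReal.div_pos hint hv1).ne'
  have hσ : ∫⁻ x in Metric.ball 0 R, ENNReal.ofReal (w x) ^ (1 - conjExp r) ≠ ∞ := by
    intro h
    rw [setLAverage_eq _ (fun x => ENNReal.ofReal (w x) ^ (1 - conjExp r)), h,
      ENNReal.top_div_of_ne_top hv1, ENNReal.top_rpow_of_pos hr1, ENNReal.mul_top hw0] at hlt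
    exact lt_irrefl _ hlt
  have hae := ae_lt_top' (hw.1.aemeasurable_ofReal.pow_const _).restrict hσ
  filter_upwards [ae_restrict_of_ae_restrict_of_subset (Metric.ball_subset_ball hkR) hae]
    with x hx h0
  rw [h0, one_sub_conjExp hr, ENNReal.zero_rpow_of_neg (by
    have : 0 < 1 / (r - 1) := by positivity
    linarith)] at hx
  exact lt_irrefl _ hx

theorem MemMuckenhoupt.cubeMuckenhoupt (hn : 1 ≤ n) {r : ℝ} (hr : 1 < r) {w : Rn n → ℝ}
    (hw : MemMuckenhoupt r w) :
    CubeMuckenhoupt r ((n ^ n) ^ r * muckenhouptConst r w)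
      (fun y => ENNReal.ofReal (w (WithLp.toLp 2 y))) (fun y => dualWeight r w (WithLp.toLp 2 y))
    where
  one_lt := hr
  aemeasurable := hw.1.aemeasurable_toLp
  ne_zero := ae_toLp (hw.ae_ne_zero hr)
  ne_top _ := ENNReal.ofReal_ne_top
  const_ne_top := ENNReal.mul_ne_top (ENNReal.rpow_ne_top_of_nonneg (by linarith) (by finiteness))
    hw.2.ne
  dual y := by rw [dualWeight, one_sub_conjExp hr]
  lintegral_ne_top := hw.1.lintegral_toLp_ne_top hn
  bound c l hl := by
    have hr1 : 0 ≤ r - 1 := by linarith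
    have hn' : (0 : ℝ) < n := by exact_mod_cast hn
    have h1 := avg_le_setLAverage_ball hn (fun x => ENNReal.ofReal (w x)) c hl
    have h2 := avg_le_setLAverage_ball hn (dualWeight r w) c hl
    have h3 : (⨍⁻ x in Metric.ball (WithLp.toLp 2 c) (n * l), ENNReal.ofReal (w x) ∂volume) *
        (⨍⁻ x in Metric.ball (WithLp.toLp 2 c) (n * l), dualWeight r w x ∂volume) ^ (r - 1) ≤
        muckenhouptConst r w := by
      rw [muckenhouptConst, if_neg hr.ne']
      exact le_iSup_of_le (WithLp.toLp 2 c) (le_iSup_of_le (n * l)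
        (le_iSup_of_le (by positivity) le_rfl))
    have h4 : ((n : ℝ≥0∞) ^ n) ^ r = n ^ n * (n ^ n) ^ (r - 1) := by
      nth_rewrite 2 [← ENNReal.rpow_one ((n : ℝ≥0∞) ^ n)]
      rw [← ENNReal.rpow_add_of_nonneg _ _ zero_le_one hr1, add_sub_cancel]
    refine (mul_le_mul' h1 (ENNReal.rpow_le_rpow h2 hr1)).trans ?_
    rw [ENNReal.mul_rpow_of_nonneg _ _ hr1, mul_mul_mul_comm, ← h4]
    gcongr

/-- Excludes `0/0 = 0` in the A_1 quotient, so a zero of `w` makes that quotient infinite. -/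
theorem ballMaximal_ne_zero {w : Rn n → ℝ} (hw : IsWeight w) (x : Rn n) :
    ballMaximal (fun y => ENNReal.ofReal (w y)) x ≠ 0 := by
  obtain ⟨R, hxR, hR, hint⟩ := hw.exists_lintegral_ball_ne_zero (‖x‖ + 1)
  have hx : x ∈ Metric.ball (0 : Rn n) R := by
    rw [mem_ball_zero_iff]; linarith
  have h : ⨍⁻ y in Metric.ball 0 R, ENNReal.ofReal (w y) ∂volume ≤
      ballMaximal (fun y => ENNReal.ofReal (w y)) x :=
    le_iSup_of_le 0 (le_iSup_of_le R (le_iSup_of_le hR (le_iSup_of_le hx le_rfl)))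
  rw [setLAverage_eq] at h
  exact (lt_of_lt_of_le (ENNReal.div_pos hint measure_ball_lt_top.ne) h).ne'

theorem MemMuckenhoupt.ae_ballMaximal_le {w : Rn n → ℝ} (hw : MemMuckenhoupt 1 w) :
    ∀ᵐ x, ENNReal.ofReal (w x) ≠ 0 ∧ ballMaximal (fun y => ENNReal.ofReal (w y)) x ≤
      muckenhouptConst 1 w * ENNReal.ofReal (w x) := by
  have h : muckenhouptConst 1 w = essSup (fun x =>
      ballMaximal (fun y => ENNReal.ofReal (w y)) x / ENNReal.ofReal (w x)) volume := if_pos rfl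
  have hlt := hw.2
  rw [h] at hlt ⊢
  filter_upwards [ENNReal.ae_le_essSup fun x =>
    ballMaximal (fun y => ENNReal.ofReal (w y)) x / ENNReal.ofReal (w x)] with x hx
  have h0 : ENNReal.ofReal (w x) ≠ 0 := by
    intro h0
    rw [h0, ENNReal.div_zero (ballMaximal_ne_zero hw.1 x)] at hx
    exact hlt.ne (top_le_iff.1 hx)
  exact ⟨h0, (ENNReal.div_le_iff h0 ENNReal.ofReal_ne_top).1 hx⟩

theorem MemMuckenhoupt.testCondition_one (hn : 1 ≤ n) {w : Rn n → ℝ} (hw : MemMuckenhoupt 1 w) :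
    TestCondition (volume.withDensity fun y : Fin n → ℝ => ENNReal.ofReal (w (WithLp.toLp 2 y))) 1
      (n ^ n * muckenhouptConst 1 w) := by
  have hn' : (0 : ℝ) < n := by exact_mod_cast hn
  refine testCondition_of_avg_le hw.1.aemeasurable_toLp (fun _ => ENNReal.ofReal_ne_top) ?_
    (ENNReal.mul_ne_top (by finiteness) hw.2.ne)
  filter_upwards [ae_toLp hw.ae_ballMaximal_le] with x hx c l hl hxc
  refine (avg_le_setLAverage_ball hn (fun x => ENNReal.ofReal (w x)) c hl).trans ?_
  rw [mul_assoc]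
  gcongr
  refine le_trans ?_ hx.2
  exact le_iSup_of_le (WithLp.toLp 2 c) (le_iSup_of_le (n * l) (le_iSup_of_le (by positivity)
    (le_iSup_of_le (ball_subset_toLp_ball hn c hl hxc) le_rfl)))

/-- The sup norm is at most the Euclidean norm; at coinciding points both sides are `0⁻¹ = 0`. -/
theorem inv_norm_rpow_le {β : ℝ} (hβ : 0 < β) (x : Rn n) (y : Fin n → ℝ) :
    (‖x - WithLp.toLp 2 y‖ ^ β)⁻¹ ≤ (‖WithLp.ofLp x - y‖ ^ β)⁻¹ := by
  rcases (norm_nonneg (WithLp.ofLp x - y)).eq_or_lt with h | h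
  · have hx : x = WithLp.toLp 2 y := by
      rw [eq_comm, norm_eq_zero, sub_eq_zero] at h
      rw [← h]
    rw [hx]
    simp [Real.zero_rpow hβ.ne']
  · exact inv_anti₀ (by positivity) (Real.rpow_le_rpow h.le (norm_ofLp_sub_le x y) hβ.le)

theorem lintegral_rieszIntegrand_le {α : ℝ} (hα : α < n) (f : Rn n → ℝ)
    {F : (Fin n → ℝ) → ℝ≥0∞} (hF : (fun y => ‖f (WithLp.toLp 2 y)‖ₑ) =ᵐ[volume] F) (x : Rn n) :
    ∫⁻ y, ‖rieszIntegrand α f x y‖ₑ ≤ cubeRiesz α F (WithLp.ofLp x) := by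
  rw [← lintegral_toLp]
  refine lintegral_mono_ae ?_
  filter_upwards [hF] with y hy
  have hpos : 0 ≤ (‖x - WithLp.toLp 2 y‖ ^ ((n : ℝ) - α))⁻¹ := by positivity
  rw [← hy, rieszIntegrand, div_eq_mul_inv, enorm_mul, Real.enorm_of_nonneg hpos]
  exact mul_le_mul_right (ENNReal.ofReal_le_ofReal (inv_norm_rpow_le (sub_pos.2 hα) x y)) _

/-- The potential of `|f|` is dominated by `cubeRiesz` on the cube circumscribing the ball. The same
bound gives absolute convergence almost everywhere, as its right side is finite and `w > 0` almost
everywhere. -/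
theorem weightedAverage_rieszPotential_le {α p s q : ℝ} {N : ℝ≥0∞} {w : Rn n → ℝ}
    (hα : 0 < α) (hp : 1 < p) (hpn : α * p < n) (hs : 1 ≤ s) (hsp : s < p)
    (hq : 1 / q = 1 / p - α / (n * s)) (hn : 1 ≤ n) (hw : IsWeight w)
    (hw0 : ∀ᵐ x, ENNReal.ofReal (w x) ≠ 0) (hN : N ≠ ∞)
    (hν : TestCondition
      (volume.withDensity fun y : Fin n → ℝ => ENNReal.ofReal (w (WithLp.toLp 2 y))) s N)
    (x₀ : Rn n) {R : ℝ} (hR : 0 < R) {f : Rn n → ℝ}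
    (hf : MemWeightedLp w (Metric.ball x₀ R) p f) :
    (∀ᵐ x ∂(volume.restrict (Metric.ball x₀ R)),
      Integrable (rieszIntegrand α ((Metric.ball x₀ R).indicator f) x) volume) ∧
    weightedAverage w (Metric.ball x₀ R) q
        (rieszPotential α ((Metric.ball x₀ R).indicator f)) ≤
      ENNReal.ofReal (8 ^ n * R ^ α) *
      (ENNReal.ofReal ((2 * n + 4) / α * sobolevExponent n α p) *
        ((2 * 6 ^ n) * (ENNReal.ofReal (p / (p - s)) ^ (1 / q) *
          (N ^ (1 / p) * weightedAverage w (Metric.ball x₀ R) p f)))) := by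
  have hp0 : 0 < p := by linarith
  have hαn : α < n := by nlinarith
  have hn0 : (0 : ℝ) < n := by linarith
  have hq0 : 0 < q := by
    rw [← one_div_pos, hq, sub_pos, div_lt_div_iff₀ (by positivity) hp0]
    nlinarith
  set B := Metric.ball x₀ R with hB
  have hBm : MeasurableSet B := Metric.isOpen_ball.measurableSet
  set W : (Fin n → ℝ) → ℝ≥0∞ := fun y => ENNReal.ofReal (w (WithLp.toLp 2 y)) with hW
  have hWm : AEMeasurable W := hw.aemeasurable_toLp
  have hWtop : ∀ y, W y < ∞ := fun y => ENNReal.ofReal_lt_top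
  set ν := volume.withDensity W with hνdef
  set B' : Set (Fin n → ℝ) := WithLp.toLp 2 ⁻¹' B with hB'
  have hB'm : MeasurableSet B' := measurableEmbedding_toLp.measurable hBm
  set Q := Metric.ball (WithLp.ofLp x₀) R with hQ
  have hBQ : B' ⊆ Q := toLp_ball_subset x₀ R
  have hνB : ν B' = ∫⁻ x in B, ENNReal.ofReal (w x) := by
    rw [hνdef, withDensity_apply _ hB'm]
    exact setLIntegral_toLp B fun x => ENNReal.ofReal (w x)
  have hνQ : ν Q ≠ ∞ := by
    rw [hνdef, withDensity_apply _ Metric.isOpen_ball.measurableSet]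
    exact hw.lintegral_toLp_ne_top hn _ _
  have hνB0 : ν B' ≠ 0 := by
    intro h
    rw [hνB, lintegral_eq_zero_iff' hw.aemeasurable_ofReal.restrict] at h
    have hfalse : ∀ᵐ x ∂(volume.restrict B), False := by
      filter_upwards [h, ae_restrict_of_ae hw0] with x h1 h2 using h2 h1
    rw [Filter.eventually_false_iff_eq_bot, ae_eq_bot, Measure.restrict_eq_zero] at hfalse
    exact (Metric.measure_ball_pos volume x₀ hR).ne' hfalse
  have hfm : AEStronglyMeasurable (B.indicator f) volume :=
    (aestronglyMeasurable_indicator_iff hBm).2 hf.1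
  have hF₀m : AEMeasurable fun y : Fin n → ℝ => ‖B.indicator f (WithLp.toLp 2 y)‖ₑ :=
    hfm.enorm.comp_quasiMeasurePreserving
      (PiLp.volume_preserving_toLp (Fin n)).quasiMeasurePreserving
  obtain ⟨F₁, hF₁m, hF₁⟩ := hF₀m
  set F := B'.indicator F₁ with hF
  have hFm : Measurable F := hF₁m.indicator hB'm
  have hFae : (fun y => ‖B.indicator f (WithLp.toLp 2 y)‖ₑ) =ᵐ[volume] F := by
    filter_upwards [hF₁] with y hy
    by_cases hyB : y ∈ B'
    · rw [hF, indicator_of_mem hyB, hy]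
    · have : WithLp.toLp 2 y ∉ B := hyB
      rw [hF, indicator_of_notMem hyB, indicator_of_notMem this, enorm_zero]
  have hFsupp : ∀ y ∉ Q, F y = 0 := fun y hy => indicator_of_notMem (fun h => hy (hBQ h)) _
  have hX : ∫⁻ y, F y ^ p ∂ν = ∫⁻ x in B, ‖f x‖ₑ ^ p * ENNReal.ofReal (w x) := by
    rw [hνdef, ← setLIntegral_univ,
      setLIntegral_withDensity_eq_setLIntegral_mul_non_measurable₀ _ hWm.restrict _
        MeasurableSet.univ (Filter.Eventually.of_forall hWtop), Measure.restrict_univ,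
      ← setLIntegral_toLp, ← lintegral_indicator hB'm]
    refine lintegral_congr_ae ?_
    filter_upwards [hFae] with y hy
    rw [Pi.mul_apply, ← hy, mul_comm]
    by_cases hyB : y ∈ B'
    · have : WithLp.toLp 2 y ∈ B := hyB
      rw [indicator_of_mem hyB, indicator_of_mem this]
    · have : WithLp.toLp 2 y ∉ B := hyB
      rw [indicator_of_notMem hyB, indicator_of_notMem this, enorm_zero,
        ENNReal.zero_rpow_of_pos hp0, zero_mul]
  have hcore := cubeRiesz_average_le hα hp hpn hs hsp hq hν hR hνQ hBQ hB'm hνB0 hFm hFsupp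
  rw [hX, ENNReal.mul_rpow_of_nonneg _ _ (by positivity : 0 ≤ 1 / p), hνB] at hcore
  have hint : ∫⁻ y in B', cubeRiesz α F y ^ q ∂ν =
      ∫⁻ x in B, cubeRiesz α F (WithLp.ofLp x) ^ q * ENNReal.ofReal (w x) := by
    rw [hνdef, setLIntegral_withDensity_eq_setLIntegral_mul_non_measurable₀ _ hWm.restrict _
      hB'm (Filter.Eventually.of_forall hWtop), ← setLIntegral_toLp]
    exact lintegral_congr fun y => mul_comm _ _
  rw [hint] at hcore
  have hle := fun x => lintegral_rieszIntegrand_le hαn (B.indicator f) hFae x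
  refine ⟨?_, ?_⟩
  -- An infinite integral would make the left side of `hcore` infinite, while every factor on its
  -- right is finite.
  · have hfin : ∫⁻ x in B, cubeRiesz α F (WithLp.ofLp x) ^ q * ENNReal.ofReal (w x) ≠ ∞ := by
      intro htop
      rw [htop, ENNReal.mul_top (ENNReal.inv_ne_zero.2 (hw.lintegral_ball_ne_top x₀ R)),
        ENNReal.top_rpow_of_pos (by positivity), top_le_iff] at hcore
      revert hcore
      have h1 : N ^ (1 / p) ≠ ∞ := ENNReal.rpow_ne_top_of_nonneg (by positivity) hN
      have h2 : ((∫⁻ x in B, ENNReal.ofReal (w x))⁻¹ *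
          ∫⁻ x in B, ‖f x‖ₑ ^ p * ENNReal.ofReal (w x)) ^ (1 / p) ≠ ∞ :=
        ENNReal.rpow_ne_top_of_nonneg (by positivity) (ENNReal.mul_ne_top
          (ENNReal.inv_ne_top.2 (hνB ▸ hνB0)) hf.2.ne)
      have h3 : ENNReal.ofReal (p / (p - s)) ^ (1 / q) ≠ ∞ :=
        ENNReal.rpow_ne_top_of_nonneg (by positivity) ENNReal.ofReal_ne_top
      exact ENNReal.mul_ne_top ENNReal.ofReal_ne_top (ENNReal.mul_ne_top ENNReal.ofReal_ne_top
        (ENNReal.mul_ne_top (by finiteness) (ENNReal.mul_ne_top h3 (ENNReal.mul_ne_top h1 h2))))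
    have hKm : Measurable (cubeRiesz α F) := by
      have : Measurable fun z : (Fin n → ℝ) × (Fin n → ℝ) =>
          F z.2 * ENNReal.ofReal ((‖z.1 - z.2‖ ^ ((n : ℝ) - α))⁻¹) :=
        (hFm.comp measurable_snd).mul (by fun_prop)
      exact this.lintegral_prod_right'
    have hKm' : Measurable fun x : Rn n => cubeRiesz α F (WithLp.ofLp x) :=
      hKm.comp (PiLp.volume_preserving_ofLp (Fin n)).measurable
    have hae := ae_lt_top' ((hKm'.pow_const q).aemeasurable.mul
      hw.aemeasurable_ofReal).restrict hfin
    filter_upwards [hae, ae_restrict_of_ae hw0] with x hx hx0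
    have hKx : cubeRiesz α F (WithLp.ofLp x) < ∞ := by
      by_contra h
      rw [Pi.mul_apply, not_lt_top_iff.1 h, ENNReal.top_rpow_of_pos hq0,
        ENNReal.top_mul hx0] at hx
      exact lt_irrefl _ hx
    refine ⟨?_, (hle x).trans_lt hKx⟩
    have hmeas : AEMeasurable fun y : Rn n => ‖x - y‖ ^ ((n : ℝ) - α) :=
      Measurable.aemeasurable (by fun_prop)
    exact (hfm.aemeasurable.div hmeas).aestronglyMeasurable
  · refine le_trans ?_ hcore
    rw [weightedAverage]
    gcongr with x
    exact (enorm_integral_le_lintegral_enorm _).trans (hle x)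

/-! ### Choice of the exponent and bookkeeping of constants. -/

/-- The dimensional constant in the fractional integral bounds. -/
noncomputable def rieszConst (n : ℕ) : ℝ :=
  8 ^ n * (2 * n + 4) * (2 * 6 ^ n) * (2 * n ^ n) * 2 ^ (n + 1)

theorem rieszConst_pos (hn : 1 ≤ n) : 0 < rieszConst n := by
  have : (0 : ℝ) < n := by exact_mod_cast hn
  unfold rieszConst
  positivity

theorem ofReal_rieszConst_mul {α P t : ℝ} (hα : 0 < α) (hP : 0 ≤ P) :
    ENNReal.ofReal (rieszConst n / α * P * t) =
      ENNReal.ofReal (8 ^ n) * (ENNReal.ofReal ((2 * n + 4) / α * P) * ((2 * 6 ^ n) *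
        ((2 * n ^ n) * (2 ^ (n + 1) * ENNReal.ofReal t)))) := by
  have e6 : (2 * 6 ^ n : ℝ≥0∞) = ENNReal.ofReal (2 * 6 ^ n) := by
    rw [ENNReal.ofReal_mul (by norm_num), ENNReal.ofReal_pow (by norm_num)]
    simp
  have en : (2 * n ^ n : ℝ≥0∞) = ENNReal.ofReal (2 * n ^ n) := by
    rw [ENNReal.ofReal_mul (by norm_num), ENNReal.ofReal_pow (by positivity)]
    simp
  have e2 : (2 ^ (n + 1) : ℝ≥0∞) = ENNReal.ofReal (2 ^ (n + 1)) := by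
    rw [ENNReal.ofReal_pow (by norm_num)]
    simp
  rw [e6, en, e2, ← ENNReal.ofReal_mul (by positivity), ← ENNReal.ofReal_mul (by positivity),
    ← ENNReal.ofReal_mul (by positivity), ← ENNReal.ofReal_mul (by positivity),
    ← ENNReal.ofReal_mul (by positivity)]
  congr 1
  unfold rieszConst
  field_simp

theorem CubeMuckenhoupt.runMax_le_fujiiWilsonConst {r : ℝ} {N : ℝ≥0∞}
    {W : (Fin n → ℝ) → ℝ≥0∞} {v : Rn n → ℝ≥0∞}
    (h : CubeMuckenhoupt r N W fun y => v (WithLp.toLp 2 y)) (k : ℕ) (c : Fin n → ℝ) {l : ℝ}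
    (hl : 0 < l) :
    ∫⁻ y in Metric.ball c l, runMax (fun y => v (WithLp.toLp 2 y)) k c l 0 y ≤
      fujiiWilsonConst v * ∫⁻ y in Metric.ball c l, v (WithLp.toLp 2 y) := by
  refine le_trans ?_ (setLIntegral_supMax_le c hl (setLIntegral_ne_zero_of_ae h.aemeasurable_dual
    (Filter.Eventually.of_forall h.dual_ne_zero) c hl) (h.lintegral_dual_ne_top c l))
  refine setLIntegral_mono' Metric.isOpen_ball.measurableSet fun y hy => ?_
  simpa using runMax_le_supMax (fun y => v (WithLp.toLp 2 y)) k hl 0 Subset.rfl hy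

/-- Generation zero: the running maximum is the mean itself. This guarantees `K > 1` when `ε =
1/(K-1)` is chosen. -/
theorem CubeMuckenhoupt.one_le_fujiiWilsonConst {r : ℝ} {N : ℝ≥0∞}
    {W : (Fin n → ℝ) → ℝ≥0∞} {v : Rn n → ℝ≥0∞}
    (h : CubeMuckenhoupt r N W fun y => v (WithLp.toLp 2 y)) : 1 ≤ fujiiWilsonConst v := by
  have h1 := h.runMax_le_fujiiWilsonConst 0 0 one_pos
  have h0 := setLIntegral_ne_zero_of_ae h.aemeasurable_dual
    (Filter.Eventually.of_forall h.dual_ne_zero) 0 one_pos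
  simp only [runMax, setLIntegral_const, max_eq_right zero_le, avg_mul_volume _ _ one_pos] at h1
  rw [mul_comm] at h1
  refine (ENNReal.mul_le_mul_iff_right h0 (h.lintegral_dual_ne_top 0 1)).1 ?_
  rwa [mul_one]

theorem fujiiWilsonConst_dualWeight_lt_top (hn : 1 ≤ n) {r : ℝ} (hr : 1 < r) {w : Rn n → ℝ}
    (hw : MemMuckenhoupt r w) : fujiiWilsonConst (dualWeight r w) < ∞ := by
  obtain ⟨C, hC, hbound⟩ := (hw.cubeMuckenhoupt hn hr).exists_supMax_bound
  exact (fujiiWilsonConst_le hbound).trans_lt hC.lt_top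

/-- With `ε = 1/(K-1)` one has `1 + ε = K/(K-1)`, so `s - 1 = (r-1)(K-1)/K`. The factor `2^(n+1)` in
`K` is the `2^n` of dyadic averages times the 2 needed for absorption in `reverse_holder`. -/
theorem MemMuckenhoupt.testCondition (hn : 1 ≤ n) {r : ℝ} (hr : 1 < r) {w : Rn n → ℝ}
    (hw : MemMuckenhoupt r w) {K s : ℝ}
    (hK : K = tau n * (fujiiWilsonConst (dualWeight r w)).toReal)
    (hs : s = (1 + r * (K - 1)) / K) :
    1 < K ∧ 1 < s ∧ s < r ∧ TestCondition
      (volume.withDensity fun y : Fin n → ℝ => ENNReal.ofReal (w (WithLp.toLp 2 y))) s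
      (2 ^ (s - 1) * ((n ^ n) ^ r * muckenhouptConst r w)) := by
  have hM := hw.cubeMuckenhoupt hn hr
  have hfin := fujiiWilsonConst_dualWeight_lt_top hn hr hw
  have hΦ1 := hM.one_le_fujiiWilsonConst
  set Φ := fujiiWilsonConst (dualWeight r w) with hΦ
  have hA1 : 1 ≤ Φ.toReal := by
    simpa using ENNReal.toReal_mono hfin.ne hΦ1
  have hτ : (2 : ℝ) ≤ tau n := by
    rw [tau, pow_succ]
    have : (1 : ℝ) ≤ 2 ^ n := one_le_pow₀ (by norm_num)
    linarith
  have hK1 : 1 < K := by rw [hK]; nlinarith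
  have hK0 : 0 < K := by linarith
  have hs1 : 1 < s := by rw [hs, lt_div_iff₀ hK0]; nlinarith
  have hsr : s < r := by rw [hs, div_lt_iff₀ hK0]; nlinarith
  refine ⟨hK1, hs1, hsr, ?_⟩
  have hε : 0 < 1 / (K - 1) := by rw [one_div_pos]; linarith
  have hK' : K - 1 ≠ 0 := by linarith
  have e : 1 + 1 / (K - 1) = K / (K - 1) := by field_simp; ring
  refine hM.testCondition hs1 hε ?_ ?_
  · rw [e, hs]
    field_simp
    ring
  · intro c l hl
    refine reverse_holder hM.aemeasurable_dual hM.lintegral_dual_ne_top (A := Φ.toNNReal) hε ?_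
      ?_ c hl
    · rw [inv_sub_one_div_one_add hK1, hK, ENNReal.coe_toNNReal_eq_toReal, tau, pow_succ]
      have : Φ.toReal ≠ 0 := by linarith
      field_simp
    · intro k c l hl
      rw [ENNReal.coe_toNNReal hfin.ne]
      exact hM.runMax_le_fujiiWilsonConst k c hl

theorem rpow_le_self_of_one_le {a : ℝ≥0∞} (ha : 1 ≤ a) {t : ℝ} (ht : t ≤ 1) : a ^ t ≤ a :=
  (ENNReal.rpow_le_rpow_of_exponent_le ha ht).trans_eq (ENNReal.rpow_one a)

theorem one_le_natCast_pow (hn : 1 ≤ n) : (1 : ℝ≥0∞) ≤ (n : ℝ≥0∞) ^ n :=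
  one_le_pow₀ (by exact_mod_cast hn)

theorem combine_constants {α R P t : ℝ} (hα : 0 < α) (hP : 0 ≤ P)
    {X Y M Φ Z : ℝ≥0∞} (hX : X ≤ 2 ^ (n + 1) * ENNReal.ofReal t * Φ)
    (hY : Y ≤ 2 * n ^ n * M) :
    ENNReal.ofReal (8 ^ n * R ^ α) * (ENNReal.ofReal ((2 * n + 4) / α * P) *
      ((2 * 6 ^ n) * (X * (Y * Z)))) ≤
      ENNReal.ofReal (rieszConst n / α * P * t) * M * Φ * ENNReal.ofReal (R ^ α) * Z := by
  rw [ofReal_rieszConst_mul hα hP, ENNReal.ofReal_mul (by positivity)]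
  calc _ ≤ ENNReal.ofReal (8 ^ n) * ENNReal.ofReal (R ^ α) *
        (ENNReal.ofReal ((2 * n + 4) / α * P) *
        ((2 * 6 ^ n) * ((2 ^ (n + 1) * ENNReal.ofReal t * Φ) * ((2 * n ^ n * M) * Z)))) := by
        gcongr
    _ = _ := by ring

end LocalRiesz

open LocalRiesz
theorem mainTheorem2 (n : ℕ) (hn : 1 ≤ n) :
    ∃ c : ℝ, 0 < c ∧
      ∀ α p r : ℝ, 0 < α → α < n → 1 < p → p < n / α → 1 ≤ r → r ≤ p →
      ∀ w : Rn n → ℝ, MemMuckenhoupt r w →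
        (1 < r →
          fujiiWilsonConst (dualWeight r w) < ∞ ∧
          ∀ q A : ℝ,
            A = (fujiiWilsonConst (dualWeight r w)).toReal →
            1 / p - 1 / q =
              α / n * (tau n * A / (1 + r * (tau n * A - 1))) →
            ∀ (x₀ : Rn n) (R : ℝ), 0 < R →
            ∀ f : Rn n → ℝ,
              MemWeightedLp w (Metric.ball x₀ R) p f →
              (∀ᵐ x ∂(volume.restrict (Metric.ball x₀ R)),
                Integrable
                  (rieszIntegrand α ((Metric.ball x₀ R).indicator f) x) volume) ∧
              weightedAverage w (Metric.ball x₀ R) q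
                  (rieszPotential α ((Metric.ball x₀ R).indicator f)) ≤
                ENNReal.ofReal
                    (c / α * sobolevExponent n α p * conjExp p ^ (1 / q)) *
                  muckenhouptConst r w ^ (1 / p) *
                  fujiiWilsonConst (dualWeight r w) ^ (1 / q) *
                  ENNReal.ofReal (R ^ α) *
                  weightedAverage w (Metric.ball x₀ R) p f) ∧
        (r = 1 →
          ∀ q : ℝ, q = sobolevExponent n α p →
            ∀ (x₀ : Rn n) (R : ℝ), 0 < R →
            ∀ f : Rn n → ℝ,
              MemWeightedLp w (Metric.ball x₀ R) p f →
              (∀ᵐ x ∂(volume.restrict (Metric.ball x₀ R)),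
                Integrable
                  (rieszIntegrand α ((Metric.ball x₀ R).indicator f) x) volume) ∧
              weightedAverage w (Metric.ball x₀ R) q
                  (rieszPotential α ((Metric.ball x₀ R).indicator f)) ≤
                ENNReal.ofReal
                    (c / α * sobolevExponent n α p * conjExp p ^ (1 / q)) *
                  muckenhouptConst 1 w ^ (1 / p) *
                  ENNReal.ofReal (R ^ α) *
                  weightedAverage w (Metric.ball x₀ R) p f) := by
  have hn0 : (0 : ℝ) < n := by exact_mod_cast hn
  refine ⟨rieszConst n, rieszConst_pos hn, fun α p r hα hαn hp hpn hr1 hrp w hw => ⟨?_, ?_⟩⟩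
  · intro hr
    have hfin := fujiiWilsonConst_dualWeight_lt_top hn hr hw
    refine ⟨hfin, fun q A hA hq x₀ R hR f hf => ?_⟩
    have hp0 : 0 < p := by linarith
    have hαp : α * p < n := by
      rw [lt_div_iff₀ hα] at hpn
      linarith
    set K := tau n * A with hK
    set s := (1 + r * (K - 1)) / K with hs
    obtain ⟨hK1, hs1, hsr, hT⟩ := hw.testCondition hn hr (K := K) (s := s) (by rw [hK, hA]) hs
    have hK0 : 0 < K := by linarith
    have hsp : s < p := by linarith
    -- The fraction defining `q_r` is `1/s`.
    have hq' : 1 / q = 1 / p - α / (n * s) := by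
      have h : α / (n * s) = α / n * (K / (1 + r * (K - 1))) := by
        rw [hs, div_mul_div_comm, mul_div_assoc', div_div_eq_mul_div]
      rw [h, ← hq]
      ring
    have hq0 : 0 < 1 / q := by
      rw [hq', sub_pos, div_lt_div_iff₀ (by positivity) hp0]
      nlinarith
    have hq1 : 1 / q ≤ 1 := by
      have h1 : 1 / p ≤ 1 := by rw [div_le_one hp0]; linarith
      have h2 : 0 ≤ α / (n * s) := by positivity
      linarith
    have hN : 2 ^ (s - 1) * (((n : ℝ≥0∞) ^ n) ^ r * muckenhouptConst r w) ≠ ∞ :=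
      ENNReal.mul_ne_top (ENNReal.rpow_ne_top_of_nonneg (by linarith) (by norm_num))
        (ENNReal.mul_ne_top (ENNReal.rpow_ne_top_of_nonneg (by linarith) (by finiteness)) hw.2.ne)
    obtain ⟨hint, hle⟩ := weightedAverage_rieszPotential_le hα hp hαp hs1.le hsp hq' hn hw.1
      (hw.ae_ne_zero hr) hN hT x₀ hR hf
    refine ⟨hint, hle.trans (combine_constants hα ?_ ?_ ?_)⟩
    · exact div_nonneg (by positivity) (by linarith)
    · have hc0 : 0 < conjExp p := div_pos hp0 (by linarith)
      -- Equivalent to `p - 1 ≤ K (p - s)`, and the difference of the two sides is `(K - 1)(p - r) ≥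
      -- 0`; here `r ≤ p` is essential.
      have hratio : p / (p - s) ≤ conjExp p * K := by
        rw [conjExp, div_mul_eq_mul_div, div_le_div_iff₀ (by linarith) (by linarith)]
        have h1 : K * s = 1 + r * (K - 1) := by rw [hs]; field_simp
        have h2 : 0 ≤ (K - 1) * (p - r) := mul_nonneg (by linarith) (by linarith)
        have h3 : p - 1 ≤ K * (p - s) := by rw [mul_sub, h1]; linarith
        calc p * (p - 1) ≤ p * (K * (p - s)) := by gcongr
          _ = p * K * (p - s) := by ring
      have hKe : ENNReal.ofReal K = 2 ^ (n + 1) * fujiiWilsonConst (dualWeight r w) := by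
        rw [hK, hA, tau, ENNReal.ofReal_mul (by positivity), ENNReal.ofReal_toReal hfin.ne,
          ENNReal.ofReal_pow (by norm_num), ENNReal.ofReal_ofNat]
      calc ENNReal.ofReal (p / (p - s)) ^ (1 / q)
          ≤ (ENNReal.ofReal (conjExp p * K)) ^ (1 / q) :=
            ENNReal.rpow_le_rpow (ENNReal.ofReal_le_ofReal hratio) hq0.le
        _ = (2 ^ (n + 1)) ^ (1 / q) * ENNReal.ofReal (conjExp p ^ (1 / q)) *
            fujiiWilsonConst (dualWeight r w) ^ (1 / q) := by
            rw [ENNReal.ofReal_mul hc0.le, hKe, ENNReal.mul_rpow_of_nonneg _ _ hq0.le,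
              ENNReal.mul_rpow_of_nonneg _ _ hq0.le, ENNReal.ofReal_rpow_of_pos hc0]
            ring
        _ ≤ _ := by
            gcongr
            exact rpow_le_self_of_one_le (one_le_pow₀ (by norm_num)) hq1
    -- The powers `(s-1)/p` of 2 and `r/p` of `n^n` have exponents at most 1, so they leave a
    -- dimensional constant.
    · have hp' : 0 ≤ 1 / p := by positivity
      rw [ENNReal.mul_rpow_of_nonneg _ _ hp', ENNReal.mul_rpow_of_nonneg _ _ hp',
        ← ENNReal.rpow_mul, ← ENNReal.rpow_mul, ← mul_assoc]
      gcongr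
      · refine rpow_le_self_of_one_le (by norm_num) ?_
        rw [mul_one_div, div_le_one hp0]
        linarith
      · refine rpow_le_self_of_one_le (one_le_natCast_pow hn) ?_
        rw [mul_one_div, div_le_one hp0]
        exact hrp
  · rintro rfl q hq x₀ R hR f hf
    have hp0 : 0 < p := by linarith
    have hαp : α * p < n := by
      rw [lt_div_iff₀ hα] at hpn
      linarith
    have hq' : 1 / q = 1 / p - α / (n * 1) := by
      rw [hq, sobolevExponent]
      have : (n : ℝ) - α * p ≠ 0 := by linarith
      field_simp
    have hq0 : 0 < 1 / q := by
      rw [hq', mul_one, sub_pos, div_lt_div_iff₀ hn0 hp0]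
      linarith
    have hN : ((n : ℝ≥0∞) ^ n) * muckenhouptConst 1 w ≠ ∞ :=
      ENNReal.mul_ne_top (by finiteness) hw.2.ne
    obtain ⟨hint, hle⟩ := weightedAverage_rieszPotential_le hα hp hαp le_rfl hp hq' hn hw.1
      (hw.ae_ballMaximal_le.mono fun x hx => hx.1) hN (hw.testCondition_one hn) x₀ hR hf
    have hc0 : 0 < conjExp p := div_pos hp0 (by linarith)
    refine ⟨hint, (hle.trans (combine_constants (M := muckenhouptConst 1 w ^ (1 / p)) (Φ := 1)
      (t := conjExp p ^ (1 / q)) hα ?_ ?_ ?_)).trans_eq (by rw [mul_one])⟩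
    · exact div_nonneg (by positivity) (by linarith)
    · rw [mul_one, ← ENNReal.ofReal_rpow_of_pos hc0]
      exact le_mul_of_one_le_left zero_le (one_le_pow₀ (by norm_num))
    · have hp' : 0 ≤ 1 / p := by positivity
      rw [ENNReal.mul_rpow_of_nonneg _ _ hp']
      gcongr
      refine (rpow_le_self_of_one_le (one_le_natCast_pow hn) ?_).trans
        (le_mul_of_one_le_left zero_le (by norm_num))
      rw [div_le_one hp0]
      linarith
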